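/- **Setting.** Let $\mathbb{H}_2=L^2([0,1]^2)$ be the real $L^2$-space of the uniform distribution on the unit square, and write $(f\otimes g)(u,v)=f(u)g(v)$. Points $z_1,\dots,z_4\in[0,1]^2$, $z_i=(x_i,y_i)$, without ties among the $x_i$ or among the $y_i$, generate the permutation $\Pi_4=r\circ q^{-1}$ of $\{1,2,3,4\}$, where $q_i=\#\{j:x_j\le x_i\}$ and $r_i=\#\{j:y_j\le y_i\}$. In one-line notation let $$D=\{1324,1342,2413,2431,3124,3142,4213,4231\},\qquad E=\{1324,1423,2314,2413,3142,3241,4132,4231\},$$ let $T_4^{A}=\tfrac{\#A}{24}-1_{A}(\Pi_4)$ for $A\in\{D,E\}$, and let $T_4^{DE}=T_4^D+T_4^E$. Let $K(DE):\mathbb{H}_2\to\mathbb{H}_2$ be the integral operator with kernel $$h_2^{DE}(z_1,z_2)=\mathbb{E}\bigl[T_4^{DE}(z_1,z_2,Z_3,Z_4)\bigr],$$ where $Z_3,Z_4$ are independent and uniformly distributed on $[0,1]^2$; that is, $(K(DE)f)(z)=\int_{[0,1]^2}h_2^{DE}(z,w)f(w)\,dw$. **Notation.** Let $\mathbb{N}=\{1,2,\dots\}$.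 * Let $\gamma_1<\gamma_2<\cdots$ be the positive zeros of $\omega(z)=1+\sqrt{3z}\cot\sqrt{3z}$, and $\mu_j=1/\gamma_j$. * For $j\in\mathbb{N}$ and $u\in[0,1]$ let $\varphi_j(u)=\sqrt2\cos(2\pi ju)$ and $$\chi_j(u)=\Bigl(\tfrac12+\tfrac{\mu_j}{3}\Bigr)^{-1/2}\Bigl(\cos\bigl(2\sqrt{3/\mu_j}\,u\bigr)+\sqrt{\mu_j/3}\,\sin\bigl(2\sqrt{3/\mu_j}\,u\bigr)\Bigr),\qquad b_j=\int_0^1\bigl(u-\tfrac12\bigr)\chi_j(u)\,du.$$ * Let $\Lambda=\{\mu_j\mu_k:j,k\in\mathbb{N}\}$ and $\Lambda_<=\{\mu_j\mu_k:j<k\}$. For a real $\lambda$ let $N_\lambda=\{(j,k)\in\mathbb{N}^2:\mu_j\mu_k=\lambda\}$, and let $L_\lambda$ be the space of all $f=\sum_{\ell,m}\alpha_{\ell,m}\,\chi_\ell\otimes\chi_m\in\mathbb{H}_2$ (convergence in $\mathbb{H}_2$) with $6K(DE)f=\lambda f$. * Let $z_1^*<z_2^*<\cdots$ be the elements of $\{1/\lambda:\lambda\in\Lambda\}$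 in increasing order. For real $z\notin\{z_1^*,z_2^*,\dots\}$ let $$\omega_{DE}(z)=1+36z\sum_{(\ell,m)\in\mathbb{N}^2}\frac{b_\ell^2b_m^2}{1-\mu_\ell\mu_mz}.$$ **Proposition.** The positive zeros of $\omega$, the set $\{1/\lambda:\lambda\in\Lambda\}$ and the positive zeros of $\omega_{DE}$ can each be enumerated as a strictly increasing infinite sequence; for the last one, $\hat z_1<\hat z_2<\cdots$, one has $\hat z_i\in(z_i^*,z_{i+1}^*)$ for all $i\in\mathbb{N}$. Put $\hat\lambda_i=1/\hat z_i$. For $\lambda\in\Lambda_<$ the set $N_\lambda$ is finite and $L_\lambda$ has the finite dimension $d_\lambda=\#N_\lambda-1$. For every $i\in\mathbb{N}$ the series $\sum_{(\ell,m)\in\mathbb{N}^2}\frac{b_\ell b_m}{\mu_\ell\mu_m-\hat\lambda_i}\,\chi_\ell\otimes\chi_m$ converges in $\mathbb{H}_2$ to a non-zero function. For each $\lambda\in\Lambda_<$ let $\tau_{\lambda,1},\dots,\tau_{\lambda,d_\lambda}$ be any orthonormal basis of $L_\lambda$, and for each $i\in\mathbb{N}$ let $$\hat f_i=c_i\sum_{(\ell,m)\in\mathbb{N}^2}\frac{b_\ell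 b_m}{\mu_\ell\mu_m-\hat\lambda_i}\,\chi_\ell\otimes\chi_m$$ with any real constant $c_i$ such that $\|\hat f_i\|=1$. Then a complete orthonormal system of eigenfunctions of $K(DE)$, with associated positive eigenvalues, is given by $$\begin{aligned} &\varphi_j\otimes\varphi_k &&\text{with } \tfrac{3}{2\pi^4j^2k^2}, && (j,k)\in\mathbb{N}^2,\\ &\varphi_j\otimes\chi_k &&\text{with } \tfrac{1}{2\pi^2j^2}\,\mu_k, && (j,k)\in\mathbb{N}^2,\\ &\chi_j\otimes\varphi_k &&\text{with } \tfrac{1}{2\pi^2k^2}\,\mu_j, && (j,k)\in\mathbb{N}^2,\\ &\tau_{\lambda,j} &&\text{with } \tfrac16\lambda, && j=1,\dots,d_\lambda,\ \lambda\in\Lambda_<,\\ &\hat f_i &&\text{with } \tfrac16\hat\lambda_i, && i\in\mathbb{N}. \end{aligned}$$ Here complete means that, if $(e_n)$ denotes this orthonormal system and $(\kappa_n)$ the associated eigenvalues, then $K(DE)f=\sum_n\kappa_n\langle f,e_n\rangle e_n$ for all $f\in\mathbb{H}_2$, with unconditional convergence in $\mathbb{H}_2$. -/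

import Mathlib

open MeasureTheory Set
open scoped RealInnerProductSpace

noncomputable section

namespace PatternDE

/-! ### The Hilbert space of the unit square -/

/-- The uniform distribution on the unit interval. -/
def unifI : Measure ℝ := volume.restrict (Icc 0 1)

/-- The uniform distribution on the unit square. -/
def unifSq : Measure (ℝ × ℝ) := unifI.prod unifI

instance : IsProbabilityMeasure unifI := by
  refine ⟨?_⟩
  simp [unifI]

instance : IsProbabilityMeasure unifSq := by
  unfold unifSq; infer_instance

/-- The real Hilbert space of square integrable functions on the unit square. -/
abbrev H2 : Type := Lp ℝ 2 unifSq

/-! ### Integral operators with bounded measurable kernel -/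

section IntegralOperator

variable {α : Type*} [MeasurableSpace α] {μ : Measure α} [IsProbabilityMeasure μ]

theorem integrable_kernel_mul {k : α → α → ℝ} (hk : Measurable (Function.uncurry k)) {C : ℝ}
    (hC : ∀ x y, |k x y| ≤ C) (f : Lp ℝ 2 μ) (x : α) :
    Integrable (fun y => k x y * f y) μ := by
  have hf : Integrable f μ := (Lp.memLp f).integrable (by norm_num)
  exact hf.bdd_mul (hk.of_uncurry_left.aestronglyMeasurable)
    (Filter.Eventually.of_forall fun y => by simpa using hC x y)

theorem abs_integral_kernel_le {k : α → α → ℝ} {C : ℝ}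
    (hC : ∀ x y, |k x y| ≤ C) (f : Lp ℝ 2 μ) (x : α) :
    ‖∫ y, k x y * f y ∂μ‖ ≤ |C| * ‖f‖ := by
  have hf : Integrable f μ := (Lp.memLp f).integrable (by norm_num)
  have h1 : ‖∫ y, k x y * f y ∂μ‖ ≤ ∫ y, |C| * ‖f y‖ ∂μ := by
    refine norm_integral_le_of_norm_le (hf.norm.const_mul _)
      (Filter.Eventually.of_forall fun y => ?_)
    rw [norm_mul]
    exact mul_le_mul_of_nonneg_right ((hC x y).trans (le_abs_self C)) (norm_nonneg _)
  refine h1.trans ?_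
  rw [integral_const_mul]
  refine mul_le_mul_of_nonneg_left ?_ (abs_nonneg C)
  rw [integral_norm_eq_lintegral_enorm hf.1, Lp.norm_def]
  refine ENNReal.toReal_mono (Lp.eLpNorm_ne_top f) ?_
  rw [← eLpNorm_one_eq_lintegral_enorm]
  exact eLpNorm_le_eLpNorm_of_exponent_le (by norm_num) hf.1

theorem memLp_integral_kernel {k : α → α → ℝ} (hk : Measurable (Function.uncurry k)) {C : ℝ}
    (hC : ∀ x y, |k x y| ≤ C) (f : Lp ℝ 2 μ) :
    MemLp (fun x => ∫ y, k x y * f y ∂μ) 2 μ := by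
  refine MemLp.of_bound ?_ (|C| * ‖f‖)
    (Filter.Eventually.of_forall fun x => abs_integral_kernel_le hC f x)
  have hm : StronglyMeasurable (Function.uncurry fun x y => k x y * f y) :=
    hk.stronglyMeasurable.mul ((Lp.stronglyMeasurable f).comp_measurable measurable_snd)
  exact hm.integral_prod_right.aestronglyMeasurable

/-- The integral operator `(K f)(x) = ∫ k(x, y) f(y) μ(dy)` on `L²(μ)`, for a bounded measurable
kernel `k`. -/
def integralOp (k : α → α → ℝ) (hk : Measurable (Function.uncurry k)) (C : ℝ)
    (hC : ∀ x y, |k x y| ≤ C) : Lp ℝ 2 μ →L[ℝ] Lp ℝ 2 μ :=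
  LinearMap.mkContinuous
    { toFun := fun f => (memLp_integral_kernel hk hC f).toLp _
      map_add' := by
        intro f g
        rw [← MemLp.toLp_add]
        congr 1
        funext x
        rw [Pi.add_apply, ← integral_add (integrable_kernel_mul hk hC f x)
          (integrable_kernel_mul hk hC g x)]
        refine integral_congr_ae ?_
        filter_upwards [Lp.coeFn_add f g] with y hy
        rw [hy, Pi.add_apply, mul_add]
      map_smul' := by
        intro a f
        rw [RingHom.id_apply, ← MemLp.toLp_const_smul]
        congr 1
        funext x
        rw [Pi.smul_apply, smul_eq_mul, ← integral_const_mul]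
        refine integral_congr_ae ?_
        filter_upwards [Lp.coeFn_smul a f] with y hy
        rw [hy, Pi.smul_apply, smul_eq_mul]
        ring }
    |C| (by
      intro f
      refine Lp.norm_le_of_ae_bound (C := |C| * ‖f‖) (by positivity) ?_ |>.trans ?_
      · filter_upwards [MemLp.coeFn_toLp (memLp_integral_kernel hk hC f)] with x hx
        exact hx ▸ abs_integral_kernel_le hC f x
      · simp [measureUnivNNReal])

theorem integralOp_apply_ae (k : α → α → ℝ) (hk : Measurable (Function.uncurry k)) (C : ℝ)
    (hC : ∀ x y, |k x y| ≤ C) (f : Lp ℝ 2 μ) :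
    integralOp k hk C hC f =ᵐ[μ] fun x => ∫ y, k x y * f y ∂μ :=
  MemLp.coeFn_toLp (memLp_integral_kernel hk hC f)

end IntegralOperator

/-! ### The test statistics for samples of size four, and the kernel -/

/-- The rank of `x i` among `x 0, …, x 3`, a number in `{1, 2, 3, 4}`. -/
def rk (x : Fin 4 → ℝ) (i : Fin 4) : ℕ := (Finset.univ.filter fun j => x j ≤ x i).card

/-- The permutation `r ∘ q⁻¹` generated by the points `z 0, …, z 3` (with `q` and `r` the rank
vectors of the first and of the second coordinates) has the one-line notation
`w 0, w 1, w 2, w 3`: a point with first rank `p + 1` has second rank `w p`. -/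
def HasPattern (w : Fin 4 → ℕ) (z : Fin 4 → ℝ × ℝ) : Prop :=
  ∀ i p : Fin 4, rk (fun m => (z m).1) i = p.1 + 1 → rk (fun m => (z m).2) i = w p

/-- The pattern set `D`. -/
def setD : Finset (Fin 4 → ℕ) :=
  {![1, 3, 2, 4], ![1, 3, 4, 2], ![2, 4, 1, 3], ![2, 4, 3, 1],
   ![3, 1, 2, 4], ![3, 1, 4, 2], ![4, 2, 1, 3], ![4, 2, 3, 1]}

/-- The pattern set `E`; it consists of the inverses of the elements of `D`. -/
def setE : Finset (Fin 4 → ℕ) :=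
  {![1, 3, 2, 4], ![1, 4, 2, 3], ![2, 3, 1, 4], ![2, 4, 1, 3],
   ![3, 1, 4, 2], ![3, 2, 4, 1], ![4, 1, 3, 2], ![4, 2, 3, 1]}

open Classical in
/-- For `A = D` and `A = E`, the test statistic `T₄^A = #A / 24 - L_A(Π₄)` of a sample of size
four, where `L_A(Π₄)` counts the elements of `A` that are equal to the permutation `Π₄` generated
by the sample. -/
def statT (A : Finset (Fin 4 → ℕ)) (z : Fin 4 → ℝ × ℝ) : ℝ :=
  (A.card : ℝ) / 24 - ∑ w ∈ A, if HasPattern w z then 1 else 0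

/-- `T₄^{DE} = T₄^D + T₄^E`. -/
def statDE (z : Fin 4 → ℝ × ℝ) : ℝ := statT setD z + statT setE z

/-- The kernel `h₂(z₁, z₂) = E[T₄^{DE}(z₁, z₂, Z₃, Z₄)]`, where `Z₃` and `Z₄` are independent and
uniformly distributed on the unit square. -/
def kernelDE (z₁ z₂ : ℝ × ℝ) : ℝ :=
  ∫ z₃, ∫ z₄, statDE ![z₁, z₂, z₃, z₄] ∂unifSq ∂unifSq

theorem measurable_rk (i : Fin 4) : Measurable fun x : Fin 4 → ℝ => rk x i := by
  simp only [rk, Finset.card_filter]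
  refine Finset.measurable_sum _ fun j _ => ?_
  exact Measurable.ite (measurableSet_le (measurable_pi_apply j) (measurable_pi_apply i))
    measurable_const measurable_const

theorem measurableSet_hasPattern (w : Fin 4 → ℕ) : MeasurableSet {z | HasPattern w z} := by
  have h1 : ∀ i : Fin 4, Measurable fun z : Fin 4 → ℝ × ℝ => rk (fun m => (z m).1) i :=
    fun i => (measurable_rk i).comp (by fun_prop)
  have h2 : ∀ i : Fin 4, Measurable fun z : Fin 4 → ℝ × ℝ => rk (fun m => (z m).2) i :=
    fun i => (measurable_rk i).comp (by fun_prop)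
  simp only [HasPattern, ofPred_forall]
  refine MeasurableSet.iInter fun i => MeasurableSet.iInter fun p => ?_
  exact ((h1 i) (measurableSet_singleton (p.1 + 1))).himp
    ((h2 i) (measurableSet_singleton (w p)))

theorem measurable_statT (A : Finset (Fin 4 → ℕ)) : Measurable (statT A) := by
  classical
  unfold statT
  refine measurable_const.sub (Finset.measurable_sum _ fun w _ => ?_)
  exact Measurable.ite (measurableSet_hasPattern w) measurable_const measurable_const

theorem measurable_statDE : Measurable statDE :=
  (measurable_statT setD).add (measurable_statT setE)

theorem abs_statT_le (A : Finset (Fin 4 → ℕ)) (z : Fin 4 → ℝ × ℝ) :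
    |statT A z| ≤ 2 * A.card := by
  classical
  unfold statT
  have h0 : (0 : ℝ) ≤ ∑ w ∈ A, if HasPattern w z then (1 : ℝ) else 0 :=
    Finset.sum_nonneg fun w _ => by split_ifs <;> norm_num
  have h1 : (∑ w ∈ A, if HasPattern w z then (1 : ℝ) else 0) ≤ A.card := by
    refine (Finset.sum_le_card_nsmul A _ 1 fun w _ => by split_ifs <;> norm_num).trans ?_
    simp
  have h2 : (0 : ℝ) ≤ A.card := Nat.cast_nonneg _
  rw [abs_le]
  constructor <;> linarith

theorem abs_statDE_le (z : Fin 4 → ℝ × ℝ) : |statDE z| ≤ 32 := by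
  have hD : setD.card = 8 := by decide
  have hE : setE.card = 8 := by decide
  have h1 := abs_statT_le setD z
  have h2 := abs_statT_le setE z
  rw [hD] at h1
  rw [hE] at h2
  refine (abs_add_le _ _).trans ?_
  push_cast at h1 h2
  linarith

theorem measurable_kernelDE : Measurable (Function.uncurry kernelDE) := by
  have h : Measurable fun q : (((ℝ × ℝ) × (ℝ × ℝ)) × (ℝ × ℝ)) × (ℝ × ℝ) =>
      statDE ![q.1.1.1, q.1.1.2, q.1.2, q.2] := by
    refine measurable_statDE.comp (measurable_pi_iff.2 fun i => ?_)
    fin_cases i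
    · exact measurable_fst.comp (measurable_fst.comp measurable_fst)
    · exact measurable_snd.comp (measurable_fst.comp measurable_fst)
    · exact measurable_snd.comp measurable_fst
    · exact measurable_snd
  have h3 := (h.stronglyMeasurable.integral_prod_right' (ν := unifSq))
  exact (h3.integral_prod_right' (ν := unifSq)).measurable

theorem abs_kernelDE_le (z₁ z₂ : ℝ × ℝ) : |kernelDE z₁ z₂| ≤ 32 := by
  have h : ∀ z₃, ‖∫ z₄, statDE ![z₁, z₂, z₃, z₄] ∂unifSq‖ ≤ 32 := fun z₃ => by
    simpa using norm_integral_le_of_norm_le_const (μ := unifSq)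
      (Filter.Eventually.of_forall fun z₄ => (Real.norm_eq_abs _).trans_le
        (abs_statDE_le ![z₁, z₂, z₃, z₄]))
  simpa [kernelDE] using norm_integral_le_of_norm_le_const (μ := unifSq)
    (Filter.Eventually.of_forall h)

/-- The Hilbert-Schmidt operator `K(DE)` on `L²([0,1]²)` with the kernel `h₂`. -/
def KDE : H2 →L[ℝ] H2 := integralOp kernelDE measurable_kernelDE 32 abs_kernelDE_le

/-! ### The building blocks

All sequences are indexed by `ℕ = {0, 1, …}`: the object with index `j` here is the `(j + 1)`-st
object of the sequence indexed by `{1, 2, …}`. -/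

/-- The elements of a set `S` of real numbers enumerated in increasing order:
`nthSmallest S n` is the `(n + 1)`-st smallest element of `S`. -/
def nthSmallest (S : Set ℝ) : ℕ → ℝ
  | 0 => sInf S
  | n + 1 => sInf {x ∈ S | nthSmallest S n < x}

/-- The function `ω(z) = 1 + √(3z) cot √(3z)`. At a pole of the cotangent the value here is `1`, so
that poles do not count as zeros. -/
def omega (z : ℝ) : ℝ := 1 + Real.sqrt (3 * z) * Real.cot (Real.sqrt (3 * z))

/-- The positive zeros of `ω`. -/
def omegaZeros : Set ℝ := {z | 0 < z ∧ omega z = 0}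

/-- `γ_{j+1}`: the positive zeros of `ω` in increasing order. -/
def gam (j : ℕ) : ℝ := nthSmallest omegaZeros j

/-- `μ_{j+1} = 1 / γ_{j+1}`. -/
def mu (j : ℕ) : ℝ := 1 / gam j

/-- `φ_{j+1}(u) = √2 cos(2 π (j+1) u)`. -/
def phi (j : ℕ) : C(ℝ, ℝ) where
  toFun u := Real.sqrt 2 * Real.cos (2 * Real.pi * (j + 1) * u)
  continuous_toFun := by fun_prop

/-- `χ_{j+1}(u) = c (cos(2 √(3/μ) u) + √(μ/3) sin(2 √(3/μ) u))`, with `μ = μ_{j+1}` and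
`c = (1/2 + μ/3)^(-1/2)`. -/
def chi (j : ℕ) : C(ℝ, ℝ) where
  toFun u := (Real.sqrt (1 / 2 + mu j / 3))⁻¹ *
    (Real.cos (2 * Real.sqrt (3 / mu j) * u)
      + Real.sqrt (mu j / 3) * Real.sin (2 * Real.sqrt (3 / mu j) * u))
  continuous_toFun := by fun_prop

theorem memLp_tensor (f g : C(ℝ, ℝ)) : MemLp (fun p : ℝ × ℝ => f p.1 * g p.2) 2 unifSq := by
  have hc : Continuous fun p : ℝ × ℝ => f p.1 * g p.2 := by fun_prop
  obtain ⟨C, hC⟩ := (isCompact_Icc.prod isCompact_Icc :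
    IsCompact (Icc (0 : ℝ) 1 ×ˢ Icc (0 : ℝ) 1)).exists_bound_of_continuousOn hc.continuousOn
  refine MemLp.of_bound hc.aestronglyMeasurable C ?_
  rw [unifSq, unifI, Measure.prod_restrict]
  exact (ae_restrict_mem (measurableSet_Icc.prod measurableSet_Icc)).mono hC

/-- The tensor product `f ⊗ g`, that is `(u, v) ↦ f(u) g(v)`, as an element of `L²([0,1]²)`. -/
def tensor (f g : C(ℝ, ℝ)) : H2 := (memLp_tensor f g).toLp _

/-- `b_{j+1} = ∫₀¹ (u - 1/2) χ_{j+1}(u) du`. -/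
def bcoef (j : ℕ) : ℝ := ∫ u in (0 : ℝ)..1, (u - 1 / 2) * chi j u

/-! ### The spaces `L_λ` -/

/-- `Λ = {μ_j μ_k : j, k}`. -/
def Lam : Set ℝ := {l | ∃ j k : ℕ, mu j * mu k = l}

/-- `Λ_< = {μ_j μ_k : j < k}`. -/
def LamLt : Set ℝ := {l | ∃ j k : ℕ, j < k ∧ mu j * mu k = l}

/-- `N_λ = {(j, k) : μ_j μ_k = λ}`. -/
def Nset (l : ℝ) : Set (ℕ × ℕ) := {p | mu p.1 * mu p.2 = l}

/-- The space `L_λ` of the functions `f = ∑ α_{ℓ,m} χ_ℓ ⊗ χ_m` in `L²([0,1]²)`, that is, of the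
elements of the closed linear span of the `χ_ℓ ⊗ χ_m`, for which `6 K(DE) f = λ f`. -/
def Lspace (l : ℝ) : Submodule ℝ H2 :=
  (Submodule.span ℝ (range fun p : ℕ × ℕ => tensor (chi p.1) (chi p.2))).topologicalClosure ⊓
    Module.End.eigenspace ((6 : ℝ) • KDE).toLinearMap l

/-! ### The secular function -/

/-- The secular function `ω_{DE}(z) = 1 + 36 z ∑_{ℓ,m} b_ℓ² b_m² / (1 - μ_ℓ μ_m z)`; its poles are
the points `1 / λ` with `λ ∈ Λ`. -/
def omegaDE (z : ℝ) : ℝ :=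
  1 + 36 * z * ∑' p : ℕ × ℕ, bcoef p.1 ^ 2 * bcoef p.2 ^ 2 / (1 - mu p.1 * mu p.2 * z)

/-- The poles of the secular function. -/
def poles : Set ℝ := {z | ∃ l ∈ Lam, z = 1 / l}

/-- `z*_{i+1}`: the poles of the secular function in increasing order. -/
def zStar (i : ℕ) : ℝ := nthSmallest poles i

/-- The positive zeros of the secular function. Poles are excluded explicitly, since division by
zero returns a finite value. -/
def omegaDEZeros : Set ℝ := {z | 0 < z ∧ z ∉ poles ∧ omegaDE z = 0}

/-- The positive zeros of the secular function in increasing order. -/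
def zHat (i : ℕ) : ℝ := nthSmallest omegaDEZeros i

/-- The reciprocal of the `(i+1)`-st positive zero of the secular function. -/
def lamHat (i : ℕ) : ℝ := 1 / zHat i

/-- The terms of the series that defines the eigenfunction belonging to `lamHat i`, up to
normalization. -/
def fHatTerm (i : ℕ) (p : ℕ × ℕ) : H2 :=
  (bcoef p.1 * bcoef p.2 / (mu p.1 * mu p.2 - lamHat i)) • tensor (chi p.1) (chi p.2)

/-- The eigenfunction belonging to `lamHat i`, with normalizing constant `c i`. -/
def fHat (c : ℕ → ℝ) (i : ℕ) : H2 := c i • ∑' p : ℕ × ℕ, fHatTerm i p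

/-! ### The eigensystem -/

/-- The index set of the five families of eigenfunctions. -/
inductive EigIndex : Type
  | phiPhi (j k : ℕ)
  | phiChi (j k : ℕ)
  | chiPhi (j k : ℕ)
  | tau (l : LamLt) (j : Fin (Module.finrank ℝ (Lspace l)))
  | hat (i : ℕ)

/-- The eigenfunctions. -/
def eigFun (τ : ∀ l : LamLt, OrthonormalBasis (Fin (Module.finrank ℝ (Lspace l))) ℝ (Lspace l))
    (c : ℕ → ℝ) : EigIndex → H2
  | .phiPhi j k => tensor (phi j) (phi k)
  | .phiChi j k => tensor (phi j) (chi k)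
  | .chiPhi j k => tensor (chi j) (phi k)
  | .tau l j => (τ l j : H2)
  | .hat i => fHat c i

/-- The eigenvalues. -/
def eigVal : EigIndex → ℝ
  | .phiPhi j k => 3 / (2 * Real.pi ^ 4 * ((j : ℝ) + 1) ^ 2 * ((k : ℝ) + 1) ^ 2)
  | .phiChi j k => 1 / (2 * Real.pi ^ 2 * ((j : ℝ) + 1) ^ 2) * mu k
  | .chiPhi j k => 1 / (2 * Real.pi ^ 2 * ((k : ℝ) + 1) ^ 2) * mu j
  | .tau l _ => 1 / 6 * (l : ℝ)
  | .hat i => 1 / 6 * lamHat i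

/-- The family `e` is a complete orthonormal system of eigenvectors of `K`, with the positive
eigenvalues `ev`: it gives the spectral representation `K f = ∑ ev i ⟨f, e i⟩ e i`. -/
structure IsCompleteEigensystem {ι : Type*} {H : Type*} [NormedAddCommGroup H]
    [InnerProductSpace ℝ H] (K : H →L[ℝ] H) (e : ι → H) (ev : ι → ℝ) : Prop where
  orthonormal : Orthonormal ℝ e
  pos : ∀ i, 0 < ev i
  eigen : ∀ i, K (e i) = ev i • e i
  complete : ∀ f, HasSum (fun i => (ev i * ⟪f, e i⟫) • e i) (K f)

end PatternDE

end

open PatternDE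

namespace PatternDE

/-! ### Enumeration of discrete sets -/

/-! The patterns compare pairings of four points. The ranks 1, 2, 3, 4 split into halves {1,2},
{3,4} or into parity classes {1,3}, {2,4}; `D` consists of the permutations that carry the first
splitting to the second, and `E` of those that carry the second to the first. Hence the statistic is
2/3 minus a sum, over the three pairings of the points, of products of a function of the abscissas
and a function of the ordinates (`statDE_eq`). Averaging over the last two points gives, off the
ties, 6 h₂ = k ⊗ k - 36 (c ⊗ c)(c ⊗ c), where c(u) = u - 1/2 and k(u,v) = 6 B₂(|u-v|) + 6 c(u) c(v)
(`kernelDE_eq`). With T the operator of kernel k, this says 6 K(DE) = T ⊗ T - 36 ⟨c ⊗ c, ·⟩ c ⊗ c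
(`opDE_apply`).

The Fourier series of B₂ writes T as a positive combination of the projections on the cosines φ_j
and the sines ψ_j, plus 6 ⟨c, ·⟩ c. The φ_j are orthogonal to everything else and stay
eigenfunctions. On the functions odd about 1/2, T maps sin(2s(u - 1/2)) to 3/s² times itself minus a
multiple of (sin s + s cos s) c (`opI_osc`); the zeros of that factor give the χ_j with eigenvalues
μ_j = 3/s². Every vector orthogonal to all φ_j and χ_j is killed by T (`opI_eq_zero_of_orthogonal`).

Since c ⟂ φ_j, tensor products containing some φ_j are untouched by the rank one term. For an
eigenfunction f of 6 K(DE) with eigenvalue λ, the coefficients on χ_ℓ ⊗ χ_m satisfy (μ_ℓ μ_m - λ) a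
= 36 ⟨c ⊗ c, f⟩ b_ℓ b_m (`sub_mul_inner_chiSq`), and no b_j vanishes. If λ is some μ_ℓ μ_m, this
forces ⟨c ⊗ c, f⟩ = 0, a single linear condition on the coordinates in N_λ, so L_λ has dimension
#N_λ - 1 (`finrank_Lspace`). Otherwise, if ⟨c ⊗ c, f⟩ ≠ 0, multiplying by b_ℓ b_m and summing gives
the secular equation ω_DE(1/λ) = 0. The function ω_DE increases from -∞ to +∞ between consecutive
poles and is positive below the first, so it has exactly one zero per gap (`zHat_spec`).

Completeness uses the spectral theorem in the form `apply_eq_zero_of_orthogonal_eigenvectors`: a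
vector orthogonal to every eigenvector with non-zero eigenvalue is in the kernel. The case
distinction above shows that a vector orthogonal to the listed functions has this property
(`opDE_eq_zero_of_forall`). -/

theorem nthSmallest_eq_of_strictMono {a : ℕ → ℝ} {S : Set ℝ} (ha : StrictMono a)
    (hS : range a = S) : nthSmallest S = a := by
  funext n
  induction n with
  | zero =>
    refine IsLeast.csInf_eq ⟨hS ▸ mem_range_self 0, ?_⟩
    rintro x hx
    obtain ⟨m, rfl⟩ := hS ▸ hx
    exact ha.monotone (Nat.zero_le m)
  | succ n ih =>
    refine IsLeast.csInf_eq ⟨⟨hS ▸ mem_range_self (n + 1), ?_⟩, ?_⟩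
    · rw [ih]; exact ha (Nat.lt_succ_self n)
    · rintro x ⟨hx, hlt⟩
      obtain ⟨m, rfl⟩ := hS ▸ hx
      rw [ih] at hlt
      exact ha.monotone (ha.lt_iff_lt.1 hlt)

theorem exists_isLeast_of_finite_inter_Iic {S T : Set ℝ} (hfin : ∀ x, (S ∩ Iic x).Finite)
    (hT : T ⊆ S) (hne : T.Nonempty) : ∃ x, IsLeast T x := by
  obtain ⟨y, hy⟩ := hne
  have hf : (T ∩ Iic y).Finite := (hfin y).subset (inter_subset_inter_left _ hT)
  obtain ⟨x, hx, hmin⟩ := hf.exists_minimalFor id _ ⟨y, hy, le_refl y⟩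
  refine ⟨x, hx.1, fun z hz => ?_⟩
  rcases le_total z y with h | h
  · exact (le_total x z).elim id fun h' => hmin ⟨hz, h⟩ h'
  · exact le_trans hx.2 h

/-- Local finiteness from below makes every infimum in the recursion attained, and infinitude keeps
the remaining sets non-empty. An element that is never reached would be an upper bound for
infinitely many elements of `S`. -/
theorem nthSmallest_strictMono_range {S : Set ℝ} (hinf : S.Infinite)
    (hfin : ∀ x, (S ∩ Iic x).Finite) :
    StrictMono (nthSmallest S) ∧ range (nthSmallest S) = S := by
  have hne : ∀ x, {y ∈ S | x < y}.Nonempty := fun x => by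
    by_contra h
    rw [not_nonempty_iff_eq_empty] at h
    refine hinf ((hfin x).subset fun y hy => ⟨hy, ?_⟩)
    by_contra hxy
    exact (h ▸ (⟨hy, not_le.1 hxy⟩ : y ∈ {y ∈ S | x < y}) : y ∈ (∅ : Set ℝ))
  have h0 : IsLeast S (nthSmallest S 0) := by
    obtain ⟨x, hx⟩ := exists_isLeast_of_finite_inter_Iic hfin Subset.rfl hinf.nonempty
    have : nthSmallest S 0 = x := hx.csInf_eq
    rwa [this]
  have hs : ∀ n, IsLeast {y ∈ S | nthSmallest S n < y} (nthSmallest S (n + 1)) := fun n => by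
    obtain ⟨x, hx⟩ := exists_isLeast_of_finite_inter_Iic hfin (sep_subset _ _)
      (hne (nthSmallest S n))
    have : nthSmallest S (n + 1) = x := hx.csInf_eq
    rwa [this]
  have hmono : StrictMono (nthSmallest S) := strictMono_nat_of_lt_succ fun n => (hs n).1.2
  have hsub : ∀ n, nthSmallest S n ∈ S := fun n => by
    cases n with
    | zero => exact h0.1
    | succ n => exact (hs n).1.1
  refine ⟨hmono, Subset.antisymm (range_subset_iff.2 hsub) fun x hx => ?_⟩
  by_contra hxr
  have hlt : ∀ n, nthSmallest S n < x := fun n => by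
    induction n with
    | zero => exact lt_of_le_of_ne (h0.2 hx) fun h => hxr ⟨0, h⟩
    | succ n ih => exact lt_of_le_of_ne ((hs n).2 ⟨hx, ih⟩) fun h => hxr ⟨n + 1, h⟩
  exact (infinite_range_of_injective hmono.injective)
    ((hfin x).subset (range_subset_iff.2 fun n => ⟨hsub n, (hlt n).le⟩))

/-! ### Orthonormal families and compact symmetric operators -/

section Hilbert

variable {H : Type*} [NormedAddCommGroup H] [InnerProductSpace ℝ H] [CompleteSpace H]
variable {ι : Type*}

theorem summable_smul_of_orthonormal {e : ι → H} (he : Orthonormal ℝ e) {a : ι → ℝ}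
    (ha : Summable fun i => a i ^ 2) : Summable fun i => a i • e i := by
  have := (he.orthogonalFamily.summable_iff_norm_sq_summable (f := fun i => (a i : ℝ))).2
    (by simpa using ha)
  simpa using this

theorem inner_tsum_of_orthonormal {e : ι → H} (he : Orthonormal ℝ e) {a : ι → ℝ}
    (ha : Summable fun i => a i ^ 2) (j : ι) : ⟪e j, ∑' i, a i • e i⟫ = a j := by
  classical
  have h := (summable_smul_of_orthonormal he ha).hasSum.mapL (innerSL ℝ (e j))
  have h2 : HasSum (fun i => innerSL ℝ (e j) (a i • e i)) (a j) := by
    convert hasSum_ite_eq j (a j) using 2 with i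
    rw [innerSL_apply_apply, inner_smul_right, orthonormal_iff_ite.1 he]
    by_cases hij : i = j
    · subst hij; simp
    · simp [hij, Ne.symm hij]
  simpa using h.unique h2

omit [CompleteSpace H] in
theorem summable_sq_inner_of_orthonormal {e : ι → H} (he : Orthonormal ℝ e) (f : H) :
    Summable fun i => ⟪e i, f⟫ ^ 2 := by
  simpa using he.inner_products_summable f

/-- The hypothesis puts `f` in the double orthogonal complement of the family. The residual of the
Fourier series is orthogonal to each `e i`, hence to `f` by hypothesis and to the sum of the series
by continuity, hence to itself. -/
theorem hasSum_inner_smul_of_forall_orthogonal {e : ι → H} (he : Orthonormal ℝ e) {f : H}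
    (hf : ∀ h : H, (∀ i, ⟪e i, h⟫ = 0) → ⟪h, f⟫ = 0) :
    HasSum (fun i => ⟪e i, f⟫ • e i) f := by
  have hs := summable_sq_inner_of_orthonormal he f
  obtain ⟨g, hg⟩ := summable_smul_of_orthonormal he hs
  have h2 : ∀ i, ⟪e i, f - g⟫ = 0 := fun i => by
    rw [inner_sub_right, ← hg.tsum_eq, inner_tsum_of_orthonormal he hs, sub_self]
  have h3 : ⟪f - g, g⟫ = 0 := by
    have h0 : HasSum (fun i => innerSL ℝ (f - g) (⟪e i, f⟫ • e i)) 0 := by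
      convert hasSum_zero using 2 with i
      rw [innerSL_apply_apply, inner_smul_right, real_inner_comm (e i) (f - g), h2, mul_zero]
    exact (hg.mapL (innerSL ℝ (f - g))).unique h0
  have h4 : ⟪f - g, f - g⟫ = 0 := by rw [inner_sub_right, hf _ h2, h3, sub_self]
  rwa [← sub_eq_zero.1 (inner_self_eq_zero.1 h4)] at hg

/-- The family need not span `H`: it suffices that `T` kills its orthogonal complement, because then
`T f` only depends on the projection of `f`. -/
theorem hasSum_of_eigenvectors {T : H →L[ℝ] H} {e : ι → H} (he : Orthonormal ℝ e) {ev : ι → ℝ}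
    (hev : ∀ i, T (e i) = ev i • e i) (hker : ∀ h, (∀ i, ⟪e i, h⟫ = 0) → T h = 0) (f : H) :
    HasSum (fun i => (ev i * ⟪f, e i⟫) • e i) (T f) := by
  have hs := summable_sq_inner_of_orthonormal he f
  have h1 := summable_smul_of_orthonormal he hs
  have h2 : ∀ i, ⟪e i, f - ∑' i, ⟪e i, f⟫ • e i⟫ = 0 := fun i => by
    rw [inner_sub_right, inner_tsum_of_orthonormal he hs, sub_self]
  have h3 : T f = T (∑' i, ⟪e i, f⟫ • e i) := by
    rw [← sub_eq_zero, ← map_sub]; exact hker _ h2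
  rw [h3]
  convert h1.hasSum.mapL T using 2 with i
  rw [map_smul, hev, smul_smul, real_inner_comm, mul_comm]

/-- By symmetry `T h` is orthogonal to every eigenspace, including that of 0, and for a compact
symmetric operator the eigenspaces have trivial common orthogonal complement. -/
theorem apply_eq_zero_of_orthogonal_eigenvectors {T : H →L[ℝ] H} (hc : IsCompactOperator T)
    (hs : T.IsSymmetric) {h : H} (hh : ∀ (l : ℝ) (f : H), l ≠ 0 → T f = l • f → ⟪h, f⟫ = 0) :
    T h = 0 := by
  have key := T.orthogonalComplement_iSup_eigenspaces_eq_bot hc hs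
  rw [← Submodule.mem_bot ℝ, ← key, Submodule.mem_orthogonal']
  intro u hu
  induction hu using Submodule.iSup_induction' with
  | mem l f hf =>
    have hf' : T f = l • f := Module.End.mem_eigenspace_iff.1 hf
    have h1 : ⟪T h, f⟫ = l * ⟪h, f⟫ := by
      rw [← inner_smul_right, ← hf']; exact hs h f
    rw [h1]
    by_cases hl : l = 0
    · simp [hl]
    · rw [hh l f hl hf', mul_zero]
  | zero => simp
  | add x y _ _ hx hy => rw [inner_add_right, hx, hy, add_zero]

/-- The operator `∑ c i ⟨a i, ·⟩ a i`. -/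
noncomputable def symOp (c : ι → ℝ) (a : ι → H) : H →L[ℝ] H :=
  ∑' i, c i • InnerProductSpace.rankOne ℝ (a i) (a i)

variable {c : ι → ℝ} {a : ι → H} {B : ℝ}

theorem hasSum_symOp (hc : Summable c) (hB : ∀ i, ‖a i‖ ≤ B) :
    HasSum (fun i => c i • InnerProductSpace.rankOne ℝ (a i) (a i)) (symOp c a) := by
  refine Summable.hasSum ?_
  refine Summable.of_norm_bounded (hc.abs.mul_right (B * B)) fun i => ?_
  rw [norm_smul, InnerProductSpace.norm_rankOne, Real.norm_eq_abs]
  gcongr <;> first | exact hB i | exact (norm_nonneg _).trans (hB i)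

theorem hasSum_symOp_apply (hc : Summable c) (hB : ∀ i, ‖a i‖ ≤ B) (f : H) :
    HasSum (fun i => (c i * ⟪a i, f⟫) • a i) (symOp c a f) := by
  have := (hasSum_symOp hc hB).mapL (ContinuousLinearMap.apply ℝ H f)
  simpa [smul_smul] using this

theorem hasSum_inner_symOp (hc : Summable c) (hB : ∀ i, ‖a i‖ ≤ B) (h f : H) :
    HasSum (fun i => c i * ⟪a i, f⟫ * ⟪a i, h⟫) ⟪h, symOp c a f⟫ := by
  have := (hasSum_symOp_apply hc hB f).mapL (innerSL ℝ h)
  simpa [inner_smul_right, real_inner_comm] using this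

theorem isSymmetric_symOp (hc : Summable c) (hB : ∀ i, ‖a i‖ ≤ B) :
    (symOp c a).IsSymmetric := by
  intro f h
  have h1 := hasSum_inner_symOp hc hB f h
  have h2 := hasSum_inner_symOp hc hB h f
  have : ⟪symOp c a f, h⟫ = ⟪f, symOp c a h⟫ := by
    rw [real_inner_comm]
    refine h2.unique ?_
    convert h1 using 2 with i
    ring
  exact this

omit [CompleteSpace H] in
theorem isCompactOperator_rankOne (x y : H) :
    IsCompactOperator (InnerProductSpace.rankOne ℝ x y) := by
  rw [InnerProductSpace.rankOne_def']
  exact (isCompactOperator_of_locallyCompactSpace_rng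
    (ContinuousLinearMap.toSpanSingleton ℝ x)).comp_clm (innerSL ℝ y)

theorem isCompactOperator_symOp (hc : Summable c) (hB : ∀ i, ‖a i‖ ≤ B) :
    IsCompactOperator (symOp c a) := by
  refine isCompactOperator_of_tendsto (hasSum_symOp hc hB) (Filter.Eventually.of_forall fun s => ?_)
  exact (compactOperator (RingHom.id ℝ) H H).sum_mem fun i _ =>
    (compactOperator (RingHom.id ℝ) H H).smul_mem (c i) (isCompactOperator_rankOne (a i) (a i))

theorem inner_symOp_nonneg (hc : Summable c) (hB : ∀ i, ‖a i‖ ≤ B) (h0 : ∀ i, 0 ≤ c i) (f : H) :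
    0 ≤ ⟪f, symOp c a f⟫ :=
  (hasSum_inner_symOp hc hB f f).nonneg fun i => by
    rw [mul_assoc]; exact mul_nonneg (h0 i) (mul_self_nonneg _)

/-- The quadratic form at `f` is the sum of the non-negative terms `c i * ⟪a i, f⟫ ^ 2`; if it
vanishes, so does each of them. -/
theorem inner_eq_zero_of_symOp_eq_zero (hc : Summable c) (hB : ∀ i, ‖a i‖ ≤ B)
    (h0 : ∀ i, 0 < c i) {f : H} (hf : symOp c a f = 0) (i : ι) : ⟪a i, f⟫ = 0 := by
  have h1 := hasSum_inner_symOp hc hB f f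
  rw [hf, inner_zero_right] at h1
  have h2 := (hasSum_zero_iff_of_nonneg fun i => by
    show 0 ≤ c i * ⟪a i, f⟫ * ⟪a i, f⟫
    rw [mul_assoc]; exact mul_nonneg (h0 i).le (mul_self_nonneg _)).1 h1
  have h3 := congrFun h2 i
  simpa [(h0 i).ne'] using h3

end Hilbert

/-! ### Integral operators whose kernel has a bounded series expansion -/

section Kernel

variable {α : Type*} [MeasurableSpace α] {μ : Measure α}

theorem inner_eq_integral_mul {f g : Lp ℝ 2 μ} {f' g' : α → ℝ} (hf : f =ᵐ[μ] f')
    (hg : g =ᵐ[μ] g') : ⟪f, g⟫ = ∫ x, f' x * g' x ∂μ := by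
  rw [L2.inner_def]
  refine integral_congr_ae ?_
  filter_upwards [hf, hg] with x h1 h2
  simp [h1, h2, mul_comm]

variable [IsProbabilityMeasure μ] {ι : Type*} {c : ι → ℝ} {a : ι → Lp ℝ 2 μ} {b : ι → α → ℝ} {B : ℝ}

theorem norm_le_of_ae_abs_le (hab : ∀ i, a i =ᵐ[μ] b i) (hB : ∀ᵐ x ∂μ, ∀ i, |b i x| ≤ B)
    (hB0 : 0 ≤ B) (i : ι) : ‖a i‖ ≤ B := by
  refine (Lp.norm_le_of_ae_bound hB0 (C := B) ?_).trans ?_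
  · filter_upwards [hab i, hB] with x h1 h2
    rw [h1]; exact h2 i
  · simp [measureUnivNNReal]

theorem integrable_mul_of_ae_abs_le (hab : ∀ i, a i =ᵐ[μ] b i)
    (hB : ∀ᵐ x ∂μ, ∀ i, |b i x| ≤ B) (f : Lp ℝ 2 μ) (i : ι) :
    Integrable (fun y => b i y * f y) μ ∧ ∫ y, ‖b i y * f y‖ ∂μ ≤ B * ∫ y, ‖f y‖ ∂μ := by
  have hf : Integrable f μ := (Lp.memLp f).integrable (by norm_num)
  have h1 : Integrable (fun y => b i y * f y) μ := by
    refine hf.bdd_mul (c := B) ((Lp.aestronglyMeasurable (a i)).congr (hab i)) ?_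
    filter_upwards [hB] with x hx using hx i
  refine ⟨h1, ?_⟩
  rw [← integral_const_mul]
  refine integral_mono_ae h1.norm (hf.norm.const_mul _) ?_
  filter_upwards [hB] with x hx
  rw [norm_mul]
  exact mul_le_mul_of_nonneg_right (hx i) (norm_nonneg _)

omit [IsProbabilityMeasure μ] in
theorem norm_integral_norm_const_mul (t : ℝ) (F : α → ℝ) :
    ‖∫ y, ‖t * F y‖ ∂μ‖ = |t| * ∫ y, ‖F y‖ ∂μ := by
  rw [Real.norm_of_nonneg (integral_nonneg fun _ => norm_nonneg _), ← integral_const_mul]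
  simp only [norm_mul, Real.norm_eq_abs]

/-- A pointwise expansion of the kernel identifies the integral operator with `symOp`. The uniform
bound on the functions and the summable weights justify exchanging sum and integral twice: at fixed
`x` in the kernel integral, and then after pairing with a test vector. -/
theorem symOp_apply_eq_of_kernel [Countable ι] (hc : Summable c) (hab : ∀ i, a i =ᵐ[μ] b i)
    (hB : ∀ᵐ x ∂μ, ∀ i, |b i x| ≤ B) (hB0 : 0 ≤ B) {k : α → α → ℝ}
    (hk : ∀ᵐ x ∂μ, ∀ᵐ y ∂μ, HasSum (fun i => c i * b i x * b i y) (k x y))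
    {f G : Lp ℝ 2 μ} (hG : G =ᵐ[μ] fun x => ∫ y, k x y * f y ∂μ) : symOp c a f = G := by
  have hI := integrable_mul_of_ae_abs_le hab hB
  have hip : ∀ (i : ι) (h : Lp ℝ 2 μ), ⟪a i, h⟫ = ∫ y, b i y * h y ∂μ := fun i h =>
    inner_eq_integral_mul (hab i) (ae_eq_refl _)
  have habs : ∀ i (h : Lp ℝ 2 μ), |⟪a i, h⟫| ≤ B * ∫ y, ‖h y‖ ∂μ := fun i h => by
    rw [hip]; exact (norm_integral_le_integral_norm _).trans (hI h i).2
  have h1 : ∀ᵐ x ∂μ, HasSum (fun i => c i * ⟪a i, f⟫ * b i x) (G x) := by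
    filter_upwards [hk, hB, hG] with x hkx hBx hGx
    have hs := hasSum_integral_of_summable_integral_norm (μ := μ)
      (F := fun i y => c i * b i x * (b i y * f y)) (fun i => (hI f i).1.const_mul _) (by
        refine Summable.of_norm_bounded (hc.abs.mul_right (B * (B * ∫ y, ‖f y‖ ∂μ))) fun i => ?_
        rw [norm_integral_norm_const_mul, abs_mul, mul_assoc]
        have := hBx i
        have := (hI f i).2
        gcongr)
    have e1 : (fun i => c i * ⟪a i, f⟫ * b i x) =
        fun i => ∫ y, c i * b i x * (b i y * f y) ∂μ := funext fun i => by
      rw [integral_const_mul, hip]; ring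
    have e2 : ∫ y, k x y * f y ∂μ = ∫ y, ∑' i, c i * b i x * (b i y * f y) ∂μ := by
      refine integral_congr_ae ?_
      filter_upwards [hkx] with y hy
      rw [← hy.tsum_eq, ← tsum_mul_right]
      exact tsum_congr fun i => by ring
    rw [hGx, e1, e2]
    exact hs
  refine ext_inner_left ℝ fun h => ?_
  have hs := hasSum_integral_of_summable_integral_norm (μ := μ)
    (F := fun i x => c i * ⟪a i, f⟫ * (b i x * h x)) (fun i => (hI h i).1.const_mul _) (by
      refine Summable.of_norm_bounded (hc.abs.mul_right
        ((B * ∫ y, ‖f y‖ ∂μ) * (B * ∫ y, ‖h y‖ ∂μ))) fun i => ?_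
      rw [norm_integral_norm_const_mul, abs_mul, mul_assoc]
      exact mul_le_mul_of_nonneg_left (mul_le_mul (habs i f) (hI h i).2
        (integral_nonneg fun _ => norm_nonneg _)
        (mul_nonneg hB0 (integral_nonneg fun _ => norm_nonneg _))) (abs_nonneg _))
  refine (hasSum_inner_symOp hc (norm_le_of_ae_abs_le hab hB hB0) h f).unique ?_
  have e1 : (fun i => c i * ⟪a i, f⟫ * ⟪a i, h⟫) =
      fun i => ∫ x, c i * ⟪a i, f⟫ * (b i x * h x) ∂μ := funext fun i => by
    rw [integral_const_mul, hip i h]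
  have e2 : ⟪h, G⟫ = ∫ x, ∑' i, c i * ⟪a i, f⟫ * (b i x * h x) ∂μ := by
    rw [inner_eq_integral_mul (ae_eq_refl h) (ae_eq_refl G)]
    refine integral_congr_ae ?_
    filter_upwards [h1] with x hx
    rw [← hx.tsum_eq, ← tsum_mul_left]
    exact tsum_congr fun i => by ring
  rw [e1, e2]
  exact hs

end Kernel

/-! ### Continuous functions in `L²([0,1])` -/

theorem memLp_unifI (f : C(ℝ, ℝ)) : MemLp f 2 unifI := by
  obtain ⟨C, hC⟩ := (isCompact_Icc : IsCompact (Icc (0 : ℝ) 1)).exists_bound_of_continuousOn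
    f.continuous.continuousOn
  refine MemLp.of_bound f.continuous.aestronglyMeasurable C ?_
  exact (ae_restrict_mem measurableSet_Icc).mono hC

/-- A continuous function as an element of `L²([0,1])`. -/
noncomputable def vecI (f : C(ℝ, ℝ)) : Lp ℝ 2 unifI := (memLp_unifI f).toLp _

theorem vecI_ae (f : C(ℝ, ℝ)) : vecI f =ᵐ[unifI] f := MemLp.coeFn_toLp _

theorem integral_unifI (f : ℝ → ℝ) : ∫ u, f u ∂unifI = ∫ u in (0 : ℝ)..1, f u := by
  rw [unifI, integral_Icc_eq_integral_Ioc, intervalIntegral.integral_of_le zero_le_one]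

theorem inner_vecI (f g : C(ℝ, ℝ)) : ⟪vecI f, vecI g⟫ = ∫ u in (0 : ℝ)..1, f u * g u := by
  rw [inner_eq_integral_mul (vecI_ae f) (vecI_ae g), integral_unifI]

theorem ae_mem_unifI : ∀ᵐ u ∂unifI, u ∈ Icc (0 : ℝ) 1 := ae_restrict_mem measurableSet_Icc

theorem ae_mem_unifSq : ∀ᵐ z ∂unifSq, z.1 ∈ Icc (0 : ℝ) 1 ∧ z.2 ∈ Icc (0 : ℝ) 1 := by
  rw [unifSq, unifI, Measure.prod_restrict]
  exact ae_restrict_mem (measurableSet_Icc.prod measurableSet_Icc)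

/-! ### Tensor products -/

theorem memLp_tens (f g : Lp ℝ 2 unifI) :
    MemLp (fun p : ℝ × ℝ => f p.1 * g p.2) 2 unifSq := by
  have hf := (memLp_two_iff_integrable_sq (Lp.aestronglyMeasurable f)).1 (Lp.memLp f)
  have hg := (memLp_two_iff_integrable_sq (Lp.aestronglyMeasurable g)).1 (Lp.memLp g)
  refine (memLp_two_iff_integrable_sq ?_).2 ?_
  · exact (Lp.aestronglyMeasurable f).comp_fst.mul (Lp.aestronglyMeasurable g).comp_snd
  · exact (hf.mul_prod hg).congr (Filter.Eventually.of_forall fun z => (mul_pow _ _ _).symm)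

theorem inner_toLp_tens (f g f' g' : Lp ℝ 2 unifI) :
    ⟪(memLp_tens f g).toLp _, (memLp_tens f' g').toLp _⟫ = ⟪f, f'⟫ * ⟪g, g'⟫ := by
  rw [inner_eq_integral_mul (MemLp.coeFn_toLp _) (MemLp.coeFn_toLp _),
    inner_eq_integral_mul (ae_eq_refl f) (ae_eq_refl f'),
    inner_eq_integral_mul (ae_eq_refl g) (ae_eq_refl g'), unifSq,
    ← integral_prod_mul (fun x => f x * f' x) fun x => g x * g' x]
  congr 1
  funext z
  ring

/-- The tensor product `L²([0,1]) × L²([0,1]) → L²([0,1]²)`. -/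
noncomputable def tens : Lp ℝ 2 unifI →L[ℝ] Lp ℝ 2 unifI →L[ℝ] H2 :=
  LinearMap.mkContinuous₂
    (LinearMap.mk₂ ℝ (fun f g => ((memLp_tens f g).toLp _ : H2))
      (fun f f' g => by
        rw [← MemLp.toLp_add]
        refine MemLp.toLp_congr _ _ ?_
        filter_upwards [Measure.quasiMeasurePreserving_fst.ae_eq_comp (Lp.coeFn_add f f')] with z hz
        simp only [Function.comp_apply, Pi.add_apply] at hz
        show (_ : ℝ) = _ + _
        rw [hz, add_mul])
      (fun r f g => by
        rw [← MemLp.toLp_const_smul]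
        refine MemLp.toLp_congr _ _ ?_
        filter_upwards [Measure.quasiMeasurePreserving_fst.ae_eq_comp (Lp.coeFn_smul r f)] with z hz
        simp only [Function.comp_apply, Pi.smul_apply] at hz
        simp [hz, mul_assoc])
      (fun f g g' => by
        rw [← MemLp.toLp_add]
        refine MemLp.toLp_congr _ _ ?_
        filter_upwards [Measure.quasiMeasurePreserving_snd.ae_eq_comp (Lp.coeFn_add g g')] with z hz
        simp only [Function.comp_apply, Pi.add_apply] at hz
        show (_ : ℝ) = _ + _
        rw [hz, mul_add])
      (fun r f g => by
        rw [← MemLp.toLp_const_smul]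
        refine MemLp.toLp_congr _ _ ?_
        filter_upwards [Measure.quasiMeasurePreserving_snd.ae_eq_comp (Lp.coeFn_smul r g)] with z hz
        simp only [Function.comp_apply, Pi.smul_apply] at hz
        simp [hz, mul_left_comm])) 1 (fun f g => by
        have h := inner_toLp_tens f g f g
        rw [real_inner_self_eq_norm_sq, real_inner_self_eq_norm_sq, real_inner_self_eq_norm_sq,
          ← mul_pow] at h
        rw [one_mul, LinearMap.mk₂_apply]
        exact ((pow_left_inj₀ (norm_nonneg _) (by positivity) two_ne_zero).1 h).le)

theorem tens_apply (f g : Lp ℝ 2 unifI) : tens f g = (memLp_tens f g).toLp _ := rfl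

theorem inner_tens (f g f' g' : Lp ℝ 2 unifI) :
    ⟪tens f g, tens f' g'⟫ = ⟪f, f'⟫ * ⟪g, g'⟫ := inner_toLp_tens f g f' g'

theorem tens_vecI (f g : C(ℝ, ℝ)) : tens (vecI f) (vecI g) = tensor f g := by
  rw [tens_apply, tensor]
  refine MemLp.toLp_congr _ _ ?_
  filter_upwards [Measure.quasiMeasurePreserving_fst.ae_eq_comp (vecI_ae f),
    Measure.quasiMeasurePreserving_snd.ae_eq_comp (vecI_ae g)] with z h1 h2
  simp only [Function.comp_apply] at h1 h2
  rw [h1, h2]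

theorem norm_tens (f g : Lp ℝ 2 unifI) : ‖tens f g‖ = ‖f‖ * ‖g‖ := by
  have h := inner_tens f g f g
  rw [real_inner_self_eq_norm_sq, real_inner_self_eq_norm_sq, real_inner_self_eq_norm_sq,
    ← mul_pow] at h
  exact (pow_left_inj₀ (norm_nonneg _) (by positivity) two_ne_zero).1 h

/-! ### The zeros of `ω` -/

/-- Where the sine vanishes, the quotient defining the cotangent is 0, so `omega` is 1; there the
cosine is non-zero, so the right side fails as well. Elsewhere one multiplies by the sine. -/
theorem omega_eq_zero_iff {z : ℝ} (hz : 0 < z) :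
    omega z = 0 ↔ Real.sin √(3 * z) + √(3 * z) * Real.cos √(3 * z) = 0 := by
  have hs : 0 < √(3 * z) := Real.sqrt_pos.2 (by linarith)
  rw [omega, Real.cot_eq_cos_div_sin]
  set s := √(3 * z)
  by_cases h : Real.sin s = 0
  · have hc : Real.cos s ≠ 0 := fun hc => by
      have := Real.sin_sq_add_cos_sq s
      simp [h, hc] at this
    simp [h, hs.ne', hc]
  · rw [← mul_div_assoc, ← div_self h, ← add_div, div_eq_zero_iff]
    simp [h]

/-- Writing s = tan(arctan s) gives sin(s + arctan s) = (sin s + s cos s) cos(arctan s). The zeros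
thus become level sets of the strictly increasing function s + arctan s. -/
theorem sin_add_mul_cos_eq_zero_iff (s : ℝ) :
    Real.sin s + s * Real.cos s = 0 ↔ ∃ n : ℤ, n * Real.pi = s + Real.arctan s := by
  rw [← Real.sin_eq_zero_iff, Real.sin_add]
  have h1 : Real.sin (Real.arctan s) = s * Real.cos (Real.arctan s) := by
    rw [← Real.tan_mul_cos (Real.cos_arctan_pos s).ne', Real.tan_arctan]
  rw [h1, show Real.sin s * Real.cos (Real.arctan s) + Real.cos s * (s * Real.cos (Real.arctan s))
    = (Real.sin s + s * Real.cos s) * Real.cos (Real.arctan s) by ring]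
  simp [(Real.cos_arctan_pos s).ne']

theorem strictMono_add_arctan : StrictMono fun s : ℝ => s + Real.arctan s :=
  strictMono_id.add Real.arctan_strictMono

theorem exists_add_arctan_eq (n : ℕ) :
    ∃ s : ℝ, 0 < s ∧ s + Real.arctan s = (n + 1) * Real.pi := by
  have hp : 0 < (n + 1) * Real.pi := by positivity
  have hc : ContinuousOn (fun s : ℝ => s + Real.arctan s) (Icc 0 ((n + 1) * Real.pi)) := by
    fun_prop
  have h := intermediate_value_Icc hp.le hc
  obtain ⟨s, hs, he⟩ := h ⟨by simpa using hp.le, by simpa using Real.arctan_nonneg.2 hp.le⟩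
  refine ⟨s, ?_, he⟩
  rcases hs.1.eq_or_lt with h0 | h0
  · exfalso
    simp only [← h0, Real.arctan_zero, add_zero] at he
    linarith
  · exact h0

theorem strictMono_range_gam : StrictMono gam ∧ range gam = omegaZeros := by
  choose s hs0 hs using exists_add_arctan_eq
  have hmono : StrictMono fun n => s n ^ 2 / 3 := fun m n hmn => by
    have : s m < s n := strictMono_add_arctan.lt_iff_lt.1 (by
      simp only [hs]
      exact mul_lt_mul_of_pos_right (by simpa using hmn) Real.pi_pos)
    have h1 := pow_lt_pow_left₀ this (hs0 m).le two_ne_zero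
    simpa using div_lt_div_of_pos_right h1 three_pos
  have hsq : ∀ n, √(3 * (s n ^ 2 / 3)) = s n := fun n => by
    rw [mul_div_cancel₀ _ (three_ne_zero), Real.sqrt_sq (hs0 n).le]
  have hrange : range (fun n => s n ^ 2 / 3) = omegaZeros := by
    ext z
    constructor
    · rintro ⟨n, rfl⟩
      have hpos : 0 < s n ^ 2 / 3 := by have := hs0 n; positivity
      refine ⟨hpos, (omega_eq_zero_iff hpos).2 ?_⟩
      rw [hsq, sin_add_mul_cos_eq_zero_iff]
      exact ⟨n + 1, by rw [hs]; push_cast; ring⟩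
    · rintro ⟨hz, h⟩
      rw [omega_eq_zero_iff hz, sin_add_mul_cos_eq_zero_iff] at h
      obtain ⟨n, hn⟩ := h
      have hpos : 0 < √(3 * z) := Real.sqrt_pos.2 (by linarith)
      -- Positivity of the root excludes n = 0, so the levels are exactly (m + 1)π with m a natural
      -- number.
      have hn0 : 0 < n := by
        have : 0 < (n : ℝ) * Real.pi := by
          rw [hn]; exact add_pos hpos (Real.arctan_pos.2 hpos)
        exact_mod_cast (pos_iff_pos_of_mul_pos this).2 Real.pi_pos
      obtain ⟨m, rfl⟩ : ∃ m : ℕ, n = m + 1 := ⟨(n - 1).toNat, by omega⟩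
      refine ⟨m, ?_⟩
      have : s m = √(3 * z) := strictMono_add_arctan.injective (by
        simp only [hs, ← hn]; push_cast; ring)
      simp only [this, Real.sq_sqrt (by linarith : 0 ≤ 3 * z)]
      ring
  have : gam = fun n => s n ^ 2 / 3 := nthSmallest_eq_of_strictMono hmono hrange
  rw [this]
  exact ⟨hmono, hrange⟩

theorem gam_mem (j : ℕ) : gam j ∈ omegaZeros := strictMono_range_gam.2 ▸ mem_range_self j

theorem gam_pos (j : ℕ) : 0 < gam j := (gam_mem j).1

theorem mu_pos (j : ℕ) : 0 < mu j := one_div_pos.2 (gam_pos j)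

/-- The `j`-th positive solution of `sin s + s cos s = 0`. -/
noncomputable def srt (j : ℕ) : ℝ := √(3 * gam j)

theorem srt_pos (j : ℕ) : 0 < srt j := Real.sqrt_pos.2 (by have := gam_pos j; linarith)

theorem srt_sq (j : ℕ) : srt j ^ 2 = 3 * gam j :=
  Real.sq_sqrt (by have := gam_pos j; linarith)

theorem mu_eq (j : ℕ) : mu j = 3 / srt j ^ 2 := by
  rw [srt_sq, mu]
  have := (gam_pos j).ne'
  field_simp

theorem strictMono_srt : StrictMono srt := fun j k h =>
  Real.sqrt_lt_sqrt (by have := gam_pos j; linarith)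
    (by have := strictMono_range_gam.1 h; linarith)

theorem strictAnti_mu : StrictAnti mu := fun j _ h =>
  one_div_lt_one_div_of_lt (gam_pos j) (strictMono_range_gam.1 h)

theorem sin_srt_add (j : ℕ) : Real.sin (srt j) + srt j * Real.cos (srt j) = 0 :=
  (omega_eq_zero_iff (gam_pos j)).1 (gam_mem j).2

theorem sin_srt (j : ℕ) : Real.sin (srt j) = -(srt j * Real.cos (srt j)) := by
  linarith [sin_srt_add j]

theorem cos_srt_ne_zero (j : ℕ) : Real.cos (srt j) ≠ 0 := fun h => by
  have h1 := sin_srt j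
  have h2 := Real.sin_sq_add_cos_sq (srt j)
  simp [h1, h] at h2

theorem cos_srt_sq (j : ℕ) : Real.cos (srt j) ^ 2 = 1 / (1 + srt j ^ 2) := by
  have h2 := Real.sin_sq_add_cos_sq (srt j)
  rw [sin_srt] at h2
  have : 0 < 1 + srt j ^ 2 := by positivity
  field_simp
  linarith

theorem exists_srt_eq {s : ℝ} (hs : 0 < s) (h : Real.sin s + s * Real.cos s = 0) :
    ∃ j, srt j = s := by
  have e : √(3 * (s ^ 2 / 3)) = s := by
    rw [mul_div_cancel₀ _ (three_ne_zero), Real.sqrt_sq hs.le]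
  have hpos : 0 < s ^ 2 / 3 := by positivity
  have : s ^ 2 / 3 ∈ omegaZeros := ⟨hpos, (omega_eq_zero_iff hpos).2 (by rwa [e])⟩
  rw [← strictMono_range_gam.2] at this
  obtain ⟨j, hj⟩ := this
  exact ⟨j, by rw [srt, hj, e]⟩

theorem sin_srt_ne_zero (j : ℕ) : Real.sin (srt j) ≠ 0 := by
  rw [sin_srt, neg_ne_zero]
  exact mul_ne_zero (srt_pos j).ne' (cos_srt_ne_zero j)

/-- A crude linear bound that makes the μ_j summable. Each root lies on a level (n + 1)π of s +
arctan s, and strict monotonicity raises the integer by at least one per step, so n ≥ j; then arctan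
< π/2 and π > 3 suffice. -/
theorem le_srt (j : ℕ) : (j : ℝ) + 1 ≤ srt j := by
  have key : ∀ j : ℕ, ∃ n : ℕ, j ≤ n ∧ srt j + Real.arctan (srt j) = (n + 1) * Real.pi := by
    intro j
    induction j with
    | zero =>
      obtain ⟨n, hn⟩ := (sin_add_mul_cos_eq_zero_iff _).1 (sin_srt_add 0)
      have hp : 0 < (n : ℝ) * Real.pi := by
        rw [hn]; exact add_pos (srt_pos 0) (Real.arctan_pos.2 (srt_pos 0))
      have hn0 : 0 < n := by exact_mod_cast (pos_iff_pos_of_mul_pos hp).2 Real.pi_pos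
      refine ⟨(n - 1).toNat, Nat.zero_le _, ?_⟩
      rw [← hn]
      have : (((n - 1).toNat : ℤ) : ℝ) = n - 1 := by
        rw [Int.toNat_of_nonneg (by omega)]; push_cast; ring
      rw [Int.cast_natCast] at this
      rw [this]; ring
    | succ j ih =>
      obtain ⟨m, hjm, hm⟩ := ih
      obtain ⟨n, hn⟩ := (sin_add_mul_cos_eq_zero_iff _).1 (sin_srt_add (j + 1))
      have hlt := strictMono_add_arctan (strictMono_srt (Nat.lt_succ_self j))
      simp only [Nat.succ_eq_add_one, hm, ← hn] at hlt
      have h1 : ((m + 1 : ℕ) : ℤ) < n := by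
        have := lt_of_mul_lt_mul_right hlt Real.pi_pos.le
        exact_mod_cast this
      refine ⟨(n - 1).toNat, by omega, ?_⟩
      rw [← hn]
      have : (((n - 1).toNat : ℤ) : ℝ) = n - 1 := by
        rw [Int.toNat_of_nonneg (by omega)]; push_cast; ring
      rw [Int.cast_natCast] at this
      rw [this]; ring
  obtain ⟨n, hjn, hn⟩ := key j
  have h1 := Real.arctan_lt_pi_div_two (srt j)
  have h2 : (j : ℝ) ≤ n := by exact_mod_cast hjn
  have h3 := Real.pi_gt_three
  nlinarith

theorem summable_mu : Summable mu := by
  have h := (summable_nat_add_iff 1).2 (Real.summable_one_div_nat_pow.2 one_lt_two)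
  refine Summable.of_nonneg_of_le (fun j => (mu_pos j).le) (fun j => ?_) (h.mul_left 3)
  rw [mu_eq, mul_one_div]
  have := le_srt j
  push_cast
  gcongr

theorem mu_injective : Function.Injective mu := strictAnti_mu.injective

/-! ### Trigonometric integrals -/

theorem integral_cos_two_pi_int (k : ℤ) :
    ∫ u in (0 : ℝ)..1, Real.cos (2 * Real.pi * k * u) = if k = 0 then 1 else 0 := by
  split_ifs with hk
  · simp [hk]
  · have h : 2 * Real.pi * (k : ℝ) ≠ 0 := by
      have := Real.pi_ne_zero
      have : (k : ℝ) ≠ 0 := by exact_mod_cast hk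
      positivity
    rw [intervalIntegral.integral_comp_mul_left _ h, integral_cos]
    have : Real.sin (2 * Real.pi * k * 1) = 0 := by
      rw [show 2 * Real.pi * (k : ℝ) * 1 = ((2 * k : ℤ) : ℝ) * Real.pi by push_cast; ring]
      exact Real.sin_int_mul_pi _
    rw [this]
    simp

theorem integral_sin_two_pi_int (k : ℤ) :
    ∫ u in (0 : ℝ)..1, Real.sin (2 * Real.pi * k * u) = 0 := by
  by_cases hk : k = 0
  · simp [hk]
  · have h : 2 * Real.pi * (k : ℝ) ≠ 0 := by
      have := Real.pi_ne_zero
      have : (k : ℝ) ≠ 0 := by exact_mod_cast hk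
      positivity
    rw [intervalIntegral.integral_comp_mul_left _ h, integral_sin]
    have : Real.cos (2 * Real.pi * k * 1) = 1 := by
      rw [show 2 * Real.pi * (k : ℝ) * 1 = k * (2 * Real.pi) by ring]
      exact Real.cos_int_mul_two_pi _
    rw [this]
    simp

/-- `ψ_{j+1}(u) = √2 sin(2 π (j+1) u)`. -/
noncomputable def psi (j : ℕ) : C(ℝ, ℝ) where
  toFun u := Real.sqrt 2 * Real.sin (2 * Real.pi * (j + 1) * u)
  continuous_toFun := by fun_prop

/-- The centered identity `u ↦ u - 1/2`. -/
noncomputable def cid : C(ℝ, ℝ) where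
  toFun u := u - 1 / 2
  continuous_toFun := by fun_prop

/-- The odd function `u ↦ sin(2 s (u - 1/2))`. -/
noncomputable def osc (s : ℝ) : C(ℝ, ℝ) where
  toFun u := Real.sin (2 * s * (u - 1 / 2))
  continuous_toFun := by fun_prop

theorem phi_apply (j : ℕ) (u : ℝ) : phi j u = √2 * Real.cos (2 * Real.pi * (j + 1) * u) := rfl
theorem psi_apply (j : ℕ) (u : ℝ) : psi j u = √2 * Real.sin (2 * Real.pi * (j + 1) * u) := rfl
theorem cid_apply (u : ℝ) : cid u = u - 1 / 2 := rfl
theorem osc_apply (s u : ℝ) : osc s u = Real.sin (2 * s * (u - 1 / 2)) := rfl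

theorem inner_phi_phi (j k : ℕ) : ⟪vecI (phi j), vecI (phi k)⟫ = if j = k then 1 else 0 := by
  rw [inner_vecI]
  have h : ∀ u : ℝ, phi j u * phi k u = Real.cos (2 * Real.pi * ((j - k : ℤ) : ℝ) * u)
      + Real.cos (2 * Real.pi * ((j + k + 2 : ℤ) : ℝ) * u) := fun u => by
    have h2 : √2 * √2 = 2 := Real.mul_self_sqrt (by norm_num)
    have e1 : 2 * Real.pi * ((j - k : ℤ) : ℝ) * u
        = 2 * Real.pi * (j + 1) * u - 2 * Real.pi * (k + 1) * u := by push_cast; ring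
    have e2 : 2 * Real.pi * ((j + k + 2 : ℤ) : ℝ) * u
        = 2 * Real.pi * (j + 1) * u + 2 * Real.pi * (k + 1) * u := by push_cast; ring
    rw [phi_apply, phi_apply, e1, e2, Real.cos_sub, Real.cos_add]
    linear_combination Real.cos (2 * Real.pi * (j + 1) * u) *
      Real.cos (2 * Real.pi * (k + 1) * u) * h2
  simp only [h]
  rw [intervalIntegral.integral_add (by apply Continuous.intervalIntegrable; fun_prop)
    (by apply Continuous.intervalIntegrable; fun_prop), integral_cos_two_pi_int,
    integral_cos_two_pi_int, if_neg (by omega : ¬ ((j : ℤ) + k + 2 = 0)), add_zero]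
  exact if_congr (by omega) rfl rfl

theorem inner_psi_psi (j k : ℕ) : ⟪vecI (psi j), vecI (psi k)⟫ = if j = k then 1 else 0 := by
  rw [inner_vecI]
  have h : ∀ u : ℝ, psi j u * psi k u = Real.cos (2 * Real.pi * ((j - k : ℤ) : ℝ) * u)
      - Real.cos (2 * Real.pi * ((j + k + 2 : ℤ) : ℝ) * u) := fun u => by
    have h2 : √2 * √2 = 2 := Real.mul_self_sqrt (by norm_num)
    have e1 : 2 * Real.pi * ((j - k : ℤ) : ℝ) * u
        = 2 * Real.pi * (j + 1) * u - 2 * Real.pi * (k + 1) * u := by push_cast; ring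
    have e2 : 2 * Real.pi * ((j + k + 2 : ℤ) : ℝ) * u
        = 2 * Real.pi * (j + 1) * u + 2 * Real.pi * (k + 1) * u := by push_cast; ring
    rw [psi_apply, psi_apply, e1, e2, Real.cos_sub, Real.cos_add]
    linear_combination Real.sin (2 * Real.pi * (j + 1) * u) *
      Real.sin (2 * Real.pi * (k + 1) * u) * h2
  simp only [h]
  rw [intervalIntegral.integral_sub (by apply Continuous.intervalIntegrable; fun_prop)
    (by apply Continuous.intervalIntegrable; fun_prop), integral_cos_two_pi_int,
    integral_cos_two_pi_int, if_neg (by omega : ¬ ((j : ℤ) + k + 2 = 0)), sub_zero]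
  exact if_congr (by omega) rfl rfl

theorem inner_psi_phi (j k : ℕ) : ⟪vecI (psi j), vecI (phi k)⟫ = 0 := by
  rw [inner_vecI]
  have h : ∀ u : ℝ, psi j u * phi k u = Real.sin (2 * Real.pi * ((j + k + 2 : ℤ) : ℝ) * u)
      + Real.sin (2 * Real.pi * ((j - k : ℤ) : ℝ) * u) := fun u => by
    have h2 : √2 * √2 = 2 := Real.mul_self_sqrt (by norm_num)
    have e1 : 2 * Real.pi * ((j - k : ℤ) : ℝ) * u
        = 2 * Real.pi * (j + 1) * u - 2 * Real.pi * (k + 1) * u := by push_cast; ring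
    have e2 : 2 * Real.pi * ((j + k + 2 : ℤ) : ℝ) * u
        = 2 * Real.pi * (j + 1) * u + 2 * Real.pi * (k + 1) * u := by push_cast; ring
    rw [psi_apply, phi_apply, e1, e2, Real.sin_sub, Real.sin_add]
    linear_combination Real.sin (2 * Real.pi * (j + 1) * u) *
      Real.cos (2 * Real.pi * (k + 1) * u) * h2
  simp only [h]
  rw [intervalIntegral.integral_add (by apply Continuous.intervalIntegrable; fun_prop)
    (by apply Continuous.intervalIntegrable; fun_prop), integral_sin_two_pi_int,
    integral_sin_two_pi_int, add_zero]

theorem sin_two_pi_succ (j : ℕ) : Real.sin (2 * Real.pi * (j + 1)) = 0 := by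
  rw [show 2 * Real.pi * ((j : ℝ) + 1) = ((2 * (j + 1) : ℕ) : ℝ) * Real.pi by push_cast; ring]
  exact Real.sin_nat_mul_pi _

theorem cos_two_pi_succ (j : ℕ) : Real.cos (2 * Real.pi * (j + 1)) = 1 := by
  rw [show 2 * Real.pi * ((j : ℝ) + 1) = ((j + 1 : ℕ) : ℝ) * (2 * Real.pi) by push_cast; ring]
  exact Real.cos_nat_mul_two_pi _

theorem inner_cid_phi (j : ℕ) : ⟪vecI cid, vecI (phi j)⟫ = 0 := by
  rw [inner_vecI]
  have ha : 2 * Real.pi * ((j : ℝ) + 1) ≠ 0 := by have := Real.pi_pos; positivity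
  have hs := sin_two_pi_succ j
  have hc := cos_two_pi_succ j
  set a := 2 * Real.pi * ((j : ℝ) + 1) with haa
  have hd : ∀ u ∈ uIcc (0 : ℝ) 1, HasDerivAt
      (fun u => √2 * ((u - 1 / 2) * Real.sin (a * u) / a + Real.cos (a * u) / a ^ 2))
      (cid u * phi j u) u := fun u _ => by
    have h1 : HasDerivAt (fun u : ℝ => a * u) a u := by simpa using (hasDerivAt_id u).const_mul a
    have h2 := ((((hasDerivAt_id u).sub_const (1 / 2)).mul h1.sin).div_const a).add
      (h1.cos.div_const (a ^ 2))
    refine (h2.const_mul √2).congr_deriv ?_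
    rw [cid_apply, phi_apply, ← haa]
    simp only [id]
    field_simp
    ring
  rw [intervalIntegral.integral_eq_sub_of_hasDerivAt hd
    (by apply Continuous.intervalIntegrable; fun_prop)]
  simp [hs, hc]

theorem inner_cid_psi (j : ℕ) :
    ⟪vecI cid, vecI (psi j)⟫ = -√2 / (2 * Real.pi * ((j : ℝ) + 1)) := by
  rw [inner_vecI]
  have ha : 2 * Real.pi * ((j : ℝ) + 1) ≠ 0 := by have := Real.pi_pos; positivity
  have hs := sin_two_pi_succ j
  have hc := cos_two_pi_succ j
  set a := 2 * Real.pi * ((j : ℝ) + 1) with haa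
  have hd : ∀ u ∈ uIcc (0 : ℝ) 1, HasDerivAt
      (fun u => √2 * (-((u - 1 / 2) * Real.cos (a * u) / a) + Real.sin (a * u) / a ^ 2))
      (cid u * psi j u) u := fun u _ => by
    have h1 : HasDerivAt (fun u : ℝ => a * u) a u := by simpa using (hasDerivAt_id u).const_mul a
    have h2 := ((((hasDerivAt_id u).sub_const (1 / 2)).mul h1.cos).div_const a).neg.add
      (h1.sin.div_const (a ^ 2))
    refine (h2.const_mul √2).congr_deriv ?_
    rw [cid_apply, psi_apply, ← haa]
    simp only [id]
    field_simp
    ring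
  rw [intervalIntegral.integral_eq_sub_of_hasDerivAt hd
    (by apply Continuous.intervalIntegrable; fun_prop)]
  simp only [mul_one, mul_zero, hs, hc, Real.sin_zero, Real.cos_zero]
  field_simp
  ring

theorem hasDerivAt_osc_arg (s u : ℝ) :
    HasDerivAt (fun u : ℝ => 2 * s * (u - 1 / 2)) (2 * s) u :=
  (((hasDerivAt_id u).sub_const (1 / 2)).const_mul (2 * s)).congr_deriv (mul_one _)

theorem inner_cid_osc {s : ℝ} (hs : s ≠ 0) :
    ⟪vecI cid, vecI (osc s)⟫ = -Real.cos s / (2 * s) + Real.sin s / (2 * s ^ 2) := by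
  rw [inner_vecI]
  have hd : ∀ u ∈ uIcc (0 : ℝ) 1, HasDerivAt
      (fun u => -((u - 1 / 2) * Real.cos (2 * s * (u - 1 / 2)) / (2 * s))
        + Real.sin (2 * s * (u - 1 / 2)) / (4 * s ^ 2))
      (cid u * osc s u) u := fun u _ => by
    have h1 := hasDerivAt_osc_arg s u
    have h2 := ((((hasDerivAt_id u).sub_const (1 / 2)).mul h1.cos).div_const (2 * s)).neg.add
      (h1.sin.div_const (4 * s ^ 2))
    refine h2.congr_deriv ?_
    rw [cid_apply, osc_apply]
    simp only [id]
    field_simp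
    ring
  rw [intervalIntegral.integral_eq_sub_of_hasDerivAt hd
    (by apply Continuous.intervalIntegrable; fun_prop)]
  rw [show 2 * s * (1 - 1 / 2) = s by ring, show 2 * s * (0 - 1 / 2) = -s by ring, Real.cos_neg,
    Real.sin_neg]
  field_simp
  ring

theorem inner_osc_osc {s : ℝ} (hs : s ≠ 0) :
    ⟪vecI (osc s), vecI (osc s)⟫ = 1 / 2 - Real.sin s * Real.cos s / (2 * s) := by
  rw [inner_vecI]
  have hd : ∀ u ∈ uIcc (0 : ℝ) 1, HasDerivAt
      (fun u => u / 2 - Real.sin (2 * s * (u - 1 / 2)) * Real.cos (2 * s * (u - 1 / 2)) / (4 * s))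
      (osc s u * osc s u) u := fun u _ => by
    have h1 := hasDerivAt_osc_arg s u
    have h2 := ((hasDerivAt_id u).div_const 2).sub ((h1.sin.mul h1.cos).div_const (4 * s))
    refine h2.congr_deriv ?_
    rw [osc_apply]
    have := Real.cos_sq' (2 * s * (u - 1 / 2))
    generalize Real.sin (2 * s * (u - 1 / 2)) = S at *
    generalize Real.cos (2 * s * (u - 1 / 2)) = C at *
    field_simp
    rw [this]
    ring
  rw [intervalIntegral.integral_eq_sub_of_hasDerivAt hd
    (by apply Continuous.intervalIntegrable; fun_prop)]
  rw [show 2 * s * (1 - 1 / 2) = s by ring, show 2 * s * (0 - 1 / 2) = -s by ring, Real.cos_neg,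
    Real.sin_neg]
  field_simp
  ring

/-! ### The kernel on the unit interval and its expansion -/

/-- The kernel `6 B₂(|u - v|) + 6 (u - 1/2) (v - 1/2)`. -/
noncomputable def kerI (u v : ℝ) : ℝ :=
  6 * (|u - v| ^ 2 - |u - v| + 1 / 6) + 6 * (u - 1 / 2) * (v - 1 / 2)

/-- The eigenvalue of `φ_{j+1}`. -/
noncomputable def nu (j : ℕ) : ℝ := 3 / (Real.pi ^ 2 * ((j : ℝ) + 1) ^ 2)

theorem nu_pos (j : ℕ) : 0 < nu j := by have := Real.pi_pos; unfold nu; positivity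

theorem nu_injective : Function.Injective nu := fun j k h => by
  unfold nu at h
  have hp := Real.pi_pos
  have h1 : Real.pi ^ 2 * ((j : ℝ) + 1) ^ 2 = Real.pi ^ 2 * ((k : ℝ) + 1) ^ 2 := by
    rw [div_eq_div_iff (by positivity) (by positivity)] at h
    linarith
  have h2 := mul_left_cancel₀ (by positivity) h1
  have h3 := (pow_left_inj₀ (by positivity) (by positivity) two_ne_zero).1 h2
  exact_mod_cast add_right_cancel h3

theorem summable_nu : Summable nu := by
  have h := (summable_nat_add_iff 1).2 (Real.summable_one_div_nat_pow.2 one_lt_two)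
  refine (h.mul_left (3 / Real.pi ^ 2)).congr fun j => ?_
  unfold nu
  have := Real.pi_ne_zero
  push_cast
  field_simp

/-- The index set of the expansion of `kerI`. -/
abbrev KIdx : Type := (ℕ ⊕ ℕ) ⊕ Unit

/-- The coefficients of the expansion of `kerI`. -/
noncomputable def kCoef : KIdx → ℝ
  | .inl (.inl j) => nu j
  | .inl (.inr j) => nu j
  | .inr _ => 6

/-- The functions of the expansion of `kerI`. -/
noncomputable def kFun : KIdx → C(ℝ, ℝ)
  | .inl (.inl j) => phi j
  | .inl (.inr j) => psi j
  | .inr _ => cid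

theorem kCoef_pos (i : KIdx) : 0 < kCoef i := by
  rcases i with (j | j) | j
  · exact nu_pos j
  · exact nu_pos j
  · norm_num [kCoef]

theorem summable_kCoef : Summable kCoef := by
  refine Summable.sum _ (Summable.sum _ ?_ ?_) ?_
  · exact summable_nu
  · exact summable_nu
  · exact (hasSum_fintype _).summable

theorem abs_kFun_le {u : ℝ} (hu : u ∈ Icc (0 : ℝ) 1) (i : KIdx) : |kFun i u| ≤ √2 := by
  have h2 : (0 : ℝ) ≤ √2 := Real.sqrt_nonneg 2
  rcases i with (j | j) | j
  · show |phi j u| ≤ _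
    rw [phi_apply, abs_mul, abs_of_nonneg h2]
    exact mul_le_of_le_one_right h2 (Real.abs_cos_le_one _)
  · show |psi j u| ≤ _
    rw [psi_apply, abs_mul, abs_of_nonneg h2]
    exact mul_le_of_le_one_right h2 (Real.abs_sin_le_one _)
  · show |cid u| ≤ _
    have h1 : (1 : ℝ) ≤ √2 := by rw [Real.one_le_sqrt]; norm_num
    rw [cid_apply, abs_le]
    constructor <;> linarith [hu.1, hu.2]

theorem hasSum_cos_div_sq {x : ℝ} (hx : x ∈ Icc (0 : ℝ) 1) :
    HasSum (fun n : ℕ => nu n * (2 * Real.cos (2 * Real.pi * (n + 1) * x)))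
      (6 * (x ^ 2 - x + 1 / 6)) := by
  have h := hasSum_one_div_nat_pow_mul_cos (one_ne_zero) hx
  have hb : (Polynomial.map (algebraMap ℚ ℝ) (Polynomial.bernoulli (2 * 1))).eval x
      = x ^ 2 - x + 6⁻¹ := bernoulliFun_two x
  -- The term of index 0 in the Fourier series of B₂ is 1/0² = 0 by convention, so the shift to
  -- indices n + 1 loses nothing.
  rw [hb, ← hasSum_nat_add_iff' 1] at h
  have hp := Real.pi_ne_zero
  have e1 : (fun n : ℕ => nu n * (2 * Real.cos (2 * Real.pi * (n + 1) * x))) =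
      fun n : ℕ => 6 / Real.pi ^ 2 *
        (1 / ((n + 1 : ℕ) : ℝ) ^ (2 * 1) * Real.cos (2 * Real.pi * ((n + 1 : ℕ) : ℝ) * x)) := by
    funext n
    unfold nu
    push_cast
    field_simp
    ring
  have e2 := h.mul_left (6 / Real.pi ^ 2)
  rw [← e1] at e2
  have e3 : 6 * (x ^ 2 - x + 1 / 6) = 6 / Real.pi ^ 2 *
      ((-1) ^ (1 + 1) * (2 * Real.pi) ^ (2 * 1) / 2 / ((2 * 1).factorial : ℝ) * (x ^ 2 - x + 6⁻¹) -
        ∑ i ∈ Finset.range 1, 1 / (i : ℝ) ^ (2 * 1) * Real.cos (2 * Real.pi * i * x)) := by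
    simp
    field_simp
  rw [e3]
  exact e2

/-- The cosine series of B₂ at |u - v| splits by the addition formula into cosine and sine products
with equal weights; the remaining index carries the rank one term. -/
theorem hasSum_kerI {u v : ℝ} (hu : u ∈ Icc (0 : ℝ) 1) (hv : v ∈ Icc (0 : ℝ) 1) :
    HasSum (fun i => kCoef i * kFun i u * kFun i v) (kerI u v) := by
  have hs : Summable fun i => kCoef i * kFun i u * kFun i v := by
    refine Summable.of_norm_bounded (summable_kCoef.mul_right (√2 * √2)) fun i => ?_
    rw [Real.norm_eq_abs, abs_mul, abs_mul, abs_of_pos (kCoef_pos i), mul_assoc]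
    exact mul_le_mul_of_nonneg_left (mul_le_mul (abs_kFun_le hu i) (abs_kFun_le hv i)
      (abs_nonneg _) (Real.sqrt_nonneg _)) (kCoef_pos i).le
  have h1 : Summable fun n => nu n * phi n u * phi n v :=
    hs.comp_injective (i := fun n : ℕ => (Sum.inl (Sum.inl n) : KIdx))
      fun a b h => by simpa using h
  have h2 : Summable fun n => nu n * psi n u * psi n v :=
    hs.comp_injective (i := fun n : ℕ => (Sum.inl (Sum.inr n) : KIdx))
      fun a b h => by simpa using h
  have hd : |u - v| ∈ Icc (0 : ℝ) 1 :=
    ⟨abs_nonneg _, abs_le.2 ⟨by linarith [hu.1, hv.2], by linarith [hu.2, hv.1]⟩⟩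
  have h3 : (∑' n, nu n * phi n u * phi n v) + ∑' n, nu n * psi n u * psi n v
      = 6 * (|u - v| ^ 2 - |u - v| + 1 / 6) := by
    refine (h1.hasSum.add h2.hasSum).unique ?_
    convert hasSum_cos_div_sq hd using 2 with n
    have e : Real.cos (2 * Real.pi * (n + 1) * |u - v|)
        = Real.cos (2 * Real.pi * (n + 1) * u - 2 * Real.pi * (n + 1) * v) := by
      have hp := Real.pi_pos
      rw [← mul_sub, ← Real.cos_abs (_ * (u - v)), abs_mul,
        abs_of_pos (by positivity : 0 < 2 * Real.pi * ((n : ℝ) + 1))]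
    have h2 : √2 * √2 = 2 := Real.mul_self_sqrt (by norm_num)
    rw [e, Real.cos_sub, phi_apply, phi_apply, psi_apply, psi_apply]
    linear_combination nu n * (Real.cos (2 * Real.pi * (n + 1) * u) *
      Real.cos (2 * Real.pi * (n + 1) * v) + Real.sin (2 * Real.pi * (n + 1) * u) *
      Real.sin (2 * Real.pi * (n + 1) * v)) * h2
  unfold kerI
  rw [← h3]
  refine HasSum.sum (HasSum.sum h1.hasSum h2.hasSum) ?_
  have := hasSum_fintype ((fun i => kCoef i * kFun i u * kFun i v) ∘ Sum.inr)
  simpa [kCoef, kFun, cid_apply] using this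

/-! ### Action of `kerI` on sines that are odd about 1/2 -/

theorem integral_quadratic_mul_osc {s : ℝ} (hs : s ≠ 0) (α β γ x y : ℝ) :
    ∫ v in x..y, (α * v ^ 2 + β * v + γ) * osc s v =
      (-((α * y ^ 2 + β * y + γ) * (2 * s * Real.cos (2 * s * (y - 1 / 2)))
        - (2 * α * y + β) * Real.sin (2 * s * (y - 1 / 2))) / (4 * s ^ 2)
        + 2 * α / (16 * s ^ 4) * (2 * s * Real.cos (2 * s * (y - 1 / 2)))) -
      (-((α * x ^ 2 + β * x + γ) * (2 * s * Real.cos (2 * s * (x - 1 / 2)))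
        - (2 * α * x + β) * Real.sin (2 * s * (x - 1 / 2))) / (4 * s ^ 2)
        + 2 * α / (16 * s ^ 4) * (2 * s * Real.cos (2 * s * (x - 1 / 2)))) := by
  refine intervalIntegral.integral_eq_sub_of_hasDerivAt (f := fun v : ℝ =>
    (-((α * v ^ 2 + β * v + γ) * (2 * s * Real.cos (2 * s * (v - 1 / 2)))
        - (2 * α * v + β) * Real.sin (2 * s * (v - 1 / 2))) / (4 * s ^ 2)
        + 2 * α / (16 * s ^ 4) * (2 * s * Real.cos (2 * s * (v - 1 / 2))))) (fun v _ => ?_)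
    (by apply Continuous.intervalIntegrable; fun_prop)
  have h1 := hasDerivAt_osc_arg s v
  have hp : HasDerivAt (fun v : ℝ => α * v ^ 2 + β * v + γ) (2 * α * v + β) v := by
    have := ((((hasDerivAt_id v).pow 2).const_mul α).add ((hasDerivAt_id v).const_mul β)).add_const γ
    refine this.congr_deriv ?_
    simp
    ring
  have hq : HasDerivAt (fun v : ℝ => 2 * α * v + β) (2 * α) v := by
    simpa using ((hasDerivAt_id v).const_mul (2 * α)).add_const β
  have h2 := ((((hp.mul (h1.cos.const_mul (2 * s))).sub (hq.mul h1.sin)).neg).div_const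
    (4 * s ^ 2)).add ((h1.cos.const_mul (2 * s)).const_mul (2 * α / (16 * s ^ 4)))
  refine h2.congr_deriv ?_
  rw [osc_apply]
  field_simp
  ring

theorem continuous_kerI (u : ℝ) : Continuous (kerI u) := by unfold kerI; fun_prop

/-- The kernel is piecewise quadratic with a kink on the diagonal, so on odd functions it inverts
-(1/12) times the second derivative up to a multiple of `cid`. The boundary terms collect into the
factor sin s + s cos s, which is why the eigenvalues come from the zeros of `omega`. -/
theorem integral_kerI_mul_osc {s : ℝ} (hs : s ≠ 0) {u : ℝ} (hu : u ∈ Icc (0 : ℝ) 1) :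
    ∫ v in (0 : ℝ)..1, kerI u v * osc s v =
      3 / s ^ 2 * osc s u - 3 / s ^ 2 * (Real.sin s + s * Real.cos s) * cid u := by
  have hc : Continuous fun v => kerI u v * osc s v := (continuous_kerI u).mul (osc s).continuous
  rw [← intervalIntegral.integral_add_adjacent_intervals (b := u) (hc.intervalIntegrable _ _)
    (hc.intervalIntegrable _ _)]
  have e1 : ∫ v in (0 : ℝ)..u, kerI u v * osc s v = ∫ v in (0 : ℝ)..u,
      (6 * v ^ 2 + (6 - 12 * u + 6 * (u - 1 / 2)) * v
        + (6 * u ^ 2 - 6 * u + 1 - 3 * (u - 1 / 2))) * osc s v := by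
    refine intervalIntegral.integral_congr fun v hv => ?_
    rw [uIcc_of_le hu.1] at hv
    simp only [kerI]
    rw [abs_of_nonneg (by linarith [hv.2])]
    ring
  have e2 : ∫ v in u..1, kerI u v * osc s v = ∫ v in u..1,
      (6 * v ^ 2 + (-6 - 12 * u + 6 * (u - 1 / 2)) * v
        + (6 * u ^ 2 + 6 * u + 1 - 3 * (u - 1 / 2))) * osc s v := by
    refine intervalIntegral.integral_congr fun v hv => ?_
    rw [uIcc_of_le hu.2] at hv
    simp only [kerI]
    rw [abs_of_nonpos (by linarith [hv.1])]
    ring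
  rw [e1, e2, integral_quadratic_mul_osc hs, integral_quadratic_mul_osc hs, osc_apply, cid_apply,
    show 2 * s * (1 - 1 / 2) = s by ring, show 2 * s * (0 - 1 / 2) = -s by ring, Real.cos_neg,
    Real.sin_neg]
  field_simp
  ring

/-! ### The integral operator on the unit interval -/

/-- The functions of the expansion of `kerI` as elements of `L²([0,1])`. -/
noncomputable def kVec (i : KIdx) : Lp ℝ 2 unifI := vecI (kFun i)

theorem ae_abs_kFun_le : ∀ᵐ u ∂unifI, ∀ i, |kFun i u| ≤ √2 :=
  ae_mem_unifI.mono fun _ hu i => abs_kFun_le hu i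

theorem norm_kVec_le (i : KIdx) : ‖kVec i‖ ≤ √2 :=
  norm_le_of_ae_abs_le (fun i => vecI_ae (kFun i)) ae_abs_kFun_le (Real.sqrt_nonneg 2) i

/-- The integral operator with kernel `kerI`. -/
noncomputable def opI : Lp ℝ 2 unifI →L[ℝ] Lp ℝ 2 unifI := symOp kCoef kVec

theorem isSymmetric_opI (f g : Lp ℝ 2 unifI) : ⟪opI f, g⟫ = ⟪f, opI g⟫ :=
  isSymmetric_symOp summable_kCoef norm_kVec_le f g

theorem hasSum_opI (f : Lp ℝ 2 unifI) : HasSum (fun i => (kCoef i * ⟪kVec i, f⟫) • kVec i) (opI f) :=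
  hasSum_symOp_apply summable_kCoef norm_kVec_le f

theorem opI_phi (j : ℕ) : opI (vecI (phi j)) = nu j • vecI (phi j) := by
  have h1 := hasSum_opI (vecI (phi j))
  have h2 := hasSum_single (f := fun i => (kCoef i * ⟪kVec i, vecI (phi j)⟫) • kVec i)
    (Sum.inl (Sum.inl j)) fun i hi => by
      rcases i with (k | k) | k
      · have hkj : k ≠ j := fun h => hi (by rw [h])
        simp [kVec, kFun, inner_phi_phi, hkj]
      · simp [kVec, kFun, inner_psi_phi]
      · simp [kVec, kFun, inner_cid_phi]
  rw [h1.unique h2]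
  show (nu j * ⟪vecI (phi j), vecI (phi j)⟫) • vecI (phi j) = _
  rw [inner_phi_phi, if_pos rfl, mul_one]

theorem opI_osc {s : ℝ} (hs : s ≠ 0) : opI (vecI (osc s)) =
    (3 / s ^ 2) • vecI (osc s) - (3 / s ^ 2 * (Real.sin s + s * Real.cos s)) • vecI cid := by
  refine symOp_apply_eq_of_kernel (k := kerI) summable_kCoef (fun i => vecI_ae (kFun i))
    ae_abs_kFun_le (Real.sqrt_nonneg 2) ?_ ?_
  · filter_upwards [ae_mem_unifI] with u hu
    filter_upwards [ae_mem_unifI] with v hv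
    exact hasSum_kerI hu hv
  · filter_upwards [ae_mem_unifI, vecI_ae (osc s), vecI_ae cid,
      Lp.coeFn_sub ((3 / s ^ 2) • vecI (osc s))
        ((3 / s ^ 2 * (Real.sin s + s * Real.cos s)) • vecI cid),
      Lp.coeFn_smul (3 / s ^ 2) (vecI (osc s)),
      Lp.coeFn_smul (3 / s ^ 2 * (Real.sin s + s * Real.cos s)) (vecI cid)] with u hu h1 h2 h3 h4 h5
    have h6 : ∫ v, kerI u v * vecI (osc s) v ∂unifI = ∫ v, kerI u v * osc s v ∂unifI := by
      refine integral_congr_ae ?_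
      filter_upwards [vecI_ae (osc s)] with v hv
      rw [hv]
    rw [h6, integral_unifI, integral_kerI_mul_osc hs hu, h3, Pi.sub_apply, h4, h5, Pi.smul_apply,
      Pi.smul_apply, h1, h2, smul_eq_mul, smul_eq_mul]

/-- The factor between `χ_j` and `osc (srt j)`. -/
noncomputable def chiCoef (j : ℕ) : ℝ :=
  (√(1 / 2 + mu j / 3))⁻¹ * (Real.cos (srt j) * (srt j + 1 / srt j))

theorem chiCoef_ne_zero (j : ℕ) : chiCoef j ≠ 0 := by
  have h1 := mu_pos j
  have h2 := srt_pos j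
  have h3 : √(1 / 2 + mu j / 3) ≠ 0 := (Real.sqrt_pos.2 (by positivity)).ne'
  exact mul_ne_zero (inv_ne_zero h3) (mul_ne_zero (cos_srt_ne_zero j) (by positivity))

/-- With the argument written as s + 2s(u - 1/2), the part even about 1/2 has coefficient cos s +
(sin s)/s, which is zero at s = `srt j`. Only the odd part survives. -/
theorem chi_eq (j : ℕ) (u : ℝ) : chi j u = chiCoef j * osc (srt j) u := by
  have hs := srt_pos j
  have e1 : √(3 / mu j) = srt j := by
    rw [mu_eq, div_div_cancel₀ three_ne_zero, Real.sqrt_sq hs.le]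
  have e2 : √(mu j / 3) = 1 / srt j := by
    rw [mu_eq, div_div, mul_comm, ← div_div, div_self three_ne_zero, Real.sqrt_div zero_le_one,
      Real.sqrt_one, Real.sqrt_sq hs.le]
  show (√(1 / 2 + mu j / 3))⁻¹ * (Real.cos (2 * √(3 / mu j) * u)
      + √(mu j / 3) * Real.sin (2 * √(3 / mu j) * u)) = _
  rw [e1, e2, osc_apply, chiCoef, mul_assoc (√(1 / 2 + mu j / 3))⁻¹]
  congr 1
  rw [show 2 * srt j * u = srt j + 2 * srt j * (u - 1 / 2) by ring, Real.cos_add, Real.sin_add,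
    sin_srt]
  field_simp
  ring

theorem vecI_chi (j : ℕ) : vecI (chi j) = chiCoef j • vecI (osc (srt j)) := by
  refine Lp.ext ?_
  filter_upwards [vecI_ae (chi j), vecI_ae (osc (srt j)),
    Lp.coeFn_smul (chiCoef j) (vecI (osc (srt j)))] with u h1 h2 h3
  rw [h1, h3, Pi.smul_apply, h2, chi_eq, smul_eq_mul]

theorem opI_osc_srt (j : ℕ) : opI (vecI (osc (srt j))) = mu j • vecI (osc (srt j)) := by
  rw [opI_osc (srt_pos j).ne', sin_srt_add, mul_zero, zero_smul, sub_zero, mu_eq]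

theorem opI_chi (j : ℕ) : opI (vecI (chi j)) = mu j • vecI (chi j) := by
  rw [vecI_chi, map_smul, opI_osc_srt, smul_comm]

theorem inner_chi_self (j : ℕ) : ⟪vecI (chi j), vecI (chi j)⟫ = 1 := by
  have hs := srt_pos j
  have h1 := mu_pos j
  have h0 : 0 < 1 / 2 + mu j / 3 := by positivity
  have h2 : (√(1 / 2 + mu j / 3))⁻¹ ^ 2 = (1 / 2 + 1 / srt j ^ 2)⁻¹ := by
    rw [inv_pow, Real.sq_sqrt h0.le, mu_eq]
    congr 2
    field_simp
  have h3 := cos_srt_sq j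
  rw [vecI_chi, real_inner_smul_left, real_inner_smul_right, inner_osc_osc hs.ne', sin_srt]
  have h4 : chiCoef j ^ 2 = (1 / 2 + 1 / srt j ^ 2)⁻¹ *
      (1 / (1 + srt j ^ 2) * (srt j + 1 / srt j) ^ 2) := by
    rw [chiCoef, mul_pow, h2, mul_pow, h3]
  have h5 : 1 / 2 - -(srt j * Real.cos (srt j)) * Real.cos (srt j) / (2 * srt j)
      = 1 / 2 + 1 / (1 + srt j ^ 2) / 2 := by
    rw [← h3]
    field_simp
    ring
  rw [h5, ← mul_assoc, ← pow_two, h4]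
  have h6 : 0 < 1 + srt j ^ 2 := by positivity
  have h7 : 0 < 1 / 2 + 1 / srt j ^ 2 := by positivity
  field_simp
  ring

theorem bcoef_eq (j : ℕ) : bcoef j = ⟪vecI cid, vecI (chi j)⟫ := by rw [inner_vecI]; rfl

theorem inner_cid_osc_srt_ne_zero (j : ℕ) : ⟪vecI cid, vecI (osc (srt j))⟫ ≠ 0 := by
  have hs := srt_pos j
  have : ⟪vecI cid, vecI (osc (srt j))⟫ = -Real.cos (srt j) / srt j := by
    rw [inner_cid_osc hs.ne', sin_srt]
    field_simp
    ring
  rw [this]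
  exact div_ne_zero (neg_ne_zero.2 (cos_srt_ne_zero j)) hs.ne'

theorem bcoef_ne_zero (j : ℕ) : bcoef j ≠ 0 := by
  rw [bcoef_eq, vecI_chi, real_inner_smul_right]
  exact mul_ne_zero (chiCoef_ne_zero j) (inner_cid_osc_srt_ne_zero j)

/-- The eigenfunctions of `opI`. -/
noncomputable def eI : ℕ ⊕ ℕ → Lp ℝ 2 unifI
  | .inl j => vecI (phi j)
  | .inr j => vecI (chi j)

/-- The eigenvalues of `opI`. -/
noncomputable def evI : ℕ ⊕ ℕ → ℝ
  | .inl j => nu j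
  | .inr j => mu j

theorem opI_eI (i : ℕ ⊕ ℕ) : opI (eI i) = evI i • eI i := by
  rcases i with j | j
  · exact opI_phi j
  · exact opI_chi j

/-- Equality would make `srt k` an integer multiple of π, where the sine vanishes. Together with the
injectivity of `nu` and `mu` this makes the φ_j and χ_k orthogonal through their eigenvalues. -/
theorem nu_ne_mu (j k : ℕ) : nu j ≠ mu k := fun h => by
  have hs := srt_pos k
  have hp := Real.pi_pos
  rw [nu, mu_eq, div_eq_div_iff (by positivity) (by positivity)] at h
  have h1 : srt k ^ 2 = (Real.pi * ((j : ℝ) + 1)) ^ 2 := by linarith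
  have h2 := (pow_left_inj₀ hs.le (by positivity) two_ne_zero).1 h1
  refine sin_srt_ne_zero k ?_
  rw [h2, show Real.pi * ((j : ℝ) + 1) = ((j + 1 : ℕ) : ℝ) * Real.pi by push_cast; ring]
  exact Real.sin_nat_mul_pi _

theorem evI_injective : Function.Injective evI := by
  rintro (j | j) (k | k) h
  · exact congrArg _ (nu_injective h)
  · exact absurd h (nu_ne_mu j k)
  · exact absurd h.symm (nu_ne_mu k j)
  · exact congrArg _ (mu_injective h)

/-- Eigenvectors of a symmetric operator with different eigenvalues are orthogonal. -/
theorem inner_eq_zero_of_eigenvalue_ne {H : Type*} [NormedAddCommGroup H] [InnerProductSpace ℝ H]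
    {T : H →L[ℝ] H} (hT : ∀ f g, ⟪T f, g⟫ = ⟪f, T g⟫) {f g : H} {a b : ℝ} (hf : T f = a • f)
    (hg : T g = b • g) (hab : a ≠ b) : ⟪f, g⟫ = 0 := by
  have h := hT f g
  rw [hf, hg, real_inner_smul_left, real_inner_smul_right] at h
  have h2 : (a - b) * ⟪f, g⟫ = 0 := by linarith
  exact (mul_eq_zero.1 h2).resolve_left (sub_ne_zero.2 hab)

theorem orthonormal_eI : Orthonormal ℝ eI := by
  refine ⟨fun i => ?_, fun i j hij => ?_⟩
  · have h : ⟪eI i, eI i⟫ = 1 := by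
      rcases i with j | j
      · exact (inner_phi_phi j j).trans (if_pos rfl)
      · exact inner_chi_self j
    rw [real_inner_self_eq_norm_sq] at h
    exact (pow_eq_one_iff_of_nonneg (norm_nonneg _) two_ne_zero).1 h
  · exact inner_eq_zero_of_eigenvalue_ne isSymmetric_opI (opI_eI i) (opI_eI j)
      fun h => hij (evI_injective h)

/-- An eigenfunction of `opI` that is orthogonal to `cid` is orthogonal to all functions that are
orthogonal to the `φ_j`. -/
theorem inner_eq_zero_of_opI_eq_smul {l : ℝ} (hl : l ≠ 0) {f h : Lp ℝ 2 unifI}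
    (hf : opI f = l • f) (hfc : ⟪vecI cid, f⟫ = 0) (hh : ∀ j, ⟪vecI (phi j), h⟫ = 0) :
    ⟪h, f⟫ = 0 := by
  have hsum : ∀ g : Lp ℝ 2 unifI,
      HasSum (fun i => kCoef i * ⟪kVec i, f⟫ * ⟪kVec i, g⟫) (l * ⟪g, f⟫) := fun g => by
    have := hasSum_inner_symOp summable_kCoef norm_kVec_le g f
    rwa [show symOp kCoef kVec f = l • f from hf, real_inner_smul_right] at this
  have h0 : ∀ i, ⟪kVec (.inr i), f⟫ = 0 := fun _ => hfc
  -- Orthogonality to `cid` removes the rank one term, so the eigenvalue equation is diagonal in the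
  -- sines.
  have hpsi : ∀ n, nu n * ⟪vecI (psi n), f⟫ = l * ⟪vecI (psi n), f⟫ := fun n => by
    have h2 := hasSum_single
      (f := fun i => kCoef i * ⟪kVec i, f⟫ * ⟪kVec i, vecI (psi n)⟫) (.inl (.inr n)) fun i hi => by
        rcases i with (k | k) | k
        · simp [kVec, kFun, real_inner_comm (vecI (psi n)), inner_psi_phi]
        · have hkn : k ≠ n := fun h => hi (by rw [h])
          simp [kVec, kFun, inner_psi_psi, hkn]
        · simp [h0]
    rw [(hsum _).unique h2]
    show _ = nu n * ⟪vecI (psi n), f⟫ * ⟪vecI (psi n), vecI (psi n)⟫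
    rw [inner_psi_psi, if_pos rfl, mul_one]
  -- If ψ_n occurred in f, then ν_n = l, and no other ψ_k could occur because the ν are distinct.
  -- Pairing with `cid` would give ν_n ⟨ψ_n, f⟩ ⟨ψ_n, c⟩ = l ⟨c, f⟩ = 0, although ⟨ψ_n, c⟩ ≠ 0.
  have hpsi0 : ∀ n, ⟪vecI (psi n), f⟫ = 0 := fun n => by
    by_contra hn
    have hnl : nu n = l := mul_right_cancel₀ hn (hpsi n)
    have h2 := hasSum_single
      (f := fun i => kCoef i * ⟪kVec i, f⟫ * ⟪kVec i, vecI cid⟫) (.inl (.inr n)) fun i hi => by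
        rcases i with (k | k) | k
        · simp [kVec, kFun, real_inner_comm (vecI cid), inner_cid_phi]
        · have hkn : k ≠ n := fun h => hi (by rw [h])
          have : ⟪vecI (psi k), f⟫ = 0 := by
            by_contra hk
            exact hkn (nu_injective ((mul_right_cancel₀ hk (hpsi k)).trans hnl.symm))
          simp [kVec, kFun, this]
        · simp [h0]
    have h3 := (hsum _).unique h2
    rw [hfc, mul_zero] at h3
    have h4 : ⟪vecI (psi n), vecI cid⟫ ≠ 0 := by
      rw [real_inner_comm, inner_cid_psi]
      have := Real.pi_pos
      have h2 : (0 : ℝ) < √2 := by positivity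
      exact div_ne_zero (neg_ne_zero.2 h2.ne') (by positivity)
    exact mul_ne_zero (mul_ne_zero (nu_pos n).ne' hn) h4 h3.symm
  have h5 : HasSum (fun i => kCoef i * ⟪kVec i, f⟫ * ⟪kVec i, h⟫) 0 := by
    have e : (fun i => kCoef i * ⟪kVec i, f⟫ * ⟪kVec i, h⟫) = fun _ => 0 := by
      funext i
      rcases i with (k | k) | k
      · simp [kVec, kFun, hh]
      · simp [kVec, kFun, hpsi0]
      · simp [h0]
    rw [e]; exact hasSum_zero
  exact (mul_eq_zero.1 ((hsum h).unique h5)).resolve_left hl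

/-- Every eigenfunction for l > 0 is compared with `osc s`, where l = 3/s². In each case the problem
reduces to an eigenfunction orthogonal to `cid`, which only involves the φ_j. -/
theorem opI_eq_zero_of_orthogonal {h : Lp ℝ 2 unifI} (hh : ∀ i, ⟪eI i, h⟫ = 0) : opI h = 0 := by
  refine apply_eq_zero_of_orthogonal_eigenvectors
    (isCompactOperator_symOp summable_kCoef norm_kVec_le)
    (isSymmetric_symOp summable_kCoef norm_kVec_le) fun l f hl hf => ?_
  have hphi : ∀ j, ⟪vecI (phi j), h⟫ = 0 := fun j => hh (.inl j)
  by_cases hfz : f = 0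
  · simp [hfz]
  have hl0 : 0 < l := by
    have h1 := inner_symOp_nonneg summable_kCoef norm_kVec_le (fun i => (kCoef_pos i).le) f
    rw [hf, real_inner_smul_right, real_inner_self_eq_norm_sq] at h1
    have h2 : 0 < ‖f‖ ^ 2 := by positivity
    exact lt_of_le_of_ne (nonneg_of_mul_nonneg_left h1 h2) hl.symm
  set s := √(3 / l) with hs
  have hs0 : 0 < s := Real.sqrt_pos.2 (by positivity)
  have hls : l = 3 / s ^ 2 := by
    rw [hs, Real.sq_sqrt (by positivity)]
    field_simp
  -- Here `osc s` is itself an eigenfunction for l, proportional to some χ_j and not orthogonal to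
  -- `cid`; subtracting a multiple of it from f makes the difference orthogonal to `cid`.
  by_cases hc : Real.sin s + s * Real.cos s = 0
  · obtain ⟨j, hj⟩ := exists_srt_eq hs0 hc
    have hlj : l = mu j := by rw [mu_eq, hj, hls]
    set b := ⟪vecI cid, vecI (osc s)⟫ with hb
    have hb0 : b ≠ 0 := by rw [hb, ← hj]; exact inner_cid_osc_srt_ne_zero j
    have hosc : opI (vecI (osc s)) = l • vecI (osc s) := by rw [hlj, ← hj, opI_osc_srt]
    have h1 := inner_eq_zero_of_opI_eq_smul (l := l) (h := h) hl
      (f := f - (⟪vecI cid, f⟫ / b) • vecI (osc s))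
      (by rw [map_sub, map_smul, hosc, show opI f = l • f from hf, smul_sub, smul_comm])
      (by rw [inner_sub_right, real_inner_smul_right, ← hb, div_mul_cancel₀ _ hb0, sub_self]) hphi
    have h2 : ⟪h, vecI (osc s)⟫ = 0 := by
      have h3 : ⟪vecI (chi j), h⟫ = 0 := hh (.inr j)
      rw [vecI_chi, real_inner_smul_left, hj] at h3
      rw [real_inner_comm]
      exact (mul_eq_zero.1 h3).resolve_left (chiCoef_ne_zero j)
    rw [inner_sub_right, real_inner_smul_right, h2, mul_zero, sub_zero] at h1
    exact h1
  -- Symmetry of the operator, tested on f and `osc s`, leaves l (sin s + s cos s) ⟨c, f⟩ = 0, so f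
  -- is already orthogonal to `cid`.
  · refine inner_eq_zero_of_opI_eq_smul hl hf ?_ hphi
    have h1 := isSymmetric_opI f (vecI (osc s))
    rw [show opI f = l • f from hf, opI_osc hs0.ne', ← hls, real_inner_smul_left, inner_sub_right,
      real_inner_smul_right, real_inner_smul_right, real_inner_comm (vecI cid)] at h1
    have h2 : l * (Real.sin s + s * Real.cos s) * ⟪vecI cid, f⟫ = 0 := by linarith
    exact (mul_eq_zero.1 h2).resolve_left (mul_ne_zero hl hc)

theorem inner_kVec_eq_zero {h : Lp ℝ 2 unifI} (hh : ∀ i, ⟪eI i, h⟫ = 0) (i : KIdx) :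
    ⟪kVec i, h⟫ = 0 :=
  inner_eq_zero_of_symOp_eq_zero summable_kCoef norm_kVec_le kCoef_pos
    (opI_eq_zero_of_orthogonal hh) i

/-- Although `eI` is only known to be complete up to the kernel of `opI`, positivity of all
coefficients puts each function of the expansion, in particular `cid`, into its closed span. -/
theorem hasSum_kVec (i : KIdx) : HasSum (fun j => ⟪eI j, kVec i⟫ • eI j) (kVec i) :=
  hasSum_inner_smul_of_forall_orthogonal orthonormal_eI fun h hh => by
    rw [real_inner_comm]; exact inner_kVec_eq_zero hh i

/-! ### The patterns in terms of pairings of the four points -/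

/-- The points `0` and `j` have ranks in the same half `{1, 2}` or `{3, 4}`. -/
def SameHalf (q : Fin 4 → ℕ) (j : Fin 4) : Prop := q j ≤ 2 ↔ q 0 ≤ 2

/-- The points `0` and `j` have ranks of the same parity. -/
def SameParity (q : Fin 4 → ℕ) (j : Fin 4) : Prop := q j % 2 = q 0 % 2

instance (q : Fin 4 → ℕ) (j : Fin 4) : Decidable (SameHalf q j) := by
  unfold SameHalf; infer_instance

instance (q : Fin 4 → ℕ) (j : Fin 4) : Decidable (SameParity q j) := by
  unfold SameParity; infer_instance

/-- The rank vector given by a permutation. -/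
def permRank (σ : Equiv.Perm (Fin 4)) (i : Fin 4) : ℕ := (σ i : ℕ) + 1

/-- This and the next lemma turn rank conditions into order relations that can be integrated
directly: halves agree when the other two points lie on one common side of both, and parities agree
when exactly one point lies between. -/
theorem sameHalf_one_iff : ∀ σ : Equiv.Perm (Fin 4), SameHalf (permRank σ) 1 ↔
    ((σ 2 < σ 0 ∧ σ 2 < σ 1) ∧ (σ 3 < σ 0 ∧ σ 3 < σ 1)) ∨
    ((σ 0 < σ 2 ∧ σ 1 < σ 2) ∧ (σ 0 < σ 3 ∧ σ 1 < σ 3)) := by decide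

theorem sameParity_one_iff : ∀ σ : Equiv.Perm (Fin 4), SameParity (permRank σ) 1 ↔
    ¬ (((σ 0 < σ 2 ∧ σ 2 < σ 1) ∨ (σ 1 < σ 2 ∧ σ 2 < σ 0)) ↔
      ((σ 0 < σ 3 ∧ σ 3 < σ 1) ∨ (σ 1 < σ 3 ∧ σ 3 < σ 0))) := by decide

theorem sum_sameHalf : ∀ σ : Equiv.Perm (Fin 4),
    (∑ j : Fin 3, if SameHalf (permRank σ) j.succ then 1 else 0) = 1 := by decide

theorem sum_sameParity : ∀ σ : Equiv.Perm (Fin 4),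
    (∑ j : Fin 3, if SameParity (permRank σ) j.succ then 1 else 0) = 1 := by decide

/-- `setD` is the set of all permutations taking the splitting {1,2}, {3,4} to {1,3}, {2,4}.
Membership therefore means that point 0 has the same partner `j.succ` in the half pairing of first
ranks and in the parity pairing of second ranks. -/
theorem count_setD : ∀ σ τ : Equiv.Perm (Fin 4),
    (∑ w ∈ setD, if ∀ i, permRank τ i = w (σ i) then 1 else 0) =
    ∑ j : Fin 3, if SameHalf (permRank σ) j.succ ∧ SameParity (permRank τ) j.succ
      then 1 else 0 := by
  decide +kernel

theorem count_setE : ∀ σ τ : Equiv.Perm (Fin 4),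
    (∑ w ∈ setE, if ∀ i, permRank τ i = w (σ i) then 1 else 0) =
    ∑ j : Fin 3, if SameParity (permRank σ) j.succ ∧ SameHalf (permRank τ) j.succ
      then 1 else 0 := by
  decide +kernel

theorem rk_lt_rk {x : Fin 4 → ℝ} {i j : Fin 4} (h : x i < x j) : rk x i < rk x j := by
  refine Finset.card_lt_card (Finset.ssubset_iff_of_subset ?_ |>.2 ⟨j, ?_, ?_⟩)
  · intro k hk
    simp only [Finset.mem_filter, Finset.mem_univ, true_and] at hk ⊢
    exact hk.trans h.le
  · simp
  · simp [h]

/-- The ranks of a sample without ties form a permutation that has the same order. -/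
theorem exists_permRank_eq {x : Fin 4 → ℝ} (hx : Function.Injective x) :
    ∃ σ : Equiv.Perm (Fin 4), rk x = permRank σ ∧ ∀ i j, x i < x j ↔ σ i < σ j := by
  have h1 : ∀ i, 1 ≤ rk x i := fun i => Finset.card_pos.2 ⟨i, by simp⟩
  have h4 : ∀ i, rk x i ≤ 4 := fun i => (Finset.card_le_univ _).trans (by simp)
  have hlt : ∀ i j, x i < x j ↔ rk x i < rk x j := fun i j => by
    refine ⟨rk_lt_rk, fun h => ?_⟩
    by_contra hn
    rcases (not_lt.1 hn).eq_or_lt with h' | h'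
    · rw [hx h'] at h; exact lt_irrefl _ h
    · exact lt_asymm h (rk_lt_rk h')
  let f : Fin 4 → Fin 4 := fun i => ⟨rk x i - 1, by have := h1 i; have := h4 i; omega⟩
  have hf : Function.Injective f := fun i j h => by
    have h' : rk x i - 1 = rk x j - 1 := congrArg Fin.val h
    have e : rk x i = rk x j := by have := h1 i; have := h1 j; omega
    refine hx (le_antisymm ?_ ?_)
    · exact not_lt.1 fun hl => (rk_lt_rk hl).ne e.symm
    · exact not_lt.1 fun hl => (rk_lt_rk hl).ne e
  refine ⟨Equiv.ofBijective f (Finite.injective_iff_bijective.1 hf), ?_, fun i j => ?_⟩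
  · funext i
    have := h1 i
    simp only [permRank, Equiv.ofBijective_apply, f]
    omega
  · rw [hlt, Fin.lt_def]
    have := h1 i
    have := h1 j
    simp only [Equiv.ofBijective_apply, f]
    omega

/-- Indicator function of `SameHalf` for the ranks of a sample. -/
noncomputable def halfInd (x : Fin 4 → ℝ) (j : Fin 3) : ℝ :=
  if SameHalf (rk x) j.succ then 1 else 0

/-- Indicator function of `SameParity` for the ranks of a sample. -/
noncomputable def parInd (x : Fin 4 → ℝ) (j : Fin 3) : ℝ :=
  if SameParity (rk x) j.succ then 1 else 0

theorem hasPattern_iff {σ τ : Equiv.Perm (Fin 4)} {z : Fin 4 → ℝ × ℝ}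
    (hσ : rk (fun m => (z m).1) = permRank σ) (hτ : rk (fun m => (z m).2) = permRank τ)
    (w : Fin 4 → ℕ) : HasPattern w z ↔ ∀ i, permRank τ i = w (σ i) := by
  unfold HasPattern
  rw [hσ, hτ]
  refine ⟨fun h i => h i (σ i) rfl, fun h i p hp => ?_⟩
  rw [h i]
  congr 1
  refine Fin.ext ?_
  simpa [permRank] using hp

theorem statDE_eq {z : Fin 4 → ℝ × ℝ} (h1 : Function.Injective fun m => (z m).1)
    (h2 : Function.Injective fun m => (z m).2) :
    statDE z = 2 / 3 - ∑ j, (halfInd (fun m => (z m).1) j * parInd (fun m => (z m).2) j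
      + parInd (fun m => (z m).1) j * halfInd (fun m => (z m).2) j) := by
  obtain ⟨σ, hσ, -⟩ := exists_permRank_eq h1
  obtain ⟨τ, hτ, -⟩ := exists_permRank_eq h2
  have hD : setD.card = 8 := by decide
  have hE : setE.card = 8 := by decide
  have e1 : (∑ w ∈ setD, if ∀ i, permRank τ i = w (σ i) then (1 : ℝ) else 0) =
      ∑ j : Fin 3, halfInd (fun m => (z m).1) j * parInd (fun m => (z m).2) j := by
    have := congrArg (Nat.cast : ℕ → ℝ) (count_setD σ τ)
    push_cast at this
    rw [this]
    refine Finset.sum_congr rfl fun j _ => ?_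
    rw [halfInd, parInd, hσ, hτ, ite_zero_mul_ite_zero, mul_one]
  have e2 : (∑ w ∈ setE, if ∀ i, permRank τ i = w (σ i) then (1 : ℝ) else 0) =
      ∑ j : Fin 3, parInd (fun m => (z m).1) j * halfInd (fun m => (z m).2) j := by
    have := congrArg (Nat.cast : ℕ → ℝ) (count_setE σ τ)
    push_cast at this
    rw [this]
    refine Finset.sum_congr rfl fun j _ => ?_
    rw [halfInd, parInd, hσ, hτ, ite_zero_mul_ite_zero, mul_one]
  have e3 : ∀ A : Finset (Fin 4 → ℕ), statT A z =
      A.card / 24 - ∑ w ∈ A, if ∀ i, permRank τ i = w (σ i) then (1 : ℝ) else 0 := fun A => by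
    unfold statT
    congr 1
    refine Finset.sum_congr rfl fun w _ => ?_
    by_cases h : HasPattern w z
    · rw [if_pos h, if_pos ((hasPattern_iff hσ hτ w).1 h)]
    · rw [if_neg h, if_neg fun h' => h ((hasPattern_iff hσ hτ w).2 h')]
  rw [statDE, e3, e3, Finset.sum_add_distrib, ← e1, ← e2, hD, hE]
  push_cast
  ring

theorem measurable_halfInd (j : Fin 3) : Measurable fun x => halfInd x j := by
  have h : Measurable fun x : Fin 4 → ℝ => (rk x j.succ, rk x 0) :=
    (measurable_rk _).prodMk (measurable_rk _)
  exact (Measurable.of_discrete (f := fun p : ℕ × ℕ =>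
    if (p.1 ≤ 2 ↔ p.2 ≤ 2) then (1 : ℝ) else 0)).comp h

theorem measurable_parInd (j : Fin 3) : Measurable fun x => parInd x j := by
  have h : Measurable fun x : Fin 4 → ℝ => (rk x j.succ, rk x 0) :=
    (measurable_rk _).prodMk (measurable_rk _)
  exact (Measurable.of_discrete (f := fun p : ℕ × ℕ =>
    if p.1 % 2 = p.2 % 2 then (1 : ℝ) else 0)).comp h

theorem abs_halfInd_le (x : Fin 4 → ℝ) (j : Fin 3) : |halfInd x j| ≤ 1 := by
  unfold halfInd; split_ifs <;> simp

theorem abs_parInd_le (x : Fin 4 → ℝ) (j : Fin 3) : |parInd x j| ≤ 1 := by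
  unfold parInd; split_ifs <;> simp

/-! ### Integration over the last two points -/

theorem integrable_of_measurable_of_abs_le {α : Type*} [MeasurableSpace α] {μ : Measure α}
    [IsFiniteMeasure μ] {f : α → ℝ} (hf : Measurable f) (C : ℝ) (hC : ∀ x, |f x| ≤ C) :
    Integrable f μ :=
  Integrable.of_bound hf.aestronglyMeasurable C (Filter.Eventually.of_forall hC)

/-- Abscissas and ordinates of the two random points are independent, so each product integrates to
a product of one-dimensional means. -/
theorem integral_integral_sub_sum_mul {κ : Type*} [Fintype κ] {F G : κ → ℝ → ℝ → ℝ}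
    (hF : ∀ k, Measurable (Function.uncurry (F k))) (hG : ∀ k, Measurable (Function.uncurry (G k)))
    (hF1 : ∀ k x y, |F k x y| ≤ 1) (hG1 : ∀ k x y, |G k x y| ≤ 1) (C : ℝ) :
    ∫ z, ∫ w, (C - ∑ k, F k z.1 w.1 * G k z.2 w.2) ∂unifSq ∂unifSq =
      C - ∑ k, (∫ x, ∫ y, F k x y ∂unifI ∂unifI) * ∫ x, ∫ y, G k x y ∂unifI ∂unifI := by
  have hFG : ∀ k (z : ℝ × ℝ), Integrable (fun w : ℝ × ℝ => F k z.1 w.1 * G k z.2 w.2) unifSq :=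
    fun k z => by
      refine integrable_of_measurable_of_abs_le ?_ 1 fun w => ?_
      · exact ((hF k).of_uncurry_left.comp measurable_fst).mul
          ((hG k).of_uncurry_left.comp measurable_snd)
      · rw [abs_mul]; exact mul_le_one₀ (hF1 _ _ _) (abs_nonneg _) (hG1 _ _ _)
  have hm : ∀ {F : ℝ → ℝ → ℝ}, Measurable (Function.uncurry F) →
      Measurable fun x => ∫ y, F x y ∂unifI := fun h =>
    (h.stronglyMeasurable.integral_prod_right).measurable
  have hb : ∀ {F : ℝ → ℝ → ℝ}, (∀ x y, |F x y| ≤ 1) → ∀ x, |∫ y, F x y ∂unifI| ≤ 1 :=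
    fun h x => by
      simpa using norm_integral_le_of_norm_le_const (μ := unifI)
        (Filter.Eventually.of_forall fun y => (Real.norm_eq_abs _).trans_le (h x y))
  have h1 : ∀ z : ℝ × ℝ, ∫ w, (C - ∑ k, F k z.1 w.1 * G k z.2 w.2) ∂unifSq =
      C - ∑ k, (∫ y, F k z.1 y ∂unifI) * ∫ y, G k z.2 y ∂unifI := fun z => by
    rw [integral_sub (integrable_const _) (integrable_finsetSum _ fun k _ => hFG k z),
      integral_finsetSum _ fun k _ => hFG k z]
    congr 1
    · simp
    · exact Finset.sum_congr rfl fun k _ => integral_prod_mul _ _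
  simp only [h1]
  have h2 : ∀ k, Integrable (fun z : ℝ × ℝ => (∫ y, F k z.1 y ∂unifI) * ∫ y, G k z.2 y ∂unifI)
      unifSq := fun k => by
    refine integrable_of_measurable_of_abs_le ?_ 1 fun w => ?_
    · exact ((hm (hF k)).comp measurable_fst).mul ((hm (hG k)).comp measurable_snd)
    · rw [abs_mul]; exact mul_le_one₀ (hb (hF1 k) _) (abs_nonneg _) (hb (hG1 k) _)
  rw [integral_sub (integrable_const _) (integrable_finsetSum _ fun k _ => h2 k),
    integral_finsetSum _ fun k _ => h2 k]
  congr 1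
  · simp
  · exact Finset.sum_congr rfl fun k _ => integral_prod_mul
      (fun x => ∫ y, F k x y ∂unifI) fun x => ∫ y, G k x y ∂unifI

/-- The mean of `halfInd` over the last two points. -/
noncomputable def halfMean (a b : ℝ) (j : Fin 3) : ℝ :=
  ∫ x, ∫ y, halfInd ![a, b, x, y] j ∂unifI ∂unifI

/-- The mean of `parInd` over the last two points. -/
noncomputable def parMean (a b : ℝ) (j : Fin 3) : ℝ :=
  ∫ x, ∫ y, parInd ![a, b, x, y] j ∂unifI ∂unifI

theorem measurable_vec4 (a b : ℝ) : Measurable fun p : ℝ × ℝ => ![a, b, p.1, p.2] :=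
  measurable_pi_iff.2 fun i => by
    fin_cases i
    · exact measurable_const
    · exact measurable_const
    · exact measurable_fst
    · exact measurable_snd

theorem ae_ne_unifI (a : ℝ) : ∀ᵐ x ∂unifI, x ≠ a :=
  ae_restrict_of_ae (Measure.ae_ne volume a)

theorem injective_vec4 {a b x y : ℝ} (hab : a ≠ b) (hxa : x ≠ a) (hxb : x ≠ b) (hya : y ≠ a)
    (hyb : y ≠ b) (hyx : y ≠ x) : Function.Injective ![a, b, x, y] := by
  intro i j h
  fin_cases i <;> fin_cases j <;> simp_all [eq_comm]

theorem ae_ne_unifSq (a b : ℝ) : ∀ᵐ z ∂unifSq, z.1 ≠ a ∧ z.2 ≠ b :=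
  ((Measure.quasiMeasurePreserving_fst (μ := unifI) (ν := unifI)).ae (ae_ne_unifI a)).and
    ((Measure.quasiMeasurePreserving_snd (μ := unifI) (ν := unifI)).ae (ae_ne_unifI b))

theorem kernelDE_eq_means {z₁ z₂ : ℝ × ℝ} (h1 : z₁.1 ≠ z₂.1) (h2 : z₁.2 ≠ z₂.2) :
    kernelDE z₁ z₂ = 2 / 3 - ∑ j, (halfMean z₁.1 z₂.1 j * parMean z₁.2 z₂.2 j
      + parMean z₁.1 z₂.1 j * halfMean z₁.2 z₂.2 j) := by
  -- The left summand indexes the pairings from `setD`, the right one those from `setE`. Ties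
  -- involving the random points form a null set; ties between the fixed points are excluded by
  -- hypothesis.
  have e1 : kernelDE z₁ z₂ = ∫ z, ∫ w, (2 / 3 - ∑ k : Fin 3 ⊕ Fin 3,
      (Sum.elim (fun j => halfInd ![z₁.1, z₂.1, z.1, w.1] j)
        (fun j => parInd ![z₁.1, z₂.1, z.1, w.1] j) k) *
      (Sum.elim (fun j => parInd ![z₁.2, z₂.2, z.2, w.2] j)
        (fun j => halfInd ![z₁.2, z₂.2, z.2, w.2] j) k)) ∂unifSq ∂unifSq := by
    unfold kernelDE
    refine integral_congr_ae ?_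
    filter_upwards [ae_ne_unifSq z₁.1 z₁.2, ae_ne_unifSq z₂.1 z₂.2] with z hz1 hz2
    refine integral_congr_ae ?_
    filter_upwards [ae_ne_unifSq z₁.1 z₁.2, ae_ne_unifSq z₂.1 z₂.2, ae_ne_unifSq z.1 z.2]
      with w hw1 hw2 hw
    have f1 : (fun m => (![z₁, z₂, z, w] m).1) = ![z₁.1, z₂.1, z.1, w.1] := by
      funext m; fin_cases m <;> rfl
    have f2 : (fun m => (![z₁, z₂, z, w] m).2) = ![z₁.2, z₂.2, z.2, w.2] := by
      funext m; fin_cases m <;> rfl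
    rw [statDE_eq (by rw [f1]; exact injective_vec4 h1 hz1.1 hz2.1 hw1.1 hw2.1 hw.1)
      (by rw [f2]; exact injective_vec4 h2 hz1.2 hz2.2 hw1.2 hw2.2 hw.2), f1, f2,
      Fintype.sum_sum_type, Finset.sum_add_distrib]
    rfl
  rw [e1, integral_integral_sub_sum_mul
    (F := fun k x y => Sum.elim (fun j => halfInd ![z₁.1, z₂.1, x, y] j)
        (fun j => parInd ![z₁.1, z₂.1, x, y] j) k)
    (G := fun k x y => Sum.elim (fun j => parInd ![z₁.2, z₂.2, x, y] j)
        (fun j => halfInd ![z₁.2, z₂.2, x, y] j) k), Fintype.sum_sum_type, Finset.sum_add_distrib]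
  · rfl
  · rintro (j | j)
    · exact (measurable_halfInd j).comp (measurable_vec4 _ _)
    · exact (measurable_parInd j).comp (measurable_vec4 _ _)
  · rintro (j | j)
    · exact (measurable_parInd j).comp (measurable_vec4 _ _)
    · exact (measurable_halfInd j).comp (measurable_vec4 _ _)
  · rintro (j | j) x y
    · exact abs_halfInd_le _ _
    · exact abs_parInd_le _ _
  · rintro (j | j) x y
    · exact abs_parInd_le _ _
    · exact abs_halfInd_le _ _

/-! ### Explicit means for the pairing that joins the two fixed points -/

theorem integral_indicator_unifI {s : Set ℝ} (hs : MeasurableSet s) :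
    ∫ x, s.indicator 1 x ∂unifI = volume.real (s ∩ Icc 0 1) := by
  rw [integral_indicator_one hs, unifI, measureReal_restrict_apply hs]

theorem integral_indicator_Iio {m : ℝ} (hm : m ∈ Icc (0 : ℝ) 1) :
    ∫ x, (Iio m).indicator 1 x ∂unifI = m := by
  have : Iio m ∩ Icc 0 1 = Ico 0 m := by
    ext x; constructor
    · rintro ⟨h1, h2⟩; exact ⟨h2.1, h1⟩
    · rintro ⟨h1, h2⟩; exact ⟨h2, h1, h2.le.trans hm.2⟩
  rw [integral_indicator_unifI measurableSet_Iio, this, Real.volume_real_Ico_of_le hm.1, sub_zero]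

theorem integral_indicator_Ioi {m : ℝ} (hm : m ∈ Icc (0 : ℝ) 1) :
    ∫ x, (Ioi m).indicator 1 x ∂unifI = 1 - m := by
  have : Ioi m ∩ Icc 0 1 = Ioc m 1 := by
    ext x; constructor
    · rintro ⟨h1, h2⟩; exact ⟨h1, h2.2⟩
    · rintro ⟨h1, h2⟩; exact ⟨h1, hm.1.trans h1.le, h2⟩
  rw [integral_indicator_unifI measurableSet_Ioi, this, Real.volume_real_Ioc_of_le hm.2]

theorem integral_indicator_Ioo {m M : ℝ} (hm : m ∈ Icc (0 : ℝ) 1) (hM : M ∈ Icc (0 : ℝ) 1)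
    (h : m ≤ M) : ∫ x, (Ioo m M).indicator 1 x ∂unifI = M - m := by
  have : Ioo m M ∩ Icc 0 1 = Ioo m M :=
    inter_eq_left.2 fun x hx => ⟨hm.1.trans hx.1.le, hx.2.le.trans hM.2⟩
  rw [integral_indicator_unifI measurableSet_Ioo, this, Real.volume_real_Ioo_of_le h]

theorem integrable_indicator_one {s : Set ℝ} (hs : MeasurableSet s) :
    Integrable (s.indicator 1 : ℝ → ℝ) unifI :=
  (integrable_const (1 : ℝ)).indicator hs

theorem halfInd_zero_eq {a b x y : ℝ} (h : Function.Injective ![a, b, x, y]) :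
    halfInd ![a, b, x, y] 0 =
      (Iio (min a b)).indicator 1 x * (Iio (min a b)).indicator 1 y +
      (Ioi (max a b)).indicator 1 x * (Ioi (max a b)).indicator 1 y := by
  obtain ⟨σ, hσ, hlt⟩ := exists_permRank_eq h
  have h1 := sameHalf_one_iff σ
  rw [← hσ, ← hlt, ← hlt, ← hlt, ← hlt, ← hlt, ← hlt, ← hlt, ← hlt] at h1
  have h2 : SameHalf (rk ![a, b, x, y]) 1 ↔
      (x < a ∧ x < b) ∧ (y < a ∧ y < b) ∨ (a < x ∧ b < x) ∧ (a < y ∧ b < y) := h1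
  have h3 : halfInd ![a, b, x, y] 0 = if SameHalf (rk ![a, b, x, y]) 1 then 1 else 0 := rfl
  rw [h3]
  simp only [h2, indicator_apply, mem_Iio, mem_Ioi, lt_min_iff, max_lt_iff, Pi.one_apply]
  by_cases p : x < a ∧ x < b <;> by_cases q : y < a ∧ y < b <;>
    by_cases r : a < x ∧ b < x <;> by_cases s : a < y ∧ b < y
  all_goals first | (exfalso; linarith [p.1, r.1]) | (exfalso; linarith [q.1, s.1]) | simp [p, q, r, s]

theorem parInd_zero_eq {a b x y : ℝ} (h : Function.Injective ![a, b, x, y]) :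
    parInd ![a, b, x, y] 0 =
      (Ioo (min a b) (max a b)).indicator 1 x * (1 - (Ioo (min a b) (max a b)).indicator 1 y) +
      (1 - (Ioo (min a b) (max a b)).indicator 1 x) * (Ioo (min a b) (max a b)).indicator 1 y := by
  obtain ⟨σ, hσ, hlt⟩ := exists_permRank_eq h
  have h1 := sameParity_one_iff σ
  rw [← hσ, ← hlt, ← hlt, ← hlt, ← hlt, ← hlt, ← hlt, ← hlt, ← hlt] at h1
  have hb : ∀ t, (a < t ∧ t < b ∨ b < t ∧ t < a) ↔ t ∈ Ioo (min a b) (max a b) := fun t => by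
    rw [mem_Ioo, min_lt_iff, lt_max_iff]
    constructor
    · rintro (⟨h1, h2⟩ | ⟨h1, h2⟩)
      · exact ⟨.inl h1, .inr h2⟩
      · exact ⟨.inr h1, .inl h2⟩
    · rintro ⟨h1 | h1, h2 | h2⟩
      · exact absurd h1 h2.not_gt
      · exact .inl ⟨h1, h2⟩
      · exact .inr ⟨h1, h2⟩
      · exact absurd h1 h2.not_gt
  have h2 : SameParity (rk ![a, b, x, y]) 1 ↔ ¬ ((a < x ∧ x < b ∨ b < x ∧ x < a) ↔
      (a < y ∧ y < b ∨ b < y ∧ y < a)) := h1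
  rw [hb, hb] at h2
  have h3 : parInd ![a, b, x, y] 0 = if SameParity (rk ![a, b, x, y]) 1 then 1 else 0 := rfl
  rw [h3]
  simp only [h2, indicator_apply, Pi.one_apply]
  by_cases p : x ∈ Ioo (min a b) (max a b) <;> by_cases q : y ∈ Ioo (min a b) (max a b) <;>
    simp [p, q]

theorem ae_injective_vec4 {a b : ℝ} (hab : a ≠ b) :
    ∀ᵐ x ∂unifI, ∀ᵐ y ∂unifI, Function.Injective ![a, b, x, y] := by
  filter_upwards [ae_ne_unifI a, ae_ne_unifI b] with x h1 h2
  filter_upwards [ae_ne_unifI a, ae_ne_unifI b, ae_ne_unifI x] with y h3 h4 h5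
  exact injective_vec4 hab h1 h2 h3 h4 h5

theorem integral_congr_ae₂ {f g : ℝ → ℝ → ℝ} (h : ∀ᵐ x ∂unifI, ∀ᵐ y ∂unifI, f x y = g x y) :
    ∫ x, ∫ y, f x y ∂unifI ∂unifI = ∫ x, ∫ y, g x y ∂unifI ∂unifI :=
  integral_congr_ae (h.mono fun _ hx => integral_congr_ae hx)

theorem min_mem_Icc {a b : ℝ} (ha : a ∈ Icc (0 : ℝ) 1) (hb : b ∈ Icc (0 : ℝ) 1) :
    min a b ∈ Icc (0 : ℝ) 1 := ⟨le_min ha.1 hb.1, (min_le_left _ _).trans ha.2⟩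

theorem max_mem_Icc {a b : ℝ} (ha : a ∈ Icc (0 : ℝ) 1) (hb : b ∈ Icc (0 : ℝ) 1) :
    max a b ∈ Icc (0 : ℝ) 1 := ⟨ha.1.trans (le_max_left _ _), max_le ha.2 hb.2⟩

theorem halfMean_zero {a b : ℝ} (ha : a ∈ Icc (0 : ℝ) 1) (hb : b ∈ Icc (0 : ℝ) 1) (hab : a ≠ b) :
    halfMean a b 0 = min a b ^ 2 + (1 - max a b) ^ 2 := by
  have e : halfMean a b 0 = ∫ x, ∫ y,
      ((Iio (min a b)).indicator 1 x * (Iio (min a b)).indicator 1 y +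
      (Ioi (max a b)).indicator 1 x * (Ioi (max a b)).indicator 1 y) ∂unifI ∂unifI :=
    integral_congr_ae₂ ((ae_injective_vec4 hab).mono fun x hx => hx.mono fun y hy =>
      halfInd_zero_eq hy)
  have i1 := integrable_indicator_one (measurableSet_Iio (a := min a b))
  have i2 := integrable_indicator_one (measurableSet_Ioi (a := max a b))
  rw [e]
  have e2 : ∀ x, ∫ y, ((Iio (min a b)).indicator 1 x * (Iio (min a b)).indicator 1 y +
      (Ioi (max a b)).indicator 1 x * (Ioi (max a b)).indicator 1 y) ∂unifI =
      (Iio (min a b)).indicator 1 x * min a b + (Ioi (max a b)).indicator 1 x * (1 - max a b) :=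
    fun x => by
      rw [integral_add (i1.const_mul _) (i2.const_mul _), integral_const_mul, integral_const_mul,
        integral_indicator_Iio (min_mem_Icc ha hb), integral_indicator_Ioi (max_mem_Icc ha hb)]
  simp only [e2]
  rw [integral_add (i1.mul_const _) (i2.mul_const _), integral_mul_const, integral_mul_const,
    integral_indicator_Iio (min_mem_Icc ha hb), integral_indicator_Ioi (max_mem_Icc ha hb)]
  ring

theorem parMean_zero {a b : ℝ} (ha : a ∈ Icc (0 : ℝ) 1) (hb : b ∈ Icc (0 : ℝ) 1) (hab : a ≠ b) :
    parMean a b 0 = 2 * (max a b - min a b) * (1 - (max a b - min a b)) := by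
  set S := Ioo (min a b) (max a b) with hS
  have e : parMean a b 0 = ∫ x, ∫ y,
      (S.indicator 1 x * (1 - S.indicator 1 y) + (1 - S.indicator 1 x) * S.indicator 1 y)
      ∂unifI ∂unifI :=
    integral_congr_ae₂ ((ae_injective_vec4 hab).mono fun x hx => hx.mono fun y hy =>
      parInd_zero_eq hy)
  have i1 := integrable_indicator_one (measurableSet_Ioo (a := min a b) (b := max a b))
  rw [← hS] at i1
  have i0 : Integrable (fun _ : ℝ => (1 : ℝ)) unifI := integrable_const _
  have i2 : Integrable (fun y => 1 - S.indicator 1 y : ℝ → ℝ) unifI := i0.sub i1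
  have h0 : ∫ _, (1 : ℝ) ∂unifI = 1 := by simp
  have h1 : ∫ y, S.indicator 1 y ∂unifI = max a b - min a b :=
    integral_indicator_Ioo (min_mem_Icc ha hb) (max_mem_Icc ha hb) min_le_max
  rw [e]
  have e2 : ∀ x, ∫ y, (S.indicator 1 x * (1 - S.indicator 1 y) +
      (1 - S.indicator 1 x) * S.indicator 1 y) ∂unifI =
      S.indicator 1 x * (1 - (max a b - min a b)) + (1 - S.indicator 1 x) * (max a b - min a b) :=
    fun x => by
      rw [integral_add (i2.const_mul _) (i1.const_mul _), integral_const_mul,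
        integral_const_mul, integral_sub i0 i1, h1, h0]
  simp only [e2]
  rw [integral_add (i1.mul_const _) (i2.mul_const _), integral_mul_const,
    integral_mul_const, integral_sub i0 i1, h1, h0]
  ring

/-! ### Means for the other two pairings, by exchanging the random points -/

theorem rk_swap (a b x y : ℝ) : rk ![a, b, y, x] = rk ![a, b, x, y] ∘ Equiv.swap 2 3 := by
  funext i
  simp only [rk, Function.comp_apply]
  rw [← Finset.card_map (Equiv.swap (2 : Fin 4) 3).toEmbedding]
  congr 1
  have h : ∀ k, ![a, b, y, x] k = ![a, b, x, y] (Equiv.swap (2 : Fin 4) 3 k) := by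
    intro k
    fin_cases k
    · rw [show Equiv.swap (2 : Fin 4) 3 ((fun i => i) ⟨0, by omega⟩) = 0 by decide]; rfl
    · rw [show Equiv.swap (2 : Fin 4) 3 ((fun i => i) ⟨1, by omega⟩) = 1 by decide]; rfl
    · rw [show Equiv.swap (2 : Fin 4) 3 ((fun i => i) ⟨2, by omega⟩) = 3 by decide]; rfl
    · rw [show Equiv.swap (2 : Fin 4) 3 ((fun i => i) ⟨3, by omega⟩) = 2 by decide]; rfl
  ext k
  simp only [Finset.mem_map_equiv, Finset.mem_filter, Finset.mem_univ, true_and, h,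
    Equiv.swap_apply_self, Equiv.symm_swap]

theorem halfInd_swap (a b x y : ℝ) : halfInd ![a, b, y, x] 1 = halfInd ![a, b, x, y] 2 := by
  simp only [halfInd, rk_swap a b x y]
  rfl

theorem parInd_swap (a b x y : ℝ) : parInd ![a, b, y, x] 1 = parInd ![a, b, x, y] 2 := by
  simp only [parInd, rk_swap a b x y]
  rfl

theorem mean_swap {g : (Fin 4 → ℝ) → Fin 3 → ℝ} (hg : Measurable fun x => g x 1)
    (hg1 : ∀ x, |g x 1| ≤ 1) {a b : ℝ} (h : ∀ x y, g ![a, b, y, x] 1 = g ![a, b, x, y] 2) :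
    ∫ x, ∫ y, g ![a, b, x, y] 1 ∂unifI ∂unifI = ∫ x, ∫ y, g ![a, b, x, y] 2 ∂unifI ∂unifI := by
  simp only [← h]
  exact integral_integral_swap (integrable_of_measurable_of_abs_le
    (hg.comp (measurable_vec4 a b)) 1 fun p => hg1 _)

theorem mean_sum {g : (Fin 4 → ℝ) → Fin 3 → ℝ} (hg : ∀ j, Measurable fun x => g x j)
    (hg1 : ∀ x j, |g x j| ≤ 1) {a b : ℝ} (hab : a ≠ b)
    (h : ∀ x, Function.Injective x → ∑ j, g x j = 1) :
    ∑ j, ∫ x, ∫ y, g ![a, b, x, y] j ∂unifI ∂unifI = 1 := by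
  have hm : ∀ j, Measurable fun p : ℝ × ℝ => g ![a, b, p.1, p.2] j := fun j =>
    (hg j).comp (measurable_vec4 a b)
  have h1 : ∀ x j, Integrable (fun y => g ![a, b, x, y] j) unifI := fun x j =>
    integrable_of_measurable_of_abs_le ((hm j).comp measurable_prodMk_left) 1 fun y => hg1 _ _
  have h2 : ∀ j, Integrable (fun x => ∫ y, g ![a, b, x, y] j ∂unifI) unifI := fun j =>
    (integrable_of_measurable_of_abs_le (μ := unifI.prod unifI) (hm j) 1
      fun p => hg1 _ _).integral_prod_left
  rw [← integral_finsetSum _ fun j _ => h2 j]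
  have : ∀ x, ∑ j, ∫ y, g ![a, b, x, y] j ∂unifI = ∫ y, ∑ j, g ![a, b, x, y] j ∂unifI := fun x =>
    (integral_finsetSum _ fun j _ => h1 x j).symm
  simp only [this]
  rw [integral_congr_ae₂ (g := fun _ _ => 1) ((ae_injective_vec4 hab).mono fun x hx =>
    hx.mono fun y hy => h _ hy)]
  simp

theorem sum_halfInd {x : Fin 4 → ℝ} (hx : Function.Injective x) : ∑ j, halfInd x j = 1 := by
  obtain ⟨σ, hσ, -⟩ := exists_permRank_eq hx
  simp only [halfInd, hσ]
  exact_mod_cast sum_sameHalf σ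

theorem sum_parInd {x : Fin 4 → ℝ} (hx : Function.Injective x) : ∑ j, parInd x j = 1 := by
  obtain ⟨σ, hσ, -⟩ := exists_permRank_eq hx
  simp only [parInd, hσ]
  exact_mod_cast sum_sameParity σ

/-- Point 0 has exactly one partner, so the three means add up to 1; the last two agree because the
random points are exchangeable. -/
theorem halfMean_succ {a b : ℝ} (hab : a ≠ b) :
    halfMean a b 1 = (1 - halfMean a b 0) / 2 ∧ halfMean a b 2 = (1 - halfMean a b 0) / 2 := by
  have h1 : halfMean a b 1 = halfMean a b 2 :=
    mean_swap (measurable_halfInd 1) (fun x => abs_halfInd_le x 1) fun x y => halfInd_swap a b x y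
  have h2 : ∑ j, halfMean a b j = 1 :=
    mean_sum measurable_halfInd abs_halfInd_le hab fun x hx => sum_halfInd hx
  rw [Fin.sum_univ_three] at h2
  constructor <;> linarith

theorem parMean_succ {a b : ℝ} (hab : a ≠ b) :
    parMean a b 1 = (1 - parMean a b 0) / 2 ∧ parMean a b 2 = (1 - parMean a b 0) / 2 := by
  have h1 : parMean a b 1 = parMean a b 2 :=
    mean_swap (measurable_parInd 1) (fun x => abs_parInd_le x 1) fun x y => parInd_swap a b x y
  have h2 : ∑ j, parMean a b j = 1 :=
    mean_sum measurable_parInd abs_parInd_le hab fun x hx => sum_parInd hx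
  rw [Fin.sum_univ_three] at h2
  constructor <;> linarith

/-- The kernel of `6 K(DE)` as a rank one perturbation of a tensor product. -/
theorem kernelDE_eq {z w : ℝ × ℝ} (hz : z.1 ∈ Icc (0 : ℝ) 1 ∧ z.2 ∈ Icc (0 : ℝ) 1)
    (hw : w.1 ∈ Icc (0 : ℝ) 1 ∧ w.2 ∈ Icc (0 : ℝ) 1) (h1 : z.1 ≠ w.1) (h2 : z.2 ≠ w.2) :
    6 * kernelDE z w = kerI z.1 w.1 * kerI z.2 w.2
      - 36 * (cid z.1 * cid z.2 * (cid w.1 * cid w.2)) := by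
  -- For B = |u-v|² - |u-v| + 1/6 and C = (u - 1/2)(v - 1/2), the means of the pairing 0 are 1/3 + B
  -- + 2C (halves) and 1/3 - 2B (parity). A product of two such means with deviations h, p from 1/3,
  -- summed over the pairings, is 1/3 + (3/2) h p. The total is 36 (B B' + C B' + B C') = 36 ((B +
  -- C)(B' + C') - C C').
  rw [kernelDE_eq_means h1 h2, Fin.sum_univ_three, (halfMean_succ h1).1, (halfMean_succ h1).2,
    (parMean_succ h1).1, (parMean_succ h1).2, (halfMean_succ h2).1, (halfMean_succ h2).2,
    (parMean_succ h2).1, (parMean_succ h2).2, halfMean_zero hz.1 hw.1 h1, parMean_zero hz.1 hw.1 h1,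
    halfMean_zero hz.2 hw.2 h2, parMean_zero hz.2 hw.2 h2]
  simp only [kerI, cid_apply]
  rcases le_total z.1 w.1 with h | h <;> rcases le_total z.2 w.2 with h' | h' <;>
    simp only [h, h', min_eq_left, min_eq_right, max_eq_left, max_eq_right,
      abs_of_nonneg, abs_of_nonpos, sub_nonneg, sub_nonpos] <;> ring

/-! ### The operator on the unit square -/

/-- The coefficients of the expansion of the product kernel. -/
noncomputable def kCoef2 (p : KIdx × KIdx) : ℝ := kCoef p.1 * kCoef p.2

/-- The functions of the expansion of the product kernel. -/
noncomputable def kVec2 (p : KIdx × KIdx) : H2 := tens (kVec p.1) (kVec p.2)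

theorem summable_kCoef2 : Summable kCoef2 :=
  summable_mul_of_summable_norm summable_kCoef.norm summable_kCoef.norm

theorem kCoef2_pos (p : KIdx × KIdx) : 0 < kCoef2 p := mul_pos (kCoef_pos _) (kCoef_pos _)

theorem norm_kVec2_le (p : KIdx × KIdx) : ‖kVec2 p‖ ≤ √2 * √2 := by
  rw [kVec2, norm_tens]
  exact mul_le_mul (norm_kVec_le _) (norm_kVec_le _) (norm_nonneg _) (Real.sqrt_nonneg _)

/-- The tensor square of `opI`. -/
noncomputable def opSq : H2 →L[ℝ] H2 := symOp kCoef2 kVec2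

theorem isSymmetric_opSq (f g : H2) : ⟪opSq f, g⟫ = ⟪f, opSq g⟫ :=
  isSymmetric_symOp summable_kCoef2 norm_kVec2_le f g

/-- The double series over pairs of indices is summed iteratively: the inner sum produces `opI g`,
the outer one `opI f`. -/
theorem opSq_tens (f g : Lp ℝ 2 unifI) : opSq (tens f g) = tens (opI f) (opI g) := by
  have h := hasSum_symOp_apply summable_kCoef2 norm_kVec2_le (tens f g)
  have h1 : ∀ i, HasSum (fun j => (kCoef2 (i, j) * ⟪kVec2 (i, j), tens f g⟫) • kVec2 (i, j))
      (tens ((kCoef i * ⟪kVec i, f⟫) • kVec i) (opI g)) := fun i => by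
    have h2 := (hasSum_opI g).mapL (tens ((kCoef i * ⟪kVec i, f⟫) • kVec i))
    have e : (fun j => (kCoef2 (i, j) * ⟪kVec2 (i, j), tens f g⟫) • kVec2 (i, j)) =
        fun j => tens ((kCoef i * ⟪kVec i, f⟫) • kVec i) ((kCoef j * ⟪kVec j, g⟫) • kVec j) := by
      funext j
      rw [kVec2, inner_tens, map_smul, map_smul, smul_apply, smul_smul, kCoef2]
      congr 1
      ring
    rw [e]
    exact h2
  have h3 := (hasSum_opI f).mapL (tens.flip (opI g))
  exact (h.prod_fiberwise h1).unique h3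

/-- The function `(u, v) ↦ (u - 1/2) (v - 1/2)`. -/
noncomputable def cidSq : H2 := tens (vecI cid) (vecI cid)

theorem tensor_ae (f g : C(ℝ, ℝ)) : tensor f g =ᵐ[unifSq] fun p => f p.1 * g p.2 :=
  MemLp.coeFn_toLp _

theorem kVec2_ae (p : KIdx × KIdx) :
    kVec2 p =ᵐ[unifSq] fun z => kFun p.1 z.1 * kFun p.2 z.2 := by
  rw [kVec2, kVec, kVec, tens_vecI]
  exact tensor_ae _ _

/-- The operator `6 K(DE)`. -/
noncomputable def opDE : H2 →L[ℝ] H2 := (6 : ℝ) • KDE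

/-- Adding the rank one term back to `6 K(DE)` gives the operator with the product kernel, whose
expansion is the product of the two one-dimensional ones. The kernel identity fails only on ties,
which are negligible. -/
theorem opDE_apply (f : H2) : opDE f = opSq f - (36 * ⟪cidSq, f⟫) • cidSq := by
  rw [eq_sub_iff_add_eq]
  symm
  have hb : ∀ᵐ z ∂unifSq, ∀ p : KIdx × KIdx, |kFun p.1 z.1 * kFun p.2 z.2| ≤ √2 * √2 := by
    filter_upwards [ae_mem_unifSq] with z hz p
    rw [abs_mul]
    exact mul_le_mul (abs_kFun_le hz.1 _) (abs_kFun_le hz.2 _) (abs_nonneg _) (Real.sqrt_nonneg _)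
  have hcid : cidSq =ᵐ[unifSq] fun z => cid z.1 * cid z.2 := kVec2_ae (.inr (), .inr ())
  refine symOp_apply_eq_of_kernel (k := fun z w => kerI z.1 w.1 * kerI z.2 w.2)
    summable_kCoef2 kVec2_ae hb (by positivity) ?_ ?_
  · filter_upwards [ae_mem_unifSq] with z hz
    filter_upwards [ae_mem_unifSq] with w hw
    have h1 := hasSum_kerI hz.1 hw.1
    have h2 := hasSum_kerI hz.2 hw.2
    have h3 := h1.mul h2 (summable_mul_of_summable_norm h1.summable.norm h2.summable.norm)
    have e : (fun p : KIdx × KIdx => kCoef2 p * (kFun p.1 z.1 * kFun p.2 z.2) *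
        (kFun p.1 w.1 * kFun p.2 w.2)) = fun p => (kCoef p.1 * kFun p.1 z.1 * kFun p.1 w.1) *
          (kCoef p.2 * kFun p.2 z.2 * kFun p.2 w.2) := by
      funext p; rw [kCoef2]; ring
    rw [e]
    exact h3
  · have hI : Integrable (fun w : ℝ × ℝ => cid w.1 * cid w.2 * f w) unifSq :=
      (integrable_mul_of_ae_abs_le kVec2_ae hb f (.inr (), .inr ())).1
    have hin : ⟪cidSq, f⟫ = ∫ w, cid w.1 * cid w.2 * f w ∂unifSq :=
      inner_eq_integral_mul hcid (ae_eq_refl _)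
    filter_upwards [ae_mem_unifSq, hcid, Lp.coeFn_add (opDE f) ((36 * ⟪cidSq, f⟫) • cidSq),
      Lp.coeFn_smul (6 : ℝ) (KDE f), Lp.coeFn_smul (36 * ⟪cidSq, f⟫) cidSq,
      integralOp_apply_ae kernelDE measurable_kernelDE 32 abs_kernelDE_le f]
      with z hz h1 h2 h3 h4 h5
    have h6 : opDE f z = 6 * ∫ w, kernelDE z w * f w ∂unifSq := by
      refine h3.trans ?_
      rw [Pi.smul_apply, smul_eq_mul]
      exact congrArg _ h5
    rw [h2, Pi.add_apply, h4, Pi.smul_apply, h1, h6, smul_eq_mul, hin, ← integral_const_mul,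
      mul_comm (36 * _), ← mul_assoc, ← integral_const_mul, ← integral_add
        ((integrable_kernel_mul measurable_kernelDE abs_kernelDE_le f z).const_mul _)
        (hI.const_mul _)]
    refine integral_congr_ae ?_
    filter_upwards [ae_mem_unifSq, ae_ne_unifSq z.1 z.2] with w hw hne
    have h7 := kernelDE_eq hz hw hne.1.symm hne.2.symm
    show 6 * (kernelDE z w * f w) + _ * (cid w.1 * cid w.2 * f w) = _
    rw [← mul_assoc, h7]
    ring

theorem isSymmetric_opDE (f g : H2) : ⟪opDE f, g⟫ = ⟪f, opDE g⟫ := by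
  rw [opDE_apply, opDE_apply, inner_sub_left, inner_sub_right, isSymmetric_opSq,
    real_inner_smul_left, real_inner_smul_right, real_inner_comm cidSq f]
  ring

theorem isCompactOperator_opDE : IsCompactOperator opDE := by
  have e : opDE = opSq - (36 : ℝ) • InnerProductSpace.rankOne ℝ cidSq cidSq := by
    ext1 f
    rw [opDE_apply, sub_apply, smul_apply,
      InnerProductSpace.rankOne_apply, smul_smul]
  rw [e]
  exact (isCompactOperator_symOp summable_kCoef2 norm_kVec2_le).sub
    ((isCompactOperator_rankOne cidSq cidSq).smul (36 : ℝ))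

/-- The subtracted form 36 ⟨c ⊗ c, f⟩² is exactly one of the non-negative terms in the expansion of
the form of `opSq`, so the rest remains non-negative. -/
theorem inner_opDE_nonneg (f : H2) : 0 ≤ ⟪f, opDE f⟫ := by
  have h := hasSum_inner_symOp summable_kCoef2 norm_kVec2_le f f
  have h1 := le_hasSum h (.inr (), .inr ()) fun p _ => by
    rw [mul_assoc]; exact mul_nonneg (kCoef2_pos p).le (mul_self_nonneg _)
  have h2 : (6 * 6 : ℝ) * ⟪cidSq, f⟫ * ⟪cidSq, f⟫ ≤ ⟪f, opSq f⟫ := h1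
  rw [opDE_apply, inner_sub_right, real_inner_smul_right, real_inner_comm cidSq f]
  linarith

/-! ### The eigenfunctions of the tensor square -/

/-- The eigenfunctions of `opSq`. -/
noncomputable def eSq (p : (ℕ ⊕ ℕ) × (ℕ ⊕ ℕ)) : H2 := tens (eI p.1) (eI p.2)

/-- The eigenvalues of `opSq`. -/
noncomputable def evSq (p : (ℕ ⊕ ℕ) × (ℕ ⊕ ℕ)) : ℝ := evI p.1 * evI p.2

theorem opSq_eSq (p : (ℕ ⊕ ℕ) × (ℕ ⊕ ℕ)) : opSq (eSq p) = evSq p • eSq p := by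
  rw [eSq, opSq_tens, opI_eI, opI_eI, map_smul, map_smul, smul_apply,
    smul_smul, evSq, mul_comm]

theorem orthonormal_eSq : Orthonormal ℝ eSq := by
  classical
  rw [orthonormal_iff_ite]
  rintro ⟨i, j⟩ ⟨k, l⟩
  rw [eSq, eSq, inner_tens, orthonormal_iff_ite.1 orthonormal_eI,
    orthonormal_iff_ite.1 orthonormal_eI, ite_zero_mul_ite_zero, mul_one]
  simp only [Prod.mk.injEq]

theorem inner_kVec2_eq_zero {h : H2} (hh : ∀ p, ⟪eSq p, h⟫ = 0) (p : KIdx × KIdx) :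
    ⟪kVec2 p, h⟫ = 0 := by
  have h1 : ∀ i j, ⟪h, tens (kVec i) (eI j)⟫ = 0 := fun i j => by
    have h2 := ((hasSum_kVec i).mapL (tens.flip (eI j))).mapL (innerSL ℝ h)
    refine HasSum.unique h2 ?_
    convert hasSum_zero using 2 with k
    have h3 : ⟪tens (eI k) (eI j), h⟫ = 0 := hh (k, j)
    rw [map_smul, map_smul, ContinuousLinearMap.flip_apply, innerSL_apply_apply,
      real_inner_comm (tens (eI k) (eI j)) h, h3, smul_zero]
  have h2 := ((hasSum_kVec p.2).mapL (tens (kVec p.1))).mapL (innerSL ℝ h)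
  rw [real_inner_comm]
  refine HasSum.unique h2 ?_
  convert hasSum_zero using 2 with k
  rw [map_smul, map_smul, innerSL_apply_apply, h1, smul_zero]

theorem opDE_eq_zero_of_orthogonal {h : H2} (hh : ∀ p, ⟪eSq p, h⟫ = 0) : opDE h = 0 := by
  have h1 : opSq h = 0 := by
    refine (hasSum_symOp_apply summable_kCoef2 norm_kVec2_le h).unique ?_
    convert hasSum_zero using 2 with p
    rw [inner_kVec2_eq_zero hh, mul_zero, zero_smul]
  have h2 : ⟪cidSq, h⟫ = 0 := inner_kVec2_eq_zero hh (.inr (), .inr ())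
  rw [opDE_apply, h1, h2, mul_zero, zero_smul, sub_zero]

/-- The function `χ_ℓ ⊗ χ_m`. -/
noncomputable def chiSq (p : ℕ × ℕ) : H2 := tensor (chi p.1) (chi p.2)

/-- The product `μ_ℓ μ_m`. -/
noncomputable def muSq (p : ℕ × ℕ) : ℝ := mu p.1 * mu p.2

/-- The product `b_ℓ b_m`. -/
noncomputable def bSq (p : ℕ × ℕ) : ℝ := bcoef p.1 * bcoef p.2

theorem chiSq_eq (p : ℕ × ℕ) : chiSq p = eSq (.inr p.1, .inr p.2) := (tens_vecI _ _).symm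

theorem bSq_ne_zero (p : ℕ × ℕ) : bSq p ≠ 0 := mul_ne_zero (bcoef_ne_zero _) (bcoef_ne_zero _)

theorem muSq_pos (p : ℕ × ℕ) : 0 < muSq p := mul_pos (mu_pos _) (mu_pos _)

theorem orthonormal_chiSq : Orthonormal ℝ chiSq := by
  have : chiSq = eSq ∘ fun p : ℕ × ℕ => (.inr p.1, .inr p.2) := funext chiSq_eq
  rw [this]
  refine orthonormal_eSq.comp _ fun p q h => ?_
  simpa [Prod.ext_iff] using h

theorem opSq_chiSq (p : ℕ × ℕ) : opSq (chiSq p) = muSq p • chiSq p := by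
  rw [chiSq_eq, opSq_eSq]; rfl

theorem inner_cidSq_chiSq (p : ℕ × ℕ) : ⟪cidSq, chiSq p⟫ = bSq p := by
  rw [chiSq_eq, eSq, cidSq, inner_tens, bSq, bcoef_eq, bcoef_eq]; rfl

theorem inner_cidSq_inl_left (j : ℕ) (k : ℕ ⊕ ℕ) : ⟪cidSq, eSq (.inl j, k)⟫ = 0 := by
  rw [eSq, cidSq, inner_tens]
  exact mul_eq_zero_of_left (inner_cid_phi j) _

theorem inner_cidSq_inl_right (j : ℕ ⊕ ℕ) (k : ℕ) : ⟪cidSq, eSq (j, .inl k)⟫ = 0 := by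
  rw [eSq, cidSq, inner_tens]
  exact mul_eq_zero_of_right _ (inner_cid_phi k)

theorem opDE_inl_left (j : ℕ) (k : ℕ ⊕ ℕ) :
    opDE (eSq (.inl j, k)) = evSq (.inl j, k) • eSq (.inl j, k) := by
  rw [opDE_apply, inner_cidSq_inl_left, mul_zero, zero_smul, sub_zero, opSq_eSq]

theorem opDE_inl_right (j : ℕ ⊕ ℕ) (k : ℕ) :
    opDE (eSq (j, .inl k)) = evSq (j, .inl k) • eSq (j, .inl k) := by
  rw [opDE_apply, inner_cidSq_inl_right, mul_zero, zero_smul, sub_zero, opSq_eSq]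

/-- `cidSq` lies in the closed span of the `eSq`, and its coefficients on products with some φ_j are
zero. -/
theorem hasSum_cidSq : HasSum (fun p => bSq p • chiSq p) cidSq := by
  have h := hasSum_inner_smul_of_forall_orthogonal orthonormal_eSq (f := cidSq) fun h hh => by
    rw [real_inner_comm]; exact inner_kVec2_eq_zero hh (.inr (), .inr ())
  have h2 := hasSum_inner_smul_of_forall_orthogonal orthonormal_chiSq (f := cidSq)
    fun g hg => by
      refine (h.mapL (innerSL ℝ g)).unique ?_
      convert hasSum_zero using 2 with p
      rw [map_smul, innerSL_apply_apply, real_inner_comm cidSq]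
      rcases p with ⟨j | j, k | k⟩
      · rw [inner_cidSq_inl_left, zero_smul]
      · rw [inner_cidSq_inl_left, zero_smul]
      · rw [inner_cidSq_inl_right, zero_smul]
      · have h3 := hg (j, k)
        rw [chiSq_eq] at h3
        rw [real_inner_comm (eSq _) g, h3, smul_zero]
  convert h2 using 3 with p
  rw [real_inner_comm, inner_cidSq_chiSq]

theorem summable_bSq_sq : Summable fun p => bSq p ^ 2 := by
  have := summable_sq_inner_of_orthonormal orthonormal_chiSq cidSq
  refine this.congr fun p => ?_
  rw [real_inner_comm, inner_cidSq_chiSq]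

/-- The coefficients of an eigenfunction of `6 K(DE)`. -/
theorem sub_mul_inner_chiSq {f : H2} {l : ℝ} (hf : opDE f = l • f) (p : ℕ × ℕ) :
    (muSq p - l) * ⟪chiSq p, f⟫ = 36 * ⟪cidSq, f⟫ * bSq p := by
  have h1 : ⟪chiSq p, opDE f⟫ = l * ⟪chiSq p, f⟫ := by rw [hf, real_inner_smul_right]
  rw [opDE_apply, inner_sub_right, ← isSymmetric_opSq, opSq_chiSq, real_inner_smul_left,
    real_inner_smul_right, real_inner_comm cidSq, inner_cidSq_chiSq] at h1
  linarith

theorem inner_eq_zero_of_opDE_eq_smul {f h : H2} {l : ℝ} (hl : l ≠ 0) (hf : opDE f = l • f)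
    (hh : ∀ p, ⟪eSq p, h⟫ = 0) : ⟪h, f⟫ = 0 := by
  have h1 := isSymmetric_opDE h f
  rw [opDE_eq_zero_of_orthogonal hh, inner_zero_left, hf, real_inner_smul_right] at h1
  exact (mul_eq_zero.1 h1.symm).resolve_left hl

/-! ### The poles of the secular function -/

/-- The products are summable, hence tend to 0. This gives both the discreteness of the poles and
the finiteness of each `Nset`. -/
theorem finite_le_muSq {l : ℝ} (hl : 0 < l) : {p | l ≤ muSq p}.Finite := by
  have h : Summable muSq := summable_mul_of_summable_norm summable_mu.norm summable_mu.norm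
  have h2 := h.tendsto_cofinite_zero.eventually_lt_const hl
  rw [Filter.eventually_cofinite] at h2
  simpa only [not_lt] using h2

theorem mem_poles_iff {z : ℝ} : z ∈ poles ↔ ∃ p, z = 1 / muSq p := by
  constructor
  · rintro ⟨_, ⟨j, k, rfl⟩, rfl⟩
    exact ⟨(j, k), rfl⟩
  · rintro ⟨p, rfl⟩
    exact ⟨_, ⟨p.1, p.2, rfl⟩, rfl⟩

theorem strictMono_range_zStar : StrictMono zStar ∧ range zStar = poles := by
  refine nthSmallest_strictMono_range ?_ fun x => ?_
  · refine (infinite_range_of_injective (f := fun j => 1 / muSq (j, 0)) fun j k h => ?_).mono ?_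
    · have h1 : muSq (j, 0) = muSq (k, 0) := by simpa using h
      exact mu_injective (mul_right_cancel₀ (mu_pos 0).ne' h1)
    · rintro _ ⟨j, rfl⟩
      exact mem_poles_iff.2 ⟨_, rfl⟩
  · rcases le_or_gt x 0 with hx | hx
    · refine finite_empty.subset ?_
      rintro y ⟨hy, hyx⟩
      obtain ⟨p, rfl⟩ := mem_poles_iff.1 hy
      exact absurd (one_div_pos.2 (muSq_pos p)) (not_lt.2 (le_trans hyx hx))
    · refine ((finite_le_muSq (one_div_pos.2 hx)).image fun p => 1 / muSq p).subset ?_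
      rintro y ⟨hy, hyx⟩
      obtain ⟨p, rfl⟩ := mem_poles_iff.1 hy
      exact ⟨p, (one_div_le (muSq_pos p) hx).1 hyx, rfl⟩

theorem exists_zStar_eq (i : ℕ) : ∃ p, zStar i = 1 / muSq p :=
  mem_poles_iff.1 (strictMono_range_zStar.2 ▸ mem_range_self i)

theorem zStar_pos (i : ℕ) : 0 < zStar i := by
  obtain ⟨p, hp⟩ := exists_zStar_eq i
  rw [hp]
  exact one_div_pos.2 (muSq_pos p)

theorem exists_one_div_muSq_eq (p : ℕ × ℕ) : ∃ k, zStar k = 1 / muSq p := by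
  have : 1 / muSq p ∈ range zStar := strictMono_range_zStar.2 ▸ mem_poles_iff.2 ⟨p, rfl⟩
  exact this

theorem exists_lt_zStar (x : ℝ) : ∃ n, x < zStar n := by
  by_contra h
  push Not at h
  obtain ⟨j, hj⟩ : ∃ j, mu j * mu 0 < 1 / (|x| + 1) := by
    have h1 : Filter.Tendsto (fun j => mu j * mu 0) Filter.atTop (nhds (0 * mu 0)) :=
      summable_mu.tendsto_atTop_zero.mul_const _
    rw [zero_mul] at h1
    exact (h1.eventually_lt_const (by positivity)).exists
  obtain ⟨k, hk⟩ := exists_one_div_muSq_eq (j, 0)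
  have h2 := h k
  rw [hk] at h2
  have h3 : |x| + 1 < 1 / muSq (j, 0) :=
    (lt_one_div (by positivity) (muSq_pos _)).2 hj
  linarith [le_abs_self x]

theorem not_mem_poles_of_mem_Ioo {i : ℕ} {z : ℝ} (hz : z ∈ Ioo (zStar i) (zStar (i + 1))) :
    z ∉ poles := by
  rw [← strictMono_range_zStar.2]
  rintro ⟨k, rfl⟩
  have h1 := strictMono_range_zStar.1.lt_iff_lt.1 hz.1
  have h2 := strictMono_range_zStar.1.lt_iff_lt.1 hz.2
  omega

/-- Between two consecutive poles, `1 - μ_ℓ μ_m z` is bounded away from zero with constant sign. -/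
theorem one_sub_muSq_mul_bounds {i : ℕ} {α : ℝ} (hα : zStar i < α) (β : ℝ)
    (p : ℕ × ℕ) : (∀ z, α ≤ z → 1 - muSq p * z ≤ -(α / zStar i - 1)) ∨
      ∀ z, 0 < z → z ≤ β → 1 - β / zStar (i + 1) ≤ 1 - muSq p * z := by
  obtain ⟨k, hk⟩ := exists_one_div_muSq_eq p
  have hm : muSq p = 1 / zStar k := by rw [hk, one_div_one_div]
  rcases Nat.lt_or_ge i k with h | h
  · right
    intro z hz0 hz
    have h1 : zStar (i + 1) ≤ zStar k := strictMono_range_zStar.1.monotone h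
    have h2 := zStar_pos (i + 1)
    rw [hm, one_div_mul_eq_div]
    have : z / zStar k ≤ β / zStar (i + 1) := by gcongr; linarith
    linarith
  · left
    intro z hz
    have h1 : zStar k ≤ zStar i := strictMono_range_zStar.1.monotone h
    have h2 := zStar_pos k
    have h3 := zStar_pos i
    rw [hm, one_div_mul_eq_div]
    have : α / zStar i ≤ z / zStar k := by gcongr; linarith
    linarith

theorem exists_le_abs_one_sub {i : ℕ} {α β : ℝ} (hα : zStar i < α) (hβ : β < zStar (i + 1)) :
    ∃ δ > 0, ∀ p, ∀ z ∈ Icc α β, δ ≤ |1 - muSq p * z| := by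
  have h1 : 0 < α / zStar i - 1 := by
    rw [sub_pos, lt_div_iff₀ (zStar_pos i)]; linarith
  have h2 : 0 < 1 - β / zStar (i + 1) := by
    rw [sub_pos, div_lt_one (zStar_pos (i + 1))]; exact hβ
  refine ⟨min _ _, lt_min h1 h2, fun p z hz => ?_⟩
  rcases one_sub_muSq_mul_bounds hα β p with h | h
  · have := h z hz.1
    refine (min_le_left _ _).trans ?_
    rw [abs_of_nonpos (by linarith)]
    linarith
  · have := h z ((zStar_pos i).trans (hα.trans_le hz.1)) hz.2
    refine (min_le_right _ _).trans ?_
    rw [abs_of_nonneg (by linarith)]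
    linarith

/-! ### The zeros of the secular function -/

/-- The terms of the secular function. -/
noncomputable def secTerm (z : ℝ) (p : ℕ × ℕ) : ℝ := bSq p ^ 2 * (z / (1 - muSq p * z))

theorem omegaDE_eq (z : ℝ) : omegaDE z = 1 + 36 * ∑' p, secTerm z p := by
  rw [omegaDE, mul_assoc, ← tsum_mul_left]
  congr 2
  refine tsum_congr fun p => ?_
  rw [secTerm, bSq, muSq]
  ring

theorem abs_secTerm_le {δ β z : ℝ} (hδ : 0 < δ) {p : ℕ × ℕ} (h : δ ≤ |1 - muSq p * z|)
    (hz0 : 0 < z) (hz : z ≤ β) : ‖secTerm z p‖ ≤ bSq p ^ 2 * (β / δ) := by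
  rw [Real.norm_eq_abs, secTerm, abs_mul, abs_div, abs_of_pos hz0, abs_of_nonneg (sq_nonneg _)]
  have : 0 ≤ β := hz0.le.trans hz
  gcongr

theorem summable_secTerm {i : ℕ} {z : ℝ} (hz : z ∈ Ioo (zStar i) (zStar (i + 1))) :
    Summable (secTerm z) := by
  obtain ⟨δ, hδ, h⟩ := exists_le_abs_one_sub hz.1 hz.2
  exact Summable.of_norm_bounded (summable_bSq_sq.mul_right _) fun p =>
    abs_secTerm_le hδ (h p z ⟨le_rfl, le_rfl⟩) ((zStar_pos i).trans hz.1) le_rfl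

/-- With m = `muSq p`, the map z ↦ z/(1 - mz) has derivative 1/(1 - mz)² and is increasing on every
interval free of its pole; the weight is positive because no b vanishes. -/
theorem secTerm_lt {i : ℕ} {z z' : ℝ} (hz : zStar i < z) (hzz : z < z') (hz' : z' < zStar (i + 1))
    (p : ℕ × ℕ) : secTerm z p < secTerm z' p := by
  have hb : 0 < bSq p ^ 2 := by have := bSq_ne_zero p; positivity
  refine mul_lt_mul_of_pos_left ?_ hb
  have h0 := (zStar_pos i).trans hz
  have hpos : 0 < (1 - muSq p * z) * (1 - muSq p * z') := by
    have h1 : 0 < z / zStar i - 1 := by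
      rw [sub_pos, lt_div_iff₀ (zStar_pos i)]; linarith
    have h2 : 0 < 1 - z' / zStar (i + 1) := by
      rw [sub_pos, div_lt_one (zStar_pos (i + 1))]; exact hz'
    rcases one_sub_muSq_mul_bounds hz z' p with h | h
    · exact mul_pos_of_neg_of_neg (by linarith [h z le_rfl]) (by linarith [h z' hzz.le])
    · exact mul_pos (by linarith [h z h0 hzz.le]) (by linarith [h z' (h0.trans hzz) le_rfl])
  have hne := mul_ne_zero_iff.1 hpos.ne'
  have : z' / (1 - muSq p * z') - z / (1 - muSq p * z) =
      (z' - z) / ((1 - muSq p * z) * (1 - muSq p * z')) := by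
    have h1 := hne.1
    have h2 := hne.2
    rw [div_sub_div _ _ h2 h1]
    congr 1 <;> ring
  have h3 : 0 < (z' - z) / ((1 - muSq p * z) * (1 - muSq p * z')) :=
    div_pos (by linarith) hpos
  linarith

/-- All terms increase, so the increment of the full series dominates that of any single term. This
transfers the blow-up of one term at its pole to `omegaDE` without estimating the others. -/
theorem secTerm_sub_le {i : ℕ} {z z' : ℝ} (hz : zStar i < z) (hzz : z < z')
    (hz' : z' < zStar (i + 1)) (p : ℕ × ℕ) :
    36 * (secTerm z' p - secTerm z p) ≤ omegaDE z' - omegaDE z := by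
  have h1 := summable_secTerm ⟨hz, hzz.trans hz'⟩
  have h2 := summable_secTerm ⟨hz.trans hzz, hz'⟩
  have h3 := le_hasSum (h2.sub h1).hasSum p fun q _ => (sub_pos.2 (secTerm_lt hz hzz hz' q)).le
  rw [h2.tsum_sub h1] at h3
  rw [omegaDE_eq, omegaDE_eq]
  linarith

theorem omegaDE_lt {i : ℕ} {z z' : ℝ} (hz : zStar i < z) (hzz : z < z')
    (hz' : z' < zStar (i + 1)) : omegaDE z < omegaDE z' := by
  have h1 := secTerm_sub_le hz hzz hz' (0, 0)
  have h2 := secTerm_lt hz hzz hz' (0, 0)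
  linarith

theorem continuousOn_omegaDE {i : ℕ} {α β : ℝ} (hα : zStar i < α) (hβ : β < zStar (i + 1)) :
    ContinuousOn omegaDE (Icc α β) := by
  obtain ⟨δ, hδ, h⟩ := exists_le_abs_one_sub hα hβ
  have : omegaDE = fun z => 1 + 36 * ∑' p, secTerm z p := funext omegaDE_eq
  rw [this]
  refine continuousOn_const.add (continuousOn_const.mul ?_)
  refine continuousOn_tsum (u := fun p => bSq p ^ 2 * (β / δ)) (fun p => ?_)
    (summable_bSq_sq.mul_right _) fun p z hz =>
      abs_secTerm_le hδ (h p z hz) ((zStar_pos i).trans (hα.trans_le hz.1)) hz.2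
  refine continuousOn_const.mul (continuousOn_id.div (by fun_prop) fun z hz h0 => ?_)
  have h1 := h p z hz
  rw [h0, abs_zero] at h1
  linarith

theorem exists_omegaDE_eq_zero (i : ℕ) :
    ∃ z ∈ Ioo (zStar i) (zStar (i + 1)), omegaDE z = 0 := by
  have hlt : zStar i < zStar (i + 1) := strictMono_range_zStar.1 (Nat.lt_succ_self i)
  obtain ⟨m, hm1, hm2⟩ := exists_between hlt
  have hz0 := zStar_pos i
  have hz1 := zStar_pos (i + 1)
  have htend : ∀ C : ℝ, 0 < C →
      Filter.Tendsto (fun ε : ℝ => C * ε⁻¹) (nhdsWithin 0 (Ioi 0)) Filter.atTop := fun C hC =>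
    tendsto_inv_nhdsGT_zero.const_mul_atTop hC
  -- At α = (1 + ε) `zStar i` a term with its pole at `zStar i` behaves like a negative multiple of
  -- 1/ε. As the increment from α to the midpoint m bounds that of this term, a small ε makes
  -- `omegaDE α` negative.
  obtain ⟨α, hα1, hα2, hα⟩ : ∃ α, zStar i < α ∧ α < m ∧ omegaDE α < 0 := by
    obtain ⟨p, hp⟩ := exists_zStar_eq i
    have hmu : muSq p = 1 / zStar i := by rw [hp, one_div_one_div]
    have hb : 0 < bSq p ^ 2 := by have := bSq_ne_zero p; positivity
    have hε0 : 0 < m / zStar i - 1 := by rw [sub_pos, lt_div_iff₀ hz0]; linarith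
    obtain ⟨ε, ⟨hε, hεm⟩, hbig⟩ := ((Filter.eventually_of_mem (Ioo_mem_nhdsGT hε0)
      fun _ h => h).and ((htend _ (mul_pos hb hz0)).eventually_gt_atTop
        (omegaDE m / 36 - secTerm m p))).exists
    have h1 : zStar i < zStar i * (1 + ε) := by nlinarith
    have h2 : zStar i * (1 + ε) < m := by
      have := (lt_div_iff₀ hz0).1 (lt_sub_iff_add_lt.1 hεm)
      linarith
    refine ⟨zStar i * (1 + ε), h1, h2, ?_⟩
    have h3 := secTerm_sub_le h1 h2 hm2 p
    have h4 : secTerm (zStar i * (1 + ε)) p = -(bSq p ^ 2 * zStar i * ε⁻¹) - bSq p ^ 2 * zStar i := by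
      rw [secTerm, hmu, show 1 - 1 / zStar i * (zStar i * (1 + ε)) = -ε by field_simp; ring]
      field_simp
      ring
    have h5 : 0 < bSq p ^ 2 * zStar i := mul_pos hb hz0
    linarith
  -- The mirror image at the right pole, with β = (1 - ε) `zStar (i + 1)` and a term growing like
  -- 1/ε.
  obtain ⟨β, hβ1, hβ2, hβ⟩ : ∃ β, m < β ∧ β < zStar (i + 1) ∧ 0 < omegaDE β := by
    obtain ⟨p, hp⟩ := exists_zStar_eq (i + 1)
    have hmu : muSq p = 1 / zStar (i + 1) := by rw [hp, one_div_one_div]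
    have hb : 0 < bSq p ^ 2 := by have := bSq_ne_zero p; positivity
    have hε0 : 0 < 1 - m / zStar (i + 1) := by rw [sub_pos, div_lt_one hz1]; exact hm2
    obtain ⟨ε, ⟨hε, hεm⟩, hbig⟩ := ((Filter.eventually_of_mem (Ioo_mem_nhdsGT hε0)
      fun _ h => h).and ((htend _ (mul_pos hb hz1)).eventually_gt_atTop
        (secTerm m p - omegaDE m / 36 + bSq p ^ 2 * zStar (i + 1)))).exists
    have h1 : zStar (i + 1) * (1 - ε) < zStar (i + 1) := by nlinarith
    have h2 : m < zStar (i + 1) * (1 - ε) := by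
      have := (div_lt_iff₀ hz1).1 (lt_sub_comm.1 hεm)
      linarith
    refine ⟨zStar (i + 1) * (1 - ε), h2, h1, ?_⟩
    have h3 := secTerm_sub_le hm1 h2 h1 p
    have h4 : secTerm (zStar (i + 1) * (1 - ε)) p =
        bSq p ^ 2 * zStar (i + 1) * ε⁻¹ - bSq p ^ 2 * zStar (i + 1) := by
      rw [secTerm, hmu, show 1 - 1 / zStar (i + 1) * (zStar (i + 1) * (1 - ε)) = ε by
        field_simp; ring]
      field_simp
    linarith
  obtain ⟨z, hz, h0⟩ := intermediate_value_Icc (hα2.trans hβ1).le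
    (continuousOn_omegaDE hα1 hβ2) ⟨hα.le, hβ.le⟩
  exact ⟨z, ⟨hα1.trans_le hz.1, hz.2.trans_lt hβ2⟩, h0⟩

theorem omegaDE_pos_of_lt {z : ℝ} (hz : 0 < z) (hz' : z < zStar 0) : 0 < omegaDE z := by
  rw [omegaDE_eq]
  have : 0 ≤ ∑' p, secTerm z p := tsum_nonneg fun p => by
    obtain ⟨k, hk⟩ := exists_one_div_muSq_eq p
    have h1 : zStar 0 ≤ zStar k := strictMono_range_zStar.1.monotone (Nat.zero_le k)
    have h2 : muSq p * z < 1 := by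
      rw [← lt_div_iff₀' (muSq_pos p), ← hk]
      linarith
    exact mul_nonneg (sq_nonneg _) (div_nonneg hz.le (by linarith))
  linarith

theorem exists_mem_Ioo_of_not_mem_poles {z : ℝ} (hz : zStar 0 ≤ z) (hp : z ∉ poles) :
    ∃ i, z ∈ Ioo (zStar i) (zStar (i + 1)) := by
  have hne : ∀ k, z ≠ zStar k := fun k h => hp (strictMono_range_zStar.2 ▸ ⟨k, h.symm⟩)
  classical
  have hex := exists_lt_zStar z
  obtain ⟨n, hn⟩ : ∃ n, Nat.find hex = n + 1 := Nat.exists_eq_succ_of_ne_zero fun h => by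
    have := Nat.find_spec hex
    rw [h] at this
    linarith
  refine ⟨n, ?_, hn ▸ Nat.find_spec hex⟩
  have := Nat.find_min hex (m := n) (by omega)
  exact lt_of_le_of_ne (not_lt.1 this) (hne n).symm

/-- Each gap between poles contains a zero by the intermediate value theorem and only one by strict
monotonicity; below the first pole `omegaDE` is positive. -/
theorem zHat_spec : StrictMono zHat ∧ range zHat = omegaDEZeros ∧
    ∀ i, zHat i ∈ Ioo (zStar i) (zStar (i + 1)) := by
  choose a ha ha0 using exists_omegaDE_eq_zero
  have hmono : StrictMono a := strictMono_nat_of_lt_succ fun n => (ha n).2.trans (ha (n + 1)).1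
  have hrange : range a = omegaDEZeros := by
    ext z
    constructor
    · rintro ⟨n, rfl⟩
      exact ⟨(zStar_pos n).trans (ha n).1, not_mem_poles_of_mem_Ioo (ha n), ha0 n⟩
    · rintro ⟨hz, hp, h0⟩
      have h1 : zStar 0 ≤ z := by
        by_contra h
        exact (omegaDE_pos_of_lt hz (not_le.1 h)).ne' h0
      obtain ⟨i, hi⟩ := exists_mem_Ioo_of_not_mem_poles h1 hp
      refine ⟨i, ?_⟩
      rcases lt_trichotomy (a i) z with h | h | h
      · have := omegaDE_lt (ha i).1 h hi.2
        rw [ha0, h0] at this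
        exact absurd this (lt_irrefl _)
      · exact h
      · have := omegaDE_lt hi.1 h (ha i).2
        rw [ha0, h0] at this
        exact absurd this (lt_irrefl _)
  have : zHat = a := nthSmallest_eq_of_strictMono hmono hrange
  rw [this]
  exact ⟨hmono, hrange, ha⟩

theorem zHat_pos (i : ℕ) : 0 < zHat i := (zStar_pos i).trans (zHat_spec.2.2 i).1

theorem omegaDE_zHat (i : ℕ) : omegaDE (zHat i) = 0 := by
  have h : zHat i ∈ omegaDEZeros := zHat_spec.2.1 ▸ mem_range_self i
  exact h.2.2

theorem lamHat_pos (i : ℕ) : 0 < lamHat i := one_div_pos.2 (zHat_pos i)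

theorem lamHat_injective : Function.Injective lamHat := fun i j h =>
  zHat_spec.1.injective (by simpa [lamHat] using h)

theorem muSq_ne_lamHat (p : ℕ × ℕ) (i : ℕ) : muSq p ≠ lamHat i := fun h =>
  not_mem_poles_of_mem_Ioo (zHat_spec.2.2 i)
    (mem_poles_iff.2 ⟨p, by rw [h, lamHat, one_div_one_div]⟩)

/-- The secular equation in terms of eigenvalues. -/
theorem secTerm_one_div {l : ℝ} (hl : 0 < l) (p : ℕ × ℕ) :
    secTerm (1 / l) p = -(bSq p ^ 2 / (muSq p - l)) := by
  rw [secTerm, show 1 - muSq p * (1 / l) = -((muSq p - l) / l) by field_simp; ring]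
  rw [div_neg, div_div_div_cancel_right₀ hl.ne', mul_neg, mul_one_div]

theorem tsum_lamHat (i : ℕ) : 36 * ∑' p, bSq p ^ 2 / (muSq p - lamHat i) = 1 := by
  have h := omegaDE_zHat i
  have e : zHat i = 1 / lamHat i := by rw [lamHat, one_div_one_div]
  rw [e, omegaDE_eq, tsum_congr fun p => secTerm_one_div (lamHat_pos i) p, tsum_neg] at h
  linarith

theorem exists_le_abs_muSq_sub_lamHat (i : ℕ) : ∃ δ > 0, ∀ p, δ ≤ |muSq p - lamHat i| := by
  obtain ⟨δ, hδ, h⟩ := exists_le_abs_one_sub (zHat_spec.2.2 i).1 (zHat_spec.2.2 i).2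
  have hz := zHat_pos i
  refine ⟨δ / zHat i, by positivity, fun p => ?_⟩
  have h1 := h p (zHat i) ⟨le_rfl, le_rfl⟩
  have e : muSq p - lamHat i = -((1 - muSq p * zHat i) / zHat i) := by
    rw [lamHat]; field_simp; ring
  rw [e, abs_neg, abs_div, abs_of_pos hz]
  gcongr

/-- The coefficients of the eigenfunction belonging to `lamHat i`. -/
noncomputable def hatCoef (i : ℕ) (p : ℕ × ℕ) : ℝ := bSq p / (muSq p - lamHat i)

theorem summable_hatCoef_sq (i : ℕ) : Summable fun p => hatCoef i p ^ 2 := by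
  obtain ⟨δ, hδ, h⟩ := exists_le_abs_muSq_sub_lamHat i
  refine Summable.of_nonneg_of_le (fun p => sq_nonneg _) (fun p => ?_)
    (summable_bSq_sq.mul_right (1 / δ ^ 2))
  rw [hatCoef, div_pow, mul_one_div]
  have := h p
  rw [← sq_abs (muSq p - lamHat i)]
  gcongr

theorem hatCoef_ne_zero (i : ℕ) (p : ℕ × ℕ) : hatCoef i p ≠ 0 :=
  div_ne_zero (bSq_ne_zero p) (sub_ne_zero.2 (muSq_ne_lamHat p i))

/-! ### The span of the functions `χ_ℓ ⊗ χ_m` -/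

/-- The closed linear span of the functions `χ_ℓ ⊗ χ_m`. -/
noncomputable def chiSpan : Submodule ℝ H2 := (Submodule.span ℝ (range chiSq)).topologicalClosure

theorem mem_Lspace_iff {l : ℝ} {f : H2} : f ∈ Lspace l ↔ f ∈ chiSpan ∧ opDE f = l • f := by
  rw [Lspace, Submodule.mem_inf, Module.End.mem_eigenspace_iff]
  rfl

theorem chiSq_mem_chiSpan (p : ℕ × ℕ) : chiSq p ∈ chiSpan :=
  Submodule.le_topologicalClosure _ (Submodule.subset_span (mem_range_self p))

theorem mem_chiSpan_of_hasSum {a : ℕ × ℕ → ℝ} {f : H2} (h : HasSum (fun p => a p • chiSq p) f) :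
    f ∈ chiSpan :=
  (Submodule.isClosed_topologicalClosure _).mem_of_tendsto h (Filter.Eventually.of_forall fun _ =>
    chiSpan.sum_mem fun p _ => chiSpan.smul_mem _ (chiSq_mem_chiSpan p))

theorem inner_eq_zero_of_mem_chiSpan {f h : H2} (hf : f ∈ chiSpan)
    (hh : ∀ p, ⟪chiSq p, h⟫ = 0) : ⟪h, f⟫ = 0 := by
  have h1 : chiSpan ≤ (ℝ ∙ h)ᗮ := by
    refine Submodule.topologicalClosure_minimal _ (Submodule.span_le.2 ?_)
      (Submodule.isClosed_orthogonal _)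
    rintro _ ⟨p, rfl⟩
    rw [SetLike.mem_coe, Submodule.mem_orthogonal_singleton_iff_inner_left]
    exact hh p
  exact Submodule.mem_orthogonal_singleton_iff_inner_right.1 (h1 hf)

theorem hasSum_of_mem_chiSpan {f : H2} (hf : f ∈ chiSpan) :
    HasSum (fun p => ⟪chiSq p, f⟫ • chiSq p) f :=
  hasSum_inner_smul_of_forall_orthogonal orthonormal_chiSq fun _ hh =>
    inner_eq_zero_of_mem_chiSpan hf hh

theorem hasSum_inner_cidSq {a : ℕ × ℕ → ℝ} {f : H2} (h : HasSum (fun p => a p • chiSq p) f) :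
    HasSum (fun p => a p * bSq p) ⟪cidSq, f⟫ := by
  have := h.mapL (innerSL ℝ cidSq)
  simpa [inner_smul_right, inner_cidSq_chiSq] using this

theorem hasSum_opSq {a : ℕ × ℕ → ℝ} {f : H2} (h : HasSum (fun p => a p • chiSq p) f) :
    HasSum (fun p => (a p * muSq p) • chiSq p) (opSq f) := by
  have := h.mapL opSq
  simpa [opSq_chiSq, smul_smul] using this

/-! ### The spaces `L_λ` -/

/-- At the index `p` the left side of the coefficient equation vanishes, while `bSq p` does not. On
eigenfunctions for elements of Λ the perturbation is therefore invisible. -/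
theorem inner_cidSq_eq_zero {f : H2} {p : ℕ × ℕ} (hf : opDE f = muSq p • f) : ⟪cidSq, f⟫ = 0 := by
  have h := sub_mul_inner_chiSq hf p
  rw [sub_self, zero_mul] at h
  have h2 := (mul_eq_zero.1 h.symm).resolve_right (bSq_ne_zero p)
  linarith

theorem inner_chiSq_eq_zero {f : H2} {p q : ℕ × ℕ} (hf : opDE f = muSq p • f)
    (hq : muSq q ≠ muSq p) : ⟪chiSq q, f⟫ = 0 := by
  have h := sub_mul_inner_chiSq hf q
  rw [inner_cidSq_eq_zero hf, mul_zero, zero_mul] at h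
  exact (mul_eq_zero.1 h).resolve_left (sub_ne_zero.2 hq)

theorem opDE_of_hasSum {a : ℕ × ℕ → ℝ} {f : H2} {l : ℝ} (h : HasSum (fun p => a p • chiSq p) f)
    (ha : ∀ p, muSq p ≠ l → a p = 0) (hf : ⟪cidSq, f⟫ = 0) : opDE f = l • f := by
  rw [opDE_apply, hf, mul_zero, zero_smul, sub_zero]
  refine (hasSum_opSq h).unique ?_
  convert h.const_smul l using 2 with p
  rw [smul_smul]
  by_cases hp : muSq p = l
  · rw [hp, mul_comm]
  · rw [ha p hp, zero_mul, mul_zero]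

theorem finite_Nset {l : ℝ} (hl : 0 < l) : (Nset l).Finite :=
  (finite_le_muSq hl).subset fun _ hp => le_of_eq (Eq.symm hp)

/-- Only coefficients indexed by N_λ can be non-zero, and such a finite combination is an
eigenfunction exactly when it is orthogonal to `cidSq`. Thus L_λ is a copy of the kernel of the
non-zero functional α ↦ ∑ α_p b_p on ℝ^{N_λ}. -/
theorem finrank_Lspace (p₀ : ℕ × ℕ) : FiniteDimensional ℝ (Lspace (muSq p₀)) ∧
    Module.finrank ℝ (Lspace (muSq p₀)) + 1 = (Nset (muSq p₀)).ncard := by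
  classical
  set l := muSq p₀ with hl
  have : Fintype (Nset l) := (finite_Nset (muSq_pos p₀)).fintype
  set Φ := Fintype.linearCombination ℝ (fun p : Nset l => chiSq p) with hΦ
  set ψ : Module.Dual ℝ (Nset l → ℝ) := Fintype.linearCombination ℝ (fun p : Nset l => bSq p)
    with hψ
  have hinj : Function.Injective Φ :=
    linearIndependent_iff_injective_fintypeLinearCombination.1
      (orthonormal_chiSq.comp _ Subtype.val_injective).linearIndependent
  have hsum : ∀ α : Nset l → ℝ,
      HasSum (fun p => (if h : p ∈ Nset l then α ⟨p, h⟩ else 0) • chiSq p) (Φ α) := fun α => by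
    refine (Subtype.val_injective (p := (· ∈ Nset l)).hasSum_iff fun p hp => ?_).1 ?_
    · rw [Subtype.range_val] at hp
      rw [dif_neg hp, zero_smul]
    · convert hasSum_fintype (fun p : Nset l => α p • chiSq p) using 2 with p
      · rw [Function.comp_apply, dif_pos p.2]
      · rfl
  have hcid : ∀ α, ⟪cidSq, Φ α⟫ = ψ α := fun α => by
    rw [hΦ, hψ, Fintype.linearCombination_apply, Fintype.linearCombination_apply, inner_sum]
    refine Finset.sum_congr rfl fun p _ => ?_
    rw [real_inner_smul_right, inner_cidSq_chiSq, smul_eq_mul]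
  have heq : Lspace l = (LinearMap.ker ψ).map Φ := by
    ext f
    rw [mem_Lspace_iff, Submodule.mem_map]
    constructor
    · rintro ⟨h1, h2⟩
      have h3 : Φ (fun p => ⟪chiSq p, f⟫) = f := by
        refine (hsum _).unique ?_
        convert hasSum_of_mem_chiSpan h1 using 3 with p
        split_ifs with h
        · rfl
        · exact (inner_chiSq_eq_zero h2 h).symm
      refine ⟨_, ?_, h3⟩
      rw [LinearMap.mem_ker, ← hcid, h3]
      exact inner_cidSq_eq_zero h2
    · rintro ⟨α, hα, rfl⟩
      refine ⟨mem_chiSpan_of_hasSum (hsum α), opDE_of_hasSum (hsum α) (fun p hp => dif_neg hp) ?_⟩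
      rw [hcid]
      exact hα
  have hψ0 : ψ ≠ 0 := fun h => by
    have h1 : ψ (Pi.single ⟨p₀, rfl⟩ 1) = bSq p₀ := by
      rw [hψ, Fintype.linearCombination_apply_single, one_smul]
    rw [h, LinearMap.zero_apply] at h1
    exact bSq_ne_zero p₀ h1.symm
  have h1 := Module.Dual.finrank_ker_add_one_of_ne_zero hψ0
  rw [heq]
  refine ⟨inferInstance, ?_⟩
  rw [← (Submodule.equivMapOfInjective Φ hinj (LinearMap.ker ψ)).finrank_eq, h1,
    Module.finrank_fintype_fun_eq_card, ← Nat.card_eq_fintype_card, Nat.card_coe_set_eq]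

/-- For λ in Λ but not in Λ_<, all representations are diagonal, and injectivity of `mu` leaves only
one. The dimension #N_λ - 1 is then 0, so omitting these λ from the eigensystem loses nothing. -/
theorem Lspace_eq_bot {p₀ : ℕ × ℕ} (h : muSq p₀ ∉ LamLt) : Lspace (muSq p₀) = ⊥ := by
  have hdiag : ∀ p : ℕ × ℕ, muSq p = muSq p₀ → p.1 = p.2 := fun p hp => by
    by_contra hne
    rcases lt_or_gt_of_ne hne with hlt | hlt
    · exact h ⟨p.1, p.2, hlt, hp⟩
    · exact h ⟨p.2, p.1, hlt, (mul_comm _ _).trans hp⟩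
  have hN : Nset (muSq p₀) = {p₀} := by
    ext p
    rw [mem_singleton_iff]
    refine ⟨fun hp => ?_, fun hp => hp ▸ rfl⟩
    have hp' : muSq p = muSq p₀ := hp
    have h1 := hdiag p hp'
    have h2 := hdiag p₀ rfl
    rw [muSq, muSq, ← h1, ← h2] at hp'
    have h3 := mu_injective ((mul_self_inj (mu_pos _).le (mu_pos _).le).1 hp')
    exact Prod.ext h3 (by rw [← h1, ← h2, h3])
  obtain ⟨h1, h2⟩ := finrank_Lspace p₀
  rw [hN, ncard_singleton] at h2
  exact Submodule.finrank_eq_zero.1 (by omega)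

/-! ### The eigenfunctions belonging to the zeros of the secular function -/

/-- The unnormalized eigenfunction belonging to `lamHat i`. -/
noncomputable def hatVec (i : ℕ) : H2 := ∑' p, fHatTerm i p

theorem summable_fHatTerm (i : ℕ) : Summable (fHatTerm i) :=
  summable_smul_of_orthonormal orthonormal_chiSq (summable_hatCoef_sq i)

theorem hasSum_hatVec (i : ℕ) : HasSum (fun p => hatCoef i p • chiSq p) (hatVec i) :=
  (summable_fHatTerm i).hasSum

theorem inner_chiSq_hatVec (i : ℕ) (p : ℕ × ℕ) : ⟪chiSq p, hatVec i⟫ = hatCoef i p :=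
  inner_tsum_of_orthonormal orthonormal_chiSq (summable_hatCoef_sq i) p

theorem hatVec_ne_zero (i : ℕ) : hatVec i ≠ 0 := fun h => by
  have h1 := inner_chiSq_hatVec i (0, 0)
  rw [h, inner_zero_right] at h1
  exact hatCoef_ne_zero i _ h1.symm

theorem inner_cidSq_hatVec (i : ℕ) : 36 * ⟪cidSq, hatVec i⟫ = 1 := by
  rw [← tsum_lamHat i, ← (hasSum_inner_cidSq (hasSum_hatVec i)).tsum_eq]
  congr 1
  refine tsum_congr fun p => ?_
  rw [hatCoef]
  ring

/-- The secular equation normalizes 36 ⟨c ⊗ c, f⟩ to 1, so exactly c ⊗ c is subtracted; then μ b/(μ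
- λ) - b = λ b/(μ - λ) coefficientwise. -/
theorem opDE_hatVec (i : ℕ) : opDE (hatVec i) = lamHat i • hatVec i := by
  rw [opDE_apply, inner_cidSq_hatVec, one_smul]
  refine ((hasSum_opSq (hasSum_hatVec i)).sub hasSum_cidSq).unique ?_
  convert (hasSum_hatVec i).const_smul (lamHat i) using 2 with p
  rw [← sub_smul, smul_smul]
  congr 1
  have := sub_ne_zero.2 (muSq_ne_lamHat p i)
  rw [hatCoef]
  field_simp
  ring

/-! ### Completeness -/

/-- Orthogonality to the tensor products that involve some `φ_j`. -/
def OrthPhi (h : H2) : Prop :=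
  (∀ j k, ⟪eSq (.inl j, k), h⟫ = 0) ∧ ∀ j k, ⟪eSq (j, .inl k), h⟫ = 0

/-- An eigenfunction with non-zero eigenvalue lies in the closed span of the `eSq`, since `opDE`
kills the complement. In its inner product with `h` the terms with some φ_j drop out. -/
theorem hasSum_inner_of_orthPhi {f h : H2} {l : ℝ} (hl : l ≠ 0) (hf : opDE f = l • f)
    (hh : OrthPhi h) : HasSum (fun p => ⟪chiSq p, f⟫ * ⟪chiSq p, h⟫) ⟪h, f⟫ := by
  have h1 := hasSum_inner_smul_of_forall_orthogonal orthonormal_eSq (f := f) fun g hg =>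
    inner_eq_zero_of_opDE_eq_smul hl hf hg
  have h2 := h1.mapL (innerSL ℝ h)
  have hinj : Function.Injective fun p : ℕ × ℕ => ((.inr p.1, .inr p.2) : (ℕ ⊕ ℕ) × (ℕ ⊕ ℕ)) :=
    fun p q h => by simpa [Prod.ext_iff] using h
  have h3 := (hinj.hasSum_iff (f := fun p => innerSL ℝ h (⟪eSq p, f⟫ • eSq p)) fun p hp => by
    rw [map_smul, innerSL_apply_apply, real_inner_comm (eSq _) h]
    rcases p with ⟨j | j, k | k⟩
    · rw [hh.1, smul_zero]
    · rw [hh.1, smul_zero]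
    · rw [hh.2, smul_zero]
    · exact absurd ⟨(j, k), rfl⟩ hp).2 h2
  have e : (fun p => ⟪chiSq p, f⟫ * ⟪chiSq p, h⟫) =
      (fun p => innerSL ℝ h (⟪eSq p, f⟫ • eSq p)) ∘
        fun p : ℕ × ℕ => ((.inr p.1, .inr p.2) : (ℕ ⊕ ℕ) × (ℕ ⊕ ℕ)) := by
    funext p
    rw [Function.comp_apply, map_smul, innerSL_apply_apply, ← chiSq_eq, real_inner_comm h,
      smul_eq_mul]
  rw [e]
  exact h3

theorem orthPhi_cidSq : OrthPhi cidSq :=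
  ⟨fun j k => by rw [real_inner_comm, inner_cidSq_inl_left],
    fun j k => by rw [real_inner_comm, inner_cidSq_inl_right]⟩

theorem hasSum_inner_cidSq_of_opDE {f : H2} {l : ℝ} (hl : l ≠ 0) (hf : opDE f = l • f) :
    HasSum (fun p => ⟪chiSq p, f⟫ * bSq p) ⟪cidSq, f⟫ := by
  convert hasSum_inner_of_orthPhi hl hf orthPhi_cidSq using 3 with p
  rw [real_inner_comm, inner_cidSq_chiSq]

/-- By the spectral theorem it is enough to test `h` against an arbitrary eigenfunction f with l >
0. Its component in the χ ⊗ χ span is in some L_λ, zero, or a multiple of some `hatVec i`. -/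
theorem opDE_eq_zero_of_forall {h : H2} (hphi : OrthPhi h)
    (hL : ∀ l ∈ LamLt, ∀ f ∈ Lspace l, ⟪h, f⟫ = 0) (hhat : ∀ i, ⟪h, hatVec i⟫ = 0) :
    opDE h = 0 := by
  refine apply_eq_zero_of_orthogonal_eigenvectors isCompactOperator_opDE isSymmetric_opDE
    fun l f hl hf => ?_
  by_cases hfz : f = 0
  · simp [hfz]
  have hl0 : 0 < l := by
    have h1 := inner_opDE_nonneg f
    rw [hf, real_inner_smul_right, real_inner_self_eq_norm_sq] at h1
    have h2 : 0 < ‖f‖ ^ 2 := by positivity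
    exact lt_of_le_of_ne (nonneg_of_mul_nonneg_left h1 h2) hl.symm
  have hs := hasSum_inner_of_orthPhi hl hf hphi
  by_cases hlam : ∃ p, muSq p = l
  · obtain ⟨p, rfl⟩ := hlam
    -- g is the projection of f on the χ ⊗ χ span. The eigenvalue may also belong to products with
    -- some φ_j, so f itself need not be in L_λ, but `h` does not see that part.
    obtain ⟨g, hg⟩ := summable_smul_of_orthonormal orthonormal_chiSq
      (summable_sq_inner_of_orthonormal orthonormal_chiSq f)
    have hgc : ⟪cidSq, g⟫ = 0 := by
      rw [← inner_cidSq_eq_zero hf]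
      exact (hasSum_inner_cidSq hg).unique (hasSum_inner_cidSq_of_opDE hl hf)
    have hgL : g ∈ Lspace (muSq p) := mem_Lspace_iff.2 ⟨mem_chiSpan_of_hasSum hg,
      opDE_of_hasSum hg (fun q hq => inner_chiSq_eq_zero hf hq) hgc⟩
    have hgh : ⟪h, f⟫ = ⟪h, g⟫ := by
      refine hs.unique ?_
      have := hg.mapL (innerSL ℝ h)
      simpa [inner_smul_right, real_inner_comm h] using this
    rw [hgh]
    by_cases hlt : muSq p ∈ LamLt
    · exact hL _ hlt g hgL
    · rw [Lspace_eq_bot hlt, Submodule.mem_bot] at hgL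
      rw [hgL, inner_zero_right]
  · push Not at hlam
    have hcoef : ∀ p, ⟪chiSq p, f⟫ = 36 * ⟪cidSq, f⟫ * (bSq p / (muSq p - l)) := fun p => by
      rw [← mul_div_assoc, eq_div_iff (sub_ne_zero.2 (hlam p)), mul_comm, sub_mul_inner_chiSq hf]
    by_cases hv : ⟪cidSq, f⟫ = 0
    · refine hs.unique ?_
      convert hasSum_zero using 2 with p
      rw [hcoef, hv, mul_zero, zero_mul, zero_mul]
    -- Multiplying the coefficients by `bSq p` and summing reproduces ⟨c ⊗ c, f⟩ on both sides;
    -- cancelling it leaves the secular equation.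
    have hsec : 36 * ∑' p, bSq p ^ 2 / (muSq p - l) = 1 := by
      have h1 := (hasSum_inner_cidSq_of_opDE hl hf).tsum_eq
      rw [tsum_congr fun p => show ⟪chiSq p, f⟫ * bSq p =
        36 * ⟪cidSq, f⟫ * (bSq p ^ 2 / (muSq p - l)) by rw [hcoef]; ring, tsum_mul_left] at h1
      refine mul_right_cancel₀ hv ?_
      linarith
    have hzero : 1 / l ∈ omegaDEZeros := by
      refine ⟨one_div_pos.2 hl0, fun hmem => ?_, ?_⟩
      · obtain ⟨p, hp⟩ := mem_poles_iff.1 hmem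
        exact hlam p (by simpa using hp.symm)
      · rw [omegaDE_eq, tsum_congr fun p => secTerm_one_div hl0 p, tsum_neg]
        linarith
    rw [← zHat_spec.2.1] at hzero
    obtain ⟨i, hi⟩ := hzero
    have hli : lamHat i = l := by rw [lamHat, hi, one_div_one_div]
    -- The coefficients of f are those of `hatVec i` times 36 ⟨c ⊗ c, f⟩.
    have h1 : HasSum (fun p => ⟪chiSq p, f⟫ * ⟪chiSq p, h⟫)
        (36 * ⟪cidSq, f⟫ * ⟪h, hatVec i⟫) := by
      have h2 := ((hasSum_hatVec i).mapL (innerSL ℝ h)).mul_left (36 * ⟪cidSq, f⟫)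
      have e : (fun p => ⟪chiSq p, f⟫ * ⟪chiSq p, h⟫) =
          fun p => 36 * ⟪cidSq, f⟫ * innerSL ℝ h (hatCoef i p • chiSq p) := by
        funext p
        rw [hcoef, map_smul, innerSL_apply_apply, real_inner_comm h, hatCoef, hli, smul_eq_mul]
        ring
      rw [e]
      exact h2
    rw [hs.unique h1, hhat, mul_zero]

/-! ### The eigensystem -/

/-- The index in the eigensystem of `opSq` of those eigenfunctions that involve some `φ_j`. -/
def EigIndex.toPair : EigIndex → Option ((ℕ ⊕ ℕ) × (ℕ ⊕ ℕ))
  | .phiPhi j k => some (.inl j, .inl k)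
  | .phiChi j k => some (.inl j, .inr k)
  | .chiPhi j k => some (.inr j, .inl k)
  | .tau _ _ => none
  | .hat _ => none

section Eigensystem

variable (τ : ∀ l : LamLt, OrthonormalBasis (Fin (Module.finrank ℝ (Lspace l))) ℝ (Lspace l))
  (c : ℕ → ℝ)

theorem fHat_eq (i : ℕ) : fHat c i = c i • hatVec i := rfl

theorem eigFun_of_toPair_eq_some {x : EigIndex} {p : (ℕ ⊕ ℕ) × (ℕ ⊕ ℕ)}
    (h : x.toPair = some p) : eigFun τ c x = eSq p := by
  cases x with
  | phiPhi j k => obtain rfl := Option.some.inj h; exact (tens_vecI _ _).symm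
  | phiChi j k => obtain rfl := Option.some.inj h; exact (tens_vecI _ _).symm
  | chiPhi j k => obtain rfl := Option.some.inj h; exact (tens_vecI _ _).symm
  | tau l j => cases h
  | hat i => cases h

theorem toPair_ne_inr {x : EigIndex} {p : (ℕ ⊕ ℕ) × (ℕ ⊕ ℕ)} (h : x.toPair = some p)
    (q : ℕ × ℕ) : (.inr q.1, .inr q.2) ≠ p := by
  cases x <;> cases h <;> simp

theorem eq_of_toPair_eq_some {x y : EigIndex} {p : (ℕ ⊕ ℕ) × (ℕ ⊕ ℕ)}
    (hx : x.toPair = some p) (hy : y.toPair = some p) : x = y := by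
  cases x <;> cases hx <;> cases y <;> cases hy <;> rfl

theorem eigFun_mem_chiSpan {x : EigIndex} (h : x.toPair = none) : eigFun τ c x ∈ chiSpan := by
  cases x with
  | phiPhi j k => cases h
  | phiChi j k => cases h
  | chiPhi j k => cases h
  | tau l j => exact (mem_Lspace_iff.1 (τ l j).2).1
  | hat i => exact chiSpan.smul_mem _ (mem_chiSpan_of_hasSum (hasSum_hatVec i))

theorem opDE_eigFun (x : EigIndex) : opDE (eigFun τ c x) = (6 * eigVal x) • eigFun τ c x := by
  have hp := Real.pi_ne_zero
  cases x with
  | phiPhi j k =>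
    rw [eigFun_of_toPair_eq_some τ c (x := .phiPhi j k) rfl, opDE_inl_left]
    congr 1
    simp only [evSq, evI, eigVal, nu]
    field_simp
    ring
  | phiChi j k =>
    rw [eigFun_of_toPair_eq_some τ c (x := .phiChi j k) rfl, opDE_inl_left]
    congr 1
    simp only [evSq, evI, eigVal, nu]
    field_simp
    ring
  | chiPhi j k =>
    rw [eigFun_of_toPair_eq_some τ c (x := .chiPhi j k) rfl, opDE_inl_right]
    congr 1
    simp only [evSq, evI, eigVal, nu]
    field_simp
    ring
  | tau l j =>
    have h := (mem_Lspace_iff.1 (τ l j).2).2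
    show opDE (τ l j : H2) = (6 * (1 / 6 * (l : ℝ))) • (τ l j : H2)
    rw [h]
    congr 1
    ring
  | hat i =>
    show opDE (c i • hatVec i) = (6 * (1 / 6 * lamHat i)) • (c i • hatVec i)
    rw [map_smul, opDE_hatVec, smul_comm]
    congr 1
    ring

theorem eigVal_pos (x : EigIndex) : 0 < eigVal x := by
  have hp := Real.pi_pos
  cases x with
  | phiPhi j k => unfold eigVal; positivity
  | phiChi j k => have := mu_pos k; unfold eigVal; positivity
  | chiPhi j k => have := mu_pos j; unfold eigVal; positivity
  | tau l j =>
    obtain ⟨_, a, b, _, rfl⟩ := l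
    exact mul_pos (by norm_num) (mul_pos (mu_pos a) (mu_pos b))
  | hat i => exact mul_pos (by norm_num) (lamHat_pos i)

variable {c}

/-- Members with some φ_j are distinct `eSq` and are orthogonal to the χ ⊗ χ span, whatever their
eigenvalues. Within that span, different eigenvalues give orthogonality: `lamHat` is injective and
avoids Λ, and equal λ are handled by the chosen basis. -/
theorem orthonormal_eigFun (hc : ∀ i, ‖fHat c i‖ = 1) : Orthonormal ℝ (eigFun τ c) := by
  have hmix : ∀ (x y : EigIndex) p, x.toPair = some p → y.toPair = none →
      ⟪eigFun τ c x, eigFun τ c y⟫ = 0 := fun x y p hx hy => by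
    rw [eigFun_of_toPair_eq_some τ c hx]
    refine inner_eq_zero_of_mem_chiSpan (eigFun_mem_chiSpan τ c hy) fun q => ?_
    rw [chiSq_eq]
    exact orthonormal_eSq.2 (toPair_ne_inr hx q)
  refine ⟨fun x => ?_, fun x y hxy => ?_⟩
  · rcases hx : x.toPair with _ | p
    · cases x with
      | phiPhi j k => cases hx
      | phiChi j k => cases hx
      | chiPhi j k => cases hx
      | tau l j => exact (τ l).orthonormal.1 j
      | hat i => exact hc i
    · rw [eigFun_of_toPair_eq_some τ c hx]
      exact orthonormal_eSq.1 p
  · rcases hx : x.toPair with _ | p <;> rcases hy : y.toPair with _ | q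
    · have hne : eigVal x ≠ eigVal y → ⟪eigFun τ c x, eigFun τ c y⟫ = 0 := fun h =>
        inner_eq_zero_of_eigenvalue_ne isSymmetric_opDE (opDE_eigFun τ c x) (opDE_eigFun τ c y)
          fun h' => h (mul_left_cancel₀ (by norm_num) h')
      have hlam : ∀ (l : LamLt) i, (l : ℝ) ≠ lamHat i := by
        rintro ⟨_, a, b, _, rfl⟩ i
        exact muSq_ne_lamHat (a, b) i
      cases x with
      | phiPhi j k => cases hx
      | phiChi j k => cases hx
      | chiPhi j k => cases hx
      | tau l j =>
        cases y with
        | phiPhi j k => cases hy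
        | phiChi j k => cases hy
        | chiPhi j k => cases hy
        | tau l' j' =>
          by_cases hl : l = l'
          · subst hl
            exact (τ l).orthonormal.2 fun h => hxy (by rw [h])
          · exact hne fun h => hl (Subtype.ext (mul_left_cancel₀ (by norm_num) h))
        | hat i => exact hne fun h => hlam l i (mul_left_cancel₀ (by norm_num) h)
      | hat i =>
        cases y with
        | phiPhi j k => cases hy
        | phiChi j k => cases hy
        | chiPhi j k => cases hy
        | tau l j => exact hne fun h => hlam l i (mul_left_cancel₀ (by norm_num) h).symm
        | hat i' =>
          exact hne fun h => hxy (congrArg _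
            (lamHat_injective (mul_left_cancel₀ (by norm_num) h)))
    · rw [real_inner_comm]
      exact hmix y x q hy hx
    · exact hmix x y p hx hy
    · rw [eigFun_of_toPair_eq_some τ c hx, eigFun_of_toPair_eq_some τ c hy]
      refine orthonormal_eSq.2 fun h => hxy ?_
      subst h
      exact eq_of_toPair_eq_some hx hy

theorem isCompleteEigensystem_eigFun (hc : ∀ i, ‖fHat c i‖ = 1) :
    IsCompleteEigensystem KDE (eigFun τ c) eigVal := by
  have hK : ∀ f, opDE f = (6 : ℝ) • KDE f := fun f => rfl
  have heig : ∀ x, KDE (eigFun τ c x) = eigVal x • eigFun τ c x := fun x => by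
    have h := opDE_eigFun τ c x
    rw [hK, mul_smul] at h
    exact smul_right_injective H2 (by norm_num : (6 : ℝ) ≠ 0) h
  refine ⟨orthonormal_eigFun τ hc, eigVal_pos, heig, fun f => ?_⟩
  refine hasSum_of_eigenvectors (orthonormal_eigFun τ hc) heig (fun h hh => ?_) f
  have hpair : ∀ (x : EigIndex) p, x.toPair = some p → ⟪eSq p, h⟫ = 0 := fun x p hx => by
    rw [← eigFun_of_toPair_eq_some τ c hx]
    exact hh x
  have h0 : opDE h = 0 := by
    refine opDE_eq_zero_of_forall ⟨fun j k => ?_, fun j k => ?_⟩ (fun l hl f hf => ?_) fun i => ?_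
    · rcases k with k | k
      · exact hpair (.phiPhi j k) _ rfl
      · exact hpair (.phiChi j k) _ rfl
    · rcases j with j | j
      · exact hpair (.phiPhi j k) _ rfl
      · exact hpair (.chiPhi j k) _ rfl
    -- Orthogonality to the basis of L_λ extends to all of L_λ by expanding f in that basis.
    · have h1 := congrArg (Subtype.val) ((τ ⟨l, hl⟩).sum_repr ⟨f, hf⟩)
      rw [← show _ = f from h1, Submodule.coe_sum, inner_sum]
      refine Finset.sum_eq_zero fun j _ => ?_
      rw [Submodule.coe_smul, real_inner_smul_right, real_inner_comm,
        show ⟪(τ ⟨l, hl⟩ j : H2), h⟫ = 0 from hh (.tau ⟨l, hl⟩ j), mul_zero]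
    · have h1 : ⟪c i • hatVec i, h⟫ = 0 := hh (.hat i)
      -- The normalization excludes a zero constant, so orthogonality to `fHat c i` passes to
      -- `hatVec i`.
      have hci : c i ≠ 0 := fun h => by
        have := hc i
        rw [fHat_eq, h, zero_smul, norm_zero] at this
        exact zero_ne_one this
      rw [real_inner_smul_left] at h1
      rw [real_inner_comm]
      exact (mul_eq_zero.1 h1).resolve_left hci
  rw [hK] at h0
  exact (smul_eq_zero.1 h0).resolve_left (by norm_num)

end Eigensystem

end PatternDE

theorem proposition3p9 :
    -- the enumerations are what their definitions say
    (StrictMono gam ∧ Set.range gam = omegaZeros) ∧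
    (StrictMono zStar ∧ Set.range zStar = poles) ∧
    (StrictMono zHat ∧ Set.range zHat = omegaDEZeros ∧
      ∀ i, zHat i ∈ Set.Ioo (zStar i) (zStar (i + 1))) ∧
    -- the dimension of `L_λ` is `#N_λ - 1`, for `λ ∈ Λ_<`
    (∀ l ∈ LamLt, (Nset l).Finite ∧ FiniteDimensional ℝ (Lspace l) ∧
      Module.finrank ℝ (Lspace l) + 1 = (Nset l).ncard) ∧
    -- the series for the remaining eigenfunctions converge to non-zero functions
    (∀ i, Summable (fHatTerm i) ∧ ∑' p, fHatTerm i p ≠ 0) ∧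
    -- the eigensystem
    ∀ (τ : ∀ l : LamLt, OrthonormalBasis (Fin (Module.finrank ℝ (Lspace l))) ℝ (Lspace l))
      (c : ℕ → ℝ), (∀ i, ‖fHat c i‖ = 1) →
      IsCompleteEigensystem KDE (eigFun τ c) eigVal := by
  refine ⟨strictMono_range_gam, strictMono_range_zStar, zHat_spec, ?_,
    fun i => ⟨summable_fHatTerm i, hatVec_ne_zero i⟩,
    fun τ _ hc => isCompleteEigensystem_eigFun τ hc⟩
  rintro _ ⟨j, k, _, rfl⟩
  exact ⟨finite_Nset (muSq_pos (j, k)), finrank_Lspace (j, k)⟩
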